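/- **Conventions.** Let $G$ be a finite multigraph (several components, multiple edges and self-loops allowed) with vertex set $\mathcal V(G)$, edge set $\mathcal E(G)$, an arbitrary orientation of the edges, and a variable $\alpha_e$ for each edge $e$. Order $\mathcal E(G)\cup\mathcal V(G)$ by a bijection $\iota$ to $\{1,\dots,|\mathcal E(G)|+|\mathcal V(G)|\}$. The expanded Laplacian $L(G)$ is the symmetric matrix with rows and columns labelled by $\mathcal E(G)\cup\mathcal V(G)$ whose entry at $(e,e)$ is $\alpha_e$, whose entries at $(e,u)$ and $(u,e)$ are $1$ (respectively $-1$) if the non-self-loop edge $e$ begins (respectively ends) in the vertex $u$, and whose other entries are $0$. For words $I,J$ of equal length in $\mathcal E(G)$, $K\subseteq\mathcal E(G)$, and a vertex $v$, the Dodgson polynomial is $$\Psi^{I,J}_K(G)=(-1)^{|\mathcal V(G)|-1+\sum_{i\in I}\iota_i+\sum_{j\in J}\iota_j}\,\mathrm{sgn}(Iv)\,\mathrm{sgn}(Jv)\,\det L^{Iv,Jv}_K(G)\in\mathbb Z[\alpha_e],$$ where $L^{Iv,Jv}_K$ is $L(G)$ with rows $Iv$ and columns $Jv$ removed and $\alpha_k=0$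 for $k\in K$, and $\mathrm{sgn}(W)$ is the sign of the permutation that orders the word $W$ with respect to $\iota$ ($0$ if $W$ has a repeated letter). It does not depend on $\iota$ or $v$. Empty indices are omitted. Let $\mathbb Z[\mathcal G]$ be the free abelian group on graphs. Write $G\backslash e$ and $G/e$ for deletion and contraction of an edge, with $G/e=0$ if $e$ is a self-loop; these operations and $\Psi^{I,J}_K$ are extended linearly to $\mathbb Z[\mathcal G]$. *Quadratic denominator reduction* of $G$ along a sequence $1,2,\dots$ of distinct edges: ${}^3\Psi^2_G(1,2,3)=[\Psi^{13,23}(G)\Psi^{1,2}_3(G)]^2$. For $n\ge3$, if ${}^n\Psi^2_G=(A\alpha_{n+1}^2+B\alpha_{n+1}+C)^2$ then ${}^{n+1}\Psi^2_G=B^2-4AC$; if ${}^n\Psi^2_G=(A\alpha_{n+1}^2+B\alpha_{n+1}+C)(D\alpha_{n+1}+E)^2$ then ${}^{n+1}\Psi^2_G=AE^2-BDE+CD^2$ (here $A,\dots,E$ are integer polynomials not involving $\alpha_{n+1}$); otherwise the reduction terminates. If it exists, ${}^n\Psi^2_G(1,\dots,n)$ is called the quadratic $n$-invariant of $G$ for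 the sequence. **Lemma.** In the following, a vertex $ijk$ is a vertex of degree $3$ without self-loops whose edges are the distinct edges $i,j,k$. Let $G$ contain a vertex $ABC$ which is oriented (the edges $A,B,C$ are all outgoing or all ingoing). Assume that one of the following holds, where all the edges named are pairwise distinct: 1. $G$ has vertices $123$ and $abc$; put $n=9$, $H=G/1a$; 2. $G$ has vertices $123$, $145$ (joined by the edge $1$) and $abc$; put $n=11$, $H=G\backslash4/15a-G\backslash5/14a$; 3. $G$ has vertices $123$, $145$ (joined by the edge $1$) and $abc$, $ade$ (joined by the edge $a$); put $n=13$, $H=G\backslash4d/15ae-G\backslash5d/14ae-G\backslash4e/15ad+G\backslash5e/14ad$. The endpoints of the remaining edges are otherwise arbitrary. Let $G_0$ be $G$ without the vertices listed in the respective item ($ABC$ is kept) and without their edges. Define $$f_0=\Psi^{AB,AB}_C,\quad f_A=\Psi^{B,C}_A,\quad f_B=\Psi^{A,C}_B,\quad f_C=\Psi^{A,B}_C,\quad f_{ABC}=\Psi_{ABC}\quad\text{at }G_0,$$ $$g_0=\Psi^{23AB,bcAB}_C,\quad g_A=\Psi^{23A,bcA}_{BC},\quad g_B=\Psi^{23B,bcB}_{AC},\quad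 g_C=\Psi^{23C,bcC}_{AB}\quad\text{at }H.$$ Then $g_0,g_A,g_B,g_C$ are the coefficients of $\alpha_A\alpha_B$, $\alpha_A$, $\alpha_B$, $\alpha_C$ in $\Psi^{23,bc}(H)$ (as a polynomial in $\alpha_A,\alpha_B,\alpha_C$). Moreover, for every sequence of edges that consists of $2,b,3,c,1,a$ in any order, followed by $4,5$ in cases 2 and 3, by $d,e$ in case 3, and finally by $A,B,C$, the quadratic $n$-invariant of $G$ exists (so there are at least nine reductions), it is unique, and it equals $${}^n\Psi^2_G=f_0\big[f_0\,\lambda(g_A,g_B,g_C)-4g_0(f_Ag_A+f_Bg_B+f_Cg_C+f_{ABC}\,g_0)\big],$$ where $\lambda(x,y,z)=(x-y-z)^2-4yz$ is the Källén function. -/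

import Mathlib

open MvPolynomial

/-- A finite directed multigraph (several components, multiple edges and self-loops are allowed)
with vertices named in `V` and edges named in `E`.  Edge `e` runs from `src e` to `tgt e`. -/
structure Multigraph (V E : Type*) where
  verts : Finset V
  edges : Finset E
  src : E → V
  tgt : E → V
  src_mem : ∀ e ∈ edges, src e ∈ verts
  tgt_mem : ∀ e ∈ edges, tgt e ∈ verts

/-- `ℤ[𝒢]`, the free abelian group on graphs. -/
abbrev GraphSum (V E : Type*) := FreeAbelianGroup (Multigraph V E)

namespace Multigraph

variable {V E : Type*} [DecidableEq V] [DecidableEq E]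

/-- The edges incident to the vertex `v` (self-loops at `v` included). -/
def incidentEdges (G : Multigraph V E) (v : V) : Finset E :=
  G.edges.filter fun e => G.src e = v ∨ G.tgt e = v

/-- `v` is a vertex of degree three without self-loops; its edges are the three distinct edges
`i`, `j`, `k`. -/
structure IsThreeValent (G : Multigraph V E) (v : V) (i j k : E) : Prop where
  mem : v ∈ G.verts
  distinct : [i, j, k].Nodup
  incident : G.incidentEdges v = {i, j, k}
  no_loop : ∀ e ∈ G.incidentEdges v, G.src e ≠ G.tgt e

/-- The non-self-loop edges incident to `v` are all outgoing or all ingoing. -/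
def IsOrientedAt (G : Multigraph V E) (v : V) : Prop :=
  (∀ e ∈ G.incidentEdges v, G.src e ≠ G.tgt e → G.src e = v) ∨
    (∀ e ∈ G.incidentEdges v, G.src e ≠ G.tgt e → G.tgt e = v)

/-- The graph without the vertices in `S` and without all edges incident to them. -/
def removeVerts (G : Multigraph V E) (S : Finset V) : Multigraph V E where
  verts := G.verts \ S
  edges := G.edges.filter fun e => G.src e ∉ S ∧ G.tgt e ∉ S
  src := G.src
  tgt := G.tgt
  src_mem e he := by
    rw [Finset.mem_filter] at he
    exact Finset.mem_sdiff.2 ⟨G.src_mem e he.1, he.2.1⟩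
  tgt_mem e he := by
    rw [Finset.mem_filter] at he
    exact Finset.mem_sdiff.2 ⟨G.tgt_mem e he.1, he.2.2⟩

/-- `G \ e`: the edge `e` is deleted. -/
def deleteEdge (G : Multigraph V E) (e : E) : Multigraph V E where
  verts := G.verts
  edges := G.edges.erase e
  src := G.src
  tgt := G.tgt
  src_mem f hf := G.src_mem f (Finset.mem_of_mem_erase hf)
  tgt_mem f hf := G.tgt_mem f (Finset.mem_of_mem_erase hf)

/-- The edge `e`, which is not a self-loop, is removed and its end point is identified with its
initial point. -/
def contractEdge (G : Multigraph V E) (e : E) (he : e ∈ G.edges ∧ G.src e ≠ G.tgt e) :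
    Multigraph V E where
  verts := G.verts.erase (G.tgt e)
  edges := G.edges.erase e
  src f := if G.src f = G.tgt e then G.src e else G.src f
  tgt f := if G.tgt f = G.tgt e then G.src e else G.tgt f
  src_mem f hf := by
    split_ifs with h
    · exact Finset.mem_erase.2 ⟨he.2, G.src_mem e he.1⟩
    · exact Finset.mem_erase.2 ⟨h, G.src_mem f (Finset.mem_of_mem_erase hf)⟩
  tgt_mem f hf := by
    split_ifs with h
    · exact Finset.mem_erase.2 ⟨he.2, G.src_mem e he.1⟩
    · exact Finset.mem_erase.2 ⟨h, G.tgt_mem f (Finset.mem_of_mem_erase hf)⟩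

/-- `G / e` as an element of `ℤ[𝒢]`: it is `0` if `e` is a self-loop. -/
noncomputable def contract (G : Multigraph V E) (e : E) : GraphSum V E :=
  if he : e ∈ G.edges ∧ G.src e ≠ G.tgt e then FreeAbelianGroup.of (G.contractEdge e he) else 0

/-- The entry of the signed incidence matrix in row `u` and column `e`. -/
def incidence (G : Multigraph V E) (u : V) (e : E) : ℤ :=
  (if G.src e = u then 1 else 0) - (if G.tgt e = u then 1 else 0)

/-- The expanded Laplacian with rows and columns labeled by edges and vertices, where the variables
`α_k`, `k ∈ K`, are set to zero. -/
noncomputable def expandedLaplacian (G : Multigraph V E) (K : Finset E) :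
    Matrix (G.edges ⊕ G.verts) (G.edges ⊕ G.verts) (MvPolynomial E ℤ) :=
  Matrix.fromBlocks
    (Matrix.diagonal fun e => if e.1 ∈ K then 0 else X e.1)
    (Matrix.of fun e u => C (G.incidence u.1 e.1))
    (Matrix.of fun u e => C (G.incidence u.1 e.1))
    0

/-- For `I = i₁⋯i_k` and `J = j₁⋯j_k`, the expanded Laplacian in which row `i_r` is replaced by
the unit row with entry `1` in column `j_r`, for every `r`, and row `v` is replaced by the unit row
with entry `1` in column `v`. -/
noncomputable def dodgsonMatrix (G : Multigraph V E) (v : V) (I J : List E) (K : Finset E) :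
    Matrix (G.edges ⊕ G.verts) (G.edges ⊕ G.verts) (MvPolynomial E ℤ) :=
  Matrix.of fun x y =>
    match x with
    | Sum.inl i =>
      if i.1 ∈ I then
        (match y with
          | Sum.inl j => if (i.1, j.1) ∈ I.zip J then 1 else 0
          | Sum.inr _ => 0)
      else G.expandedLaplacian K x y
    | Sum.inr u =>
      if u.1 = v then
        (match y with
          | Sum.inl _ => 0
          | Sum.inr w => if w.1 = v then 1 else 0)
      else G.expandedLaplacian K x y

/-- The signed Dodgson polynomial `Ψ^{I,J}_K(G)` for words `I`, `J` in the edges of `G`.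

It is `(-1)^(|V(G)| - 1)` times the signed minor of the expanded Laplacian in which the rows `Iv` and
the columns `Jv` are removed, for a vertex `v`.  By Laplace expansion along the unit rows, the
determinant of `dodgsonMatrix` is `(-1)^(∑ ι_i + ∑ ι_j) sgn(Iv) sgn(Jv) det L^{Iv,Jv}_K` for every
ordering `ι` of the edges and vertices.  The value does not depend on the vertex `v`.
Words with a repeated letter, or of unequal length, give `0`. -/
noncomputable def dodgson (G : Multigraph V E) (I J : List E) (K : Finset E) : MvPolynomial E ℤ :=
  if h : G.verts.Nonempty ∧ I.length = J.length ∧ I.Nodup ∧ J.Nodup then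
    (-1) ^ (G.verts.card - 1) * (G.dodgsonMatrix h.1.choose I J K).det
  else 0

end Multigraph

namespace GraphSum

variable {V E : Type*} [DecidableEq V] [DecidableEq E]

/-- Deletion of an edge, extended linearly to `ℤ[𝒢]`. -/
noncomputable def delete (e : E) : GraphSum V E →+ GraphSum V E :=
  FreeAbelianGroup.map fun G => G.deleteEdge e

/-- Contraction of an edge, extended linearly to `ℤ[𝒢]`. -/
noncomputable def contract (e : E) : GraphSum V E →+ GraphSum V E :=
  FreeAbelianGroup.lift fun G => G.contract e

/-- Iterated deletion of the edges in `D`, then contraction of the edges in `K`: `H \ D / K`. -/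
noncomputable def minor (H : GraphSum V E) (D K : List E) : GraphSum V E :=
  K.foldl (fun H' e => contract e H') (D.foldl (fun H' e => delete e H') H)

/-- The Dodgson polynomial, extended linearly to `ℤ[𝒢]`. -/
noncomputable def dodgson (I J : List E) (K : Finset E) : GraphSum V E →+ MvPolynomial E ℤ :=
  FreeAbelianGroup.lift fun G => G.dodgson I J K

end GraphSum

/-- The polynomial `P` does not involve the variable `α_e`. -/
def FreeOf {E : Type*} (e : E) (P : MvPolynomial E ℤ) : Prop := e ∉ P.vars

/-- One step of quadratic denominator reduction in the variable `α_e`. -/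
inductive QuadraticStep {E : Type*} (e : E) : MvPolynomial E ℤ → MvPolynomial E ℤ → Prop
  | square (A B C : MvPolynomial E ℤ) (hA : FreeOf e A) (hB : FreeOf e B) (hC : FreeOf e C) :
      QuadraticStep e ((A * X e ^ 2 + B * X e + C) ^ 2) (B ^ 2 - 4 * A * C)
  | root (A B C D F : MvPolynomial E ℤ) (hA : FreeOf e A) (hB : FreeOf e B) (hC : FreeOf e C)
      (hD : FreeOf e D) (hF : FreeOf e F) :
      QuadraticStep e ((A * X e ^ 2 + B * X e + C) * (D * X e + F) ^ 2)
        (A * F ^ 2 - B * D * F + C * D ^ 2)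

/-- `G.IsQuadraticInvariant s P`: quadratic denominator reduction of `G` along the sequence
`s = [1, …, n]` of distinct edges (`n ≥ 3`) exists and `P` is the quadratic `n`-invariant
`ⁿΨ²_G(1, …, n)`. -/
inductive Multigraph.IsQuadraticInvariant {V E : Type*} [DecidableEq V] [DecidableEq E]
    (G : Multigraph V E) : List E → MvPolynomial E ℤ → Prop
  | base (i j k : E) (hi : i ∈ G.edges) (hj : j ∈ G.edges) (hk : k ∈ G.edges)
      (hd : [i, j, k].Nodup) :
      G.IsQuadraticInvariant [i, j, k] ((G.dodgson [i, k] [j, k] ∅ * G.dodgson [i] [j] {k}) ^ 2)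
  | step (s : List E) (e : E) (P Q : MvPolynomial E ℤ) (hP : G.IsQuadraticInvariant s P)
      (he : e ∈ G.edges) (hs : e ∉ s) (hQ : QuadraticStep e P Q) :
      G.IsQuadraticInvariant (s ++ [e]) Q

/-- The Källén function. -/
def kaellen {R : Type*} [CommRing R] (x y z : R) : R := (x - y - z) ^ 2 - 4 * y * z

section

variable {V E : Type*} [DecidableEq V] [DecidableEq E]

/-- The polynomial `f₀ [f₀ λ(g_A, g_B, g_C) - 4 g₀ (f_A g_A + f_B g_B + f_C g_C + f_{ABC} g₀)]`
built from the graph `G₀`, the element `H` of `ℤ[𝒢]`, and the edges `2, 3, b, c, A, B, C`. -/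
noncomputable def reducedInvariant (G₀ : Multigraph V E) (H : GraphSum V E)
    (e₂ e₃ b c A B C : E) : MvPolynomial E ℤ :=
  let f₀ := G₀.dodgson [A, B] [A, B] {C}
  let fA := G₀.dodgson [B] [C] {A}
  let fB := G₀.dodgson [A] [C] {B}
  let fC := G₀.dodgson [A] [B] {C}
  let fABC := G₀.dodgson [] [] {A, B, C}
  let g₀ := GraphSum.dodgson [e₂, e₃, A, B] [b, c, A, B] {C} H
  let gA := GraphSum.dodgson [e₂, e₃, A] [b, c, A] {B, C} H
  let gB := GraphSum.dodgson [e₂, e₃, B] [b, c, B] {A, C} H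
  let gC := GraphSum.dodgson [e₂, e₃, C] [b, c, C] {A, B} H
  f₀ * (f₀ * kaellen gA gB gC - 4 * g₀ * (fA * gA + fB * gB + fC * gC + fABC * g₀))

/-- The Dodgsons `g₀`, `g_A`, `g_B`, `g_C` of `H` are the coefficients of `α_A α_B`, `α_A`, `α_B`,
`α_C` in `Ψ^{23,bc}(H)`, viewed as a polynomial in `α_A`, `α_B`, `α_C` (of degree at most one in
each of them). -/
def CoefficientsOf (H : GraphSum V E) (e₂ e₃ b c A B C : E) : Prop :=
  ∃ g₀ gA gB gC p q r t : MvPolynomial E ℤ,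
    g₀ = GraphSum.dodgson [e₂, e₃, A, B] [b, c, A, B] {C} H ∧
    gA = GraphSum.dodgson [e₂, e₃, A] [b, c, A] {B, C} H ∧
    gB = GraphSum.dodgson [e₂, e₃, B] [b, c, B] {A, C} H ∧
    gC = GraphSum.dodgson [e₂, e₃, C] [b, c, C] {A, B} H ∧
    (∀ P ∈ [g₀, gA, gB, gC, p, q, r, t], ∀ e ∈ [A, B, C], FreeOf e P) ∧
    GraphSum.dodgson [e₂, e₃] [b, c] ∅ H =
      p * (X A * X B * X C) + g₀ * (X A * X B) + q * (X A * X C) + r * (X B * X C) +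
        gA * X A + gB * X B + gC * X C + t

end

/-!
The quadratic denominator reduction of a graph at vertices of degree three.

All Dodgson polynomials are minors `unitMinor S M p` of one symmetric matrix `M`, the expanded
Laplacian with rows indexed by edges and vertices: for `(i, j)` in the list `p`, row `i` and
column `j` are removed, and the sign is encoded by replacing row `i` by a unit row. Identities
between minors (exchange of indices, transposition, Desnanot-Jacobi) hold for every matrix
(transposition for symmetric ones), because it suffices to prove them for the invertible matrix
`M + t` over a field of rational functions in `t`, where a minor is a determinant of entries of
the inverse (`exists_generic_minors`). That the removed vertex does not matter
(`Multigraph.unitMinor_vertex_indep`) holds because the sum of the rows of all vertices of a graph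
is zero.

The row of a vertex of degree three has only three nonzero entries, all `±1` (`IsStar`). Hence
minors in which all edges at a vertex are among the removed rows vanish, and minors that differ in
one edge at that vertex are related linearly. This drives all reductions.

* By the Desnanot-Jacobi identity the `4`-invariant is the square of a product of two Dodgson
  polynomials. The `5`-invariant is the square of their resultant `fiveInvariant`, which is, up to
  sign, symmetric in its five edges.
* For edges at two vertices `123` and `abc` one of the four minors in the `5`-invariant of
  `2,b,3,c,1` vanishes, so the invariant factorizes. Reducing `a` gives the square of
  `Ψ^{23,bc} Ψ`, where the Symanzik polynomial `Ψ` belongs to the graph without both vertices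
  (`Multigraph.isQuadraticInvariant_six`). The other choices of the last edge follow from the
  linear relations at the two vertices and from transposition.
* If `123` and `145` share the edge `1`, then `4`, `5` are the edges of a vertex of degree two in
  that smaller graph. Here `Ψ = (α₄ + α₅) F + F'`, while `Ψ^{23,bc}` has no term `α₄ α₅`; two
  steps replace `Ψ` by `F`, and `Ψ^{23,bc}` by the difference of its coefficients of `α₄` and `α₅`
  (`Multigraph.IsQuadraticInvariant.reduce_two_valent`). This is the difference of the two minors
  of the graph in `H`.
* At the oriented vertex `ABC` both factors have no cubic term and equal quadratic coefficients
  (`Multigraph.HasStar.starExpansion`). The resultant in `α_A` is then a conic in `α_B`, `α_C`;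
  its discriminant in `α_B` is a quadratic polynomial in `α_C` whose leading coefficient is the
  result, by the relation `f₀ f_{ABC} = f_A f_B + f_A f_C + f_B f_C`
  (`Multigraph.IsQuadraticInvariant.reduce_star`).

A single reduction step determines its result: the result is a square root of one of the two
invariants of a binary quartic form, and its cube is half of the other (`QuadraticStep.unique`).
Hence the invariant of a sequence is unique if it exists, even where both kinds of steps apply.
-/

/-! ### Minors of a matrix with unit rows -/

section UnitMinors

variable {κ R : Type*} [DecidableEq κ] [CommRing R]

/-- If all rows outside the range of an injection are unit rows, they can be dropped from the
determinant together with the columns of the same labels. -/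
theorem Matrix.det_eq_det_submatrix_of_unit_rows {ι ι' : Type*} [Fintype ι] [DecidableEq ι]
    [Fintype ι'] [DecidableEq ι'] (A : Matrix ι ι R) (f : ι' → ι) (hf : f.Injective)
    (h : ∀ x, x ∉ Set.range f → A x = Pi.single x 1) : A.det = (A.submatrix f f).det := by
  classical
  rw [Matrix.twoBlockTriangular_det A (fun x => x ∈ Set.range f)]
  · have h2 : (A.toSquareBlockProp fun i => i ∉ Set.range f) = 1 := by
      ext ⟨x, hx⟩ ⟨y, hy⟩
      simp only [Matrix.toSquareBlockProp, Matrix.toBlock_apply, h x hx, Matrix.one_apply,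
        Subtype.mk.injEq, Pi.single_apply]
      simp only [eq_comm]
    rw [h2, Matrix.det_one, mul_one]
    have e : (A.toSquareBlockProp fun x => x ∈ Set.range f).submatrix (Equiv.ofInjective f hf)
      (Equiv.ofInjective f hf) = A.submatrix f f := rfl
    rw [← e]
    convert (Matrix.det_submatrix_equiv_self (Equiv.ofInjective f hf)
      (A.toSquareBlockProp fun x => x ∈ Set.range f)).symm
  · intro i hi j hj
    rw [h i hi, Pi.single_apply, if_neg]
    rintro rfl
    exact hi hj

/-- The square matrix with rows and columns in the finite set `S` in which row `i` of `M` is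
replaced by the unit row with entry `1` in column `j`, for every pair `(i, j)` in `p`. -/
def rowSubst (S : Finset κ) (M : Matrix κ κ R) (p : List (κ × κ)) : Matrix S S R :=
  Matrix.of fun x y =>
    if x.1 ∈ p.map Prod.fst then (if (x.1, y.1) ∈ p then 1 else 0) else M x.1 y.1

/-- The signed minor of `M` over `S` in which, for every pair `(i, j)` in `p`, row `i` and column
`j` are removed.  It is encoded as a determinant with unit rows, which fixes the sign. -/
def unitMinor (S : Finset κ) (M : Matrix κ κ R) (p : List (κ × κ)) : R := (rowSubst S M p).det

theorem rowSubst_apply_of_notMem {S : Finset κ} {M : Matrix κ κ R} {p : List (κ × κ)} {x : S}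
    (hx : x.1 ∉ p.map Prod.fst) (y : S) : rowSubst S M p x y = M x.1 y.1 := by
  simp only [rowSubst, Matrix.of_apply, if_neg hx]

theorem rowSubst_cons {S : Finset κ} (M : Matrix κ κ R) {p : List (κ × κ)} {x y : κ} (hx : x ∈ S)
    (hy : y ∈ S) (hp : x ∉ p.map Prod.fst) :
    rowSubst S M ((x, y) :: p) =
      (rowSubst S M p).updateRow ⟨x, hx⟩ (Pi.single ⟨y, hy⟩ 1) := by
  ext ⟨i, hi⟩ ⟨j, hj⟩
  by_cases h : i = x
  · subst h
    have : ∀ j, (i, j) ∉ p := fun j hj => hp (List.mem_map.2 ⟨_, hj, rfl⟩)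
    simp [rowSubst, Pi.single_apply, this]
  · rw [Matrix.updateRow_ne (by simpa using h)]
    simp only [rowSubst, Matrix.of_apply, List.map_cons, List.mem_cons, Prod.mk.injEq, h, false_and,
      false_or]

theorem unitMinor_cons {S : Finset κ} (M : Matrix κ κ R) {p : List (κ × κ)} {x y : κ} (hx : x ∈ S)
    (hy : y ∈ S) (hp : x ∉ p.map Prod.fst) :
    unitMinor S M ((x, y) :: p) = (rowSubst S M p).adjugate ⟨y, hy⟩ ⟨x, hx⟩ := by
  rw [unitMinor, rowSubst_cons M hx hy hp, Matrix.adjugate_apply]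

/-- Expansion along row `x`; for `x ≠ x'` the minor with row `x'` replaced by row `x` vanishes. -/
theorem sum_row_mul_unitMinor {S : Finset κ} (M : Matrix κ κ R) {p : List (κ × κ)} {x x' : κ}
    (hx : x ∈ S) (hx' : x' ∈ S) (hp : x ∉ p.map Prod.fst) (hp' : x' ∉ p.map Prod.fst) :
    ∑ y ∈ S, M x y * unitMinor S M ((x', y) :: p) = if x = x' then unitMinor S M p else 0 := by
  have := congrFun (congrFun (rowSubst S M p).mul_adjugate ⟨x, hx⟩) ⟨x', hx'⟩
  rw [Matrix.mul_apply] at this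
  simp only [Matrix.smul_apply, Matrix.one_apply, Subtype.mk.injEq, smul_eq_mul, mul_ite, mul_one,
    mul_zero] at this
  rw [unitMinor.eq_1 S M p, ← this, ← Finset.sum_coe_sort]
  refine Finset.sum_congr rfl fun y _ => ?_
  rw [unitMinor_cons M hx' y.2 hp', rowSubst_apply_of_notMem hp]

/-- Expansion along column `y`. -/
theorem sum_col_mul_unitMinor {S : Finset κ} (M : Matrix κ κ R) {p : List (κ × κ)} {y : κ}
    (hy : y ∈ S) (hp : y ∉ p.map Prod.snd) :
    ∑ x ∈ S with x ∉ p.map Prod.fst, M x y * unitMinor S M ((x, y) :: p) = unitMinor S M p := by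
  have := congrFun (congrFun (rowSubst S M p).adjugate_mul ⟨y, hy⟩) ⟨y, hy⟩
  rw [Matrix.mul_apply] at this
  simp only [Matrix.smul_apply, Matrix.one_apply, smul_eq_mul, if_true, mul_one] at this
  rw [unitMinor.eq_1 S M p, ← this, Finset.sum_filter, ← Finset.sum_coe_sort]
  refine Finset.sum_congr rfl fun x _ => ?_
  by_cases hx : x.1 ∈ p.map Prod.fst
  · have : (x.1, y) ∉ p := fun h => hp (List.mem_map.2 ⟨_, h, rfl⟩)
    rw [if_neg (not_not.2 hx), rowSubst, Matrix.of_apply, if_pos hx, if_neg this, mul_zero]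
  · rw [if_pos hx, unitMinor_cons M x.2 hy hx, rowSubst_apply_of_notMem hx, mul_comm]

theorem unitMinor_perm {S : Finset κ} (M : Matrix κ κ R) {p q : List (κ × κ)} (h : p.Perm q) :
    unitMinor S M p = unitMinor S M q := by
  simp only [unitMinor, rowSubst, h.mem_iff, (h.map Prod.fst).mem_iff]

theorem unitMinor_congr {S : Finset κ} {M M' : Matrix κ κ R} {p : List (κ × κ)}
    (h : ∀ x ∈ S, x ∉ p.map Prod.fst → ∀ y ∈ S, M x y = M' x y) :
    unitMinor S M p = unitMinor S M' p := by
  unfold unitMinor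
  congr 1
  ext ⟨x, hx⟩ ⟨y, hy⟩
  simp only [rowSubst, Matrix.of_apply]
  split_ifs with h1
  · rfl
  · rfl
  · exact h x hx h1 y hy

theorem unitMinor_erase {S : Finset κ} (M : Matrix κ κ R) {p : List (κ × κ)} {x : κ} (hx : x ∈ S)
    (hp : x ∉ p.map Prod.fst) :
    unitMinor S M ((x, x) :: p) = unitMinor (S.erase x) M p := by
  unfold unitMinor
  rw [Matrix.det_eq_det_submatrix_of_unit_rows _
    (fun z : (S.erase x : Finset κ) => (⟨z.1, Finset.mem_of_mem_erase z.2⟩ : S))]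
  · congr 1
    ext ⟨i, hi⟩ ⟨j, hj⟩
    have : i ≠ x := Finset.ne_of_mem_erase hi
    simp only [rowSubst, Matrix.of_apply, List.map_cons, List.mem_cons, Prod.mk.injEq, this,
      false_and, false_or, Matrix.submatrix_apply]
  · intro a b h
    exact Subtype.ext (congrArg (fun z : S => z.1) h)
  · rintro ⟨z, hz⟩ hzr
    have : z = x := by
      by_contra hne
      exact hzr ⟨⟨z, Finset.mem_erase.2 ⟨hne, hz⟩⟩, rfl⟩
    subst this
    rw [rowSubst_cons M hz hz hp, Matrix.updateRow_self]

theorem unitMinor_map {R' : Type*} [CommRing R'] (f : R →+* R') (S : Finset κ) (M : Matrix κ κ R)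
    (p : List (κ × κ)) : f (unitMinor S M p) = unitMinor S (M.map f) p := by
  unfold unitMinor
  rw [RingHom.map_det]
  congr 1
  ext x y
  simp only [rowSubst, RingHom.mapMatrix_apply, Matrix.map_apply, Matrix.of_apply]
  split_ifs <;> simp

/-- Exchanging two of the removed columns changes the sign. -/
theorem unitMinor_swap {S : Finset κ} (M : Matrix κ κ R) {p : List (κ × κ)} {i j k l : κ}
    (hi : i ∈ S) (hj : j ∈ S) (hk : k ∈ S) (hl : l ∈ S) (hik : i ≠ k) (hip : i ∉ p.map Prod.fst)
    (hkp : k ∉ p.map Prod.fst) :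
    unitMinor S M ((i, j) :: (k, l) :: p) = -unitMinor S M ((i, l) :: (k, j) :: p) := by
  have hik' : (⟨i, hi⟩ : S) ≠ ⟨k, hk⟩ := by simpa using hik
  have h1 : i ∉ List.map Prod.fst ((k, l) :: p) := by simpa [hik] using hip
  have h2 : i ∉ List.map Prod.fst ((k, j) :: p) := by simpa [hik] using hip
  unfold unitMinor
  have := Matrix.det_permute (Equiv.swap (⟨i, hi⟩ : S) ⟨k, hk⟩)
    (rowSubst S M ((i, l) :: (k, j) :: p))
  rw [Equiv.Perm.sign_swap hik'] at this
  simp only [Units.val_neg, Units.val_one, Int.cast_neg, Int.cast_one, neg_mul, one_mul] at this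
  rw [← this]
  congr 1
  rw [rowSubst_cons M hi hj h1, rowSubst_cons M hi hl h2, rowSubst_cons M hk hl hkp,
    rowSubst_cons M hk hj hkp]
  ext z y
  by_cases hz : z = ⟨i, hi⟩
  · subst hz
    simp [Matrix.updateRow_apply, hik'.symm]
  · by_cases hz' : z = ⟨k, hk⟩
    · subst hz'
      simp [Matrix.updateRow_apply, hz]
    · simp [Matrix.updateRow_apply, hz, hz', Equiv.swap_apply_of_ne_of_ne hz hz']

theorem unitMinor_eq_zero_of_snd_mem {S : Finset κ} (M : Matrix κ κ R) {p : List (κ × κ)} {i j : κ}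
    (hi : i ∈ S) (hpS : ∀ q ∈ p, q.1 ∈ S) (hn : (p.map Prod.fst).Nodup)
    (hip : i ∉ p.map Prod.fst) (hjp : j ∈ p.map Prod.snd) : unitMinor S M ((i, j) :: p) = 0 := by
  obtain ⟨⟨k, l⟩, hkl, rfl⟩ := List.mem_map.1 hjp
  have hik : i ≠ k := by
    rintro rfl
    exact hip (List.mem_map.2 ⟨_, hkl, rfl⟩)
  have hu : ∀ y, (k, y) ∈ p ↔ y = l := fun y =>
    ⟨fun h => congrArg Prod.snd (List.inj_on_of_nodup_map hn h hkl rfl), fun h => h ▸ hkl⟩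
  have hi' : ∀ y, (i, y) ∉ p := fun y h => hip (List.mem_map.2 ⟨_, h, rfl⟩)
  have hk' : k ∈ p.map Prod.fst := List.mem_map.2 ⟨_, hkl, rfl⟩
  refine Matrix.det_zero_of_row_eq (i := ⟨i, hi⟩) (j := ⟨k, hpS _ hkl⟩) (by simpa using hik) ?_
  ext y
  simp only [rowSubst, Matrix.of_apply, List.map_cons, List.mem_cons, true_or, if_true, hk',
    or_true, Prod.mk.injEq, true_and, hi', or_false, hik.symm, false_and, false_or, hu]

/-- The rows of `p` are distinct, and all its rows and columns are in `S`. -/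
def ValidPairs (S : Finset κ) (p : List (κ × κ)) : Prop :=
  (p.map Prod.fst).Nodup ∧ ∀ q ∈ p, q.1 ∈ S ∧ q.2 ∈ S

/-- Jacobi's formula: the minors of an invertible matrix are, up to its determinant, the
complementary minors of its inverse. -/
theorem unitMinor_eq_det_mul_det_inverse {S : Finset κ} (M Y : Matrix κ κ R)
    (h : (M.submatrix Subtype.val Subtype.val : Matrix S S R) *
      (Y.submatrix Subtype.val Subtype.val : Matrix S S R) = 1)
    {p : List (κ × κ)} (hp : ValidPairs S p) :
    unitMinor S M p = (M.submatrix Subtype.val Subtype.val : Matrix S S R).det *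
      (Matrix.of fun r s : Fin p.length => Y (p.get r).2 (p.get s).1).det := by
  set N : Matrix S S R := M.submatrix Subtype.val Subtype.val with hN
  set Z : Matrix S S R := Y.submatrix Subtype.val Subtype.val with hZ
  have h1 : N.det * Z.det = 1 := by rw [← Matrix.det_mul, h, Matrix.det_one]
  have h2 : unitMinor S M p = N.det * (rowSubst S M p * Z).det := by
    rw [Matrix.det_mul, unitMinor]
    linear_combination (-(rowSubst S M p).det) * h1
  have hf : Function.Injective fun r : Fin p.length => (p.get r).1 := by
    intro r s hrs
    have := (List.nodup_iff_injective_get.1 hp.1)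
    have h3 := @this ⟨r, by simp⟩ ⟨s, by simp⟩ (by simpa using hrs)
    simpa [Fin.ext_iff] using h3
  have hrow : ∀ x : S, x.1 ∉ p.map Prod.fst → (rowSubst S M p * Z) x = Pi.single x 1 := by
    intro x hx
    have h4 : (rowSubst S M p) x = N x := by
      ext y
      rw [rowSubst_apply_of_notMem hx]; rfl
    have h5 : (rowSubst S M p * Z) x = (N * Z) x := by
      ext y
      simp only [Matrix.mul_apply, h4]
    rw [h5, h]
    ext y
    simp [Matrix.one_apply, Pi.single_apply, eq_comm]
  rw [h2, Matrix.det_eq_det_submatrix_of_unit_rows (rowSubst S M p * Z)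
    (fun r : Fin p.length => (⟨(p.get r).1, (hp.2 _ (List.get_mem _ _)).1⟩ : S))]
  · congr 2
    ext r s
    have hmem := hp.2 _ (List.get_mem p r)
    have h6 : (rowSubst S M p) ⟨(p.get r).1, hmem.1⟩ = Pi.single ⟨(p.get r).2, hmem.2⟩ 1 := by
      ext y
      have h7 : (p.get r).1 ∈ p.map Prod.fst := List.mem_map.2 ⟨_, List.get_mem _ _, rfl⟩
      simp only [rowSubst, Matrix.of_apply, if_pos h7, Pi.single_apply]
      congr 1
      refine propext ⟨fun hy => ?_, fun hy => ?_⟩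
      · exact Subtype.ext (congrArg Prod.snd
          (List.inj_on_of_nodup_map hp.1 hy (List.get_mem p r) rfl))
      · subst hy
        exact List.get_mem p r
    simp only [Matrix.submatrix_apply, Matrix.of_apply, Matrix.mul_apply, h6]
    rw [Finset.sum_eq_single ⟨(p.get r).2, hmem.2⟩]
    · simp [hZ]
    · intro b _ hb
      rw [Pi.single_eq_of_ne hb, zero_mul]
    · simp
  · intro r s hrs
    exact hf (by simpa using hrs)
  · intro x hx
    refine hrow x fun hx' => hx ?_
    obtain ⟨q, hq, hqx⟩ := List.mem_map.1 hx'
    obtain ⟨r, rfl⟩ := List.get_of_mem hq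
    exact ⟨r, Subtype.ext hqx⟩

end UnitMinors

/-! ### Determinant identities for minors -/

section Identities

variable {κ R : Type*} [DecidableEq κ] [CommRing R]

/-- Adding `t` times the identity makes a matrix invertible over the field of fractions of `R[t]`.
Hence every polynomial identity between the minors `δ p` that follows from Jacobi's formula
specializes, at `t = 0`, to an identity between the minors of the matrix itself. -/
theorem exists_generic_minors [IsDomain R] (S : Finset κ) (M : Matrix κ κ R) :
    ∃ (δ : List (κ × κ) → Polynomial R) (D : FractionRing (Polynomial R))
      (Y : κ → κ → FractionRing (Polynomial R)),
      (∀ p, (δ p).eval 0 = unitMinor S M p) ∧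
      (∀ p, ValidPairs S p → algebraMap _ (FractionRing (Polynomial R)) (δ p) =
        D * (Matrix.of fun r s : Fin p.length => Y (p.get r).2 (p.get s).1).det) ∧
      ((∀ x y, M x y = M y x) → ∀ x y, Y x y = Y y x) := by
  set F := FractionRing (Polynomial R)
  set N : Matrix κ κ (Polynomial R) :=
    (Polynomial.X : Polynomial R) • (1 : Matrix κ κ (Polynomial R)) + M.map Polynomial.C with hN
  set NF : Matrix κ κ F := N.map (algebraMap _ F) with hNF
  set B : Matrix S S F := NF.submatrix Subtype.val Subtype.val with hB
  have hdet : B.det ≠ 0 := by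
    have h1 : B = (algebraMap (Polynomial R) F).mapMatrix
        ((Polynomial.X : Polynomial R) • (1 : Matrix S S (Polynomial R)) +
          (M.submatrix Subtype.val Subtype.val : Matrix S S R).map Polynomial.C) := by
      ext x y
      by_cases h : x = y
      · subst h; simp [hB, hNF, hN]
      · have h' : x.1 ≠ y.1 := fun e => h (Subtype.ext e)
        simp [hB, hNF, hN, Matrix.one_apply_ne h, Matrix.one_apply_ne h']
    rw [h1, ← RingHom.map_det]
    refine fun h0 => ?_
    have h2 := (IsFractionRing.injective (Polynomial R) F) (h0.trans (map_zero _).symm)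
    have h3 := Polynomial.leadingCoeff_det_X_one_add_C
      (M.submatrix Subtype.val Subtype.val : Matrix S S R)
    rw [h2] at h3
    simp at h3
  refine ⟨fun p => unitMinor S N p, B.det,
    fun x y => if h : x ∈ S ∧ y ∈ S then B⁻¹ ⟨x, h.1⟩ ⟨y, h.2⟩ else 0, ?_, ?_, ?_⟩
  · intro p
    rw [← Polynomial.coe_evalRingHom, unitMinor_map]
    congr 1
    ext x y
    by_cases h : x = y
    · subst h; simp [hN]
    · simp [hN, Matrix.one_apply_ne h]
  · intro p hp
    rw [unitMinor_map]
    refine unitMinor_eq_det_mul_det_inverse NF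
      (fun x y => if h : x ∈ S ∧ y ∈ S then B⁻¹ ⟨x, h.1⟩ ⟨y, h.2⟩ else 0) ?_ hp
    have h4 : (Matrix.submatrix (fun x y => if h : x ∈ S ∧ y ∈ S then B⁻¹ ⟨x, h.1⟩ ⟨y, h.2⟩ else 0)
        Subtype.val Subtype.val : Matrix S S F) = B⁻¹ := by
      ext x y
      exact dif_pos ⟨x.2, y.2⟩
    rw [h4]
    exact Matrix.mul_nonsing_inv B (isUnit_iff_ne_zero.2 hdet)
  · intro hM x y
    have h5 : B.transpose = B := by
      ext x y
      simp only [hB, hNF, hN, Matrix.transpose_apply, Matrix.submatrix_apply, Matrix.map_apply,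
        Matrix.add_apply, Matrix.smul_apply, Matrix.one_apply, hM y x, eq_comm]
    have h6 : B⁻¹.transpose = B⁻¹ := by rw [Matrix.transpose_nonsing_inv, h5]
    change (if h : x ∈ S ∧ y ∈ S then B⁻¹ ⟨x, h.1⟩ ⟨y, h.2⟩ else 0) =
      (if h : y ∈ S ∧ x ∈ S then B⁻¹ ⟨y, h.1⟩ ⟨x, h.2⟩ else 0)
    by_cases h : x ∈ S ∧ y ∈ S
    · rw [dif_pos h, dif_pos h.symm]
      exact congrFun (congrFun h6 ⟨y, h.2⟩) ⟨x, h.1⟩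
    · rw [dif_neg h, dif_neg fun h' => h h'.symm]

/-- For a symmetric matrix, rows and columns may be exchanged. -/
theorem unitMinor_transpose [IsDomain R] {S : Finset κ} {M : Matrix κ κ R}
    (hM : ∀ x y, M x y = M y x) {p : List (κ × κ)} (hp : ValidPairs S p)
    (hp' : (p.map Prod.snd).Nodup) :
    unitMinor S M (p.map Prod.swap) = unitMinor S M p := by
  obtain ⟨δ, D, Y, h0, hJ, hs⟩ := exists_generic_minors S M
  rw [← h0, ← h0]
  congr 1
  apply IsFractionRing.injective (Polynomial R) (FractionRing (Polynomial R))
  have hq : ValidPairs S (p.map Prod.swap) := by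
    refine ⟨by simpa [List.map_map, Function.comp_def] using hp', ?_⟩
    simp only [List.mem_map]
    rintro _ ⟨q, hq, rfl⟩
    exact (hp.2 q hq).symm
  rw [hJ p hp, hJ _ hq, ← Matrix.det_transpose]
  congr 1
  have e : p.length = (p.map Prod.swap).length := by simp
  rw [← Matrix.det_submatrix_equiv_self (finCongr e)]
  congr 1
  ext r s
  simp [hs hM p[s.1].1]

theorem validPairs_cons {ι : Type*} {S : Finset ι} {p : List (ι × ι)} {i j : ι} :
    ValidPairs S ((i, j) :: p) ↔
      i ∉ p.map Prod.fst ∧ i ∈ S ∧ j ∈ S ∧ ValidPairs S p := by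
  simp only [ValidPairs, List.map_cons, List.nodup_cons, List.forall_mem_cons]
  tauto

theorem validPairs_nil {ι : Type*} {S : Finset ι} : ValidPairs S [] := ⟨List.nodup_nil, by simp⟩

/-- The polynomial (in the entries of a symmetric matrix) whose square is the quadratic
`5`-invariant: the resultant, in the variable of `m`, of the Dodgson polynomials with rows and
columns `ik, jl` and `il, jk`. -/
def fiveInvariant (S : Finset κ) (M : Matrix κ κ R) (i j k l m : κ) : R :=
  unitMinor S M [(i, j), (k, l), (m, m)] * unitMinor S M [(i, j), (l, k)] -
    unitMinor S M [(i, j), (k, l)] * unitMinor S M [(i, j), (l, k), (m, m)]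

/-- The Desnanot–Jacobi identity. -/
theorem unitMinor_desnanot_jacobi [IsDomain R] {S : Finset κ} (M : Matrix κ κ R) {i j k l : κ}
    (hi : i ∈ S) (hj : j ∈ S) (hk : k ∈ S) (hl : l ∈ S) (hik : i ≠ k) (hil : i ≠ l) (hkl : k ≠ l) :
    unitMinor S M [(i, j), (k, k)] * unitMinor S M [(i, j), (l, l)] -
      unitMinor S M [(i, j), (k, k), (l, l)] * unitMinor S M [(i, j)] =
      unitMinor S M [(i, j), (k, l)] * unitMinor S M [(i, j), (l, k)] := by
  obtain ⟨δ, D, Y, h0, hJ, -⟩ := exists_generic_minors S M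
  simp only [← h0, ← Polynomial.eval_mul, ← Polynomial.eval_sub]
  congr 1
  apply IsFractionRing.injective (Polynomial R) (FractionRing (Polynomial R))
  simp only [map_mul, map_sub]
  rw [hJ [(i, j), (k, k)], hJ [(i, j), (l, l)], hJ [(i, j), (k, k), (l, l)], hJ [(i, j)],
    hJ [(i, j), (k, l)], hJ [(i, j), (l, k)]]
  · simp [Matrix.det_fin_two, Matrix.det_fin_three, Fin.isValue]
    ring
  all_goals simp [validPairs_cons, validPairs_nil, *]

/-- The Desnanot-Jacobi identity: for generic `M` it is the determinant of a `2 × 2` block of the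
inverse. -/
theorem unitMinor_dodgson [IsDomain R] {S : Finset κ} (M : Matrix κ κ R) {k l : κ}
    (hk : k ∈ S) (hl : l ∈ S) (hkl : k ≠ l) :
    unitMinor S M [(k, k)] * unitMinor S M [(l, l)] -
      unitMinor S M [(k, k), (l, l)] * unitMinor S M [] =
      unitMinor S M [(k, l)] * unitMinor S M [(l, k)] := by
  obtain ⟨δ, D, Y, h0, hJ, -⟩ := exists_generic_minors S M
  simp only [← h0, ← Polynomial.eval_mul, ← Polynomial.eval_sub]
  congr 1
  apply IsFractionRing.injective (Polynomial R) (FractionRing (Polynomial R))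
  simp only [map_mul, map_sub]
  rw [hJ [(k, k)], hJ [(l, l)], hJ [(k, k), (l, l)], hJ [],
    hJ [(k, l)], hJ [(l, k)]]
  · simp [Matrix.det_fin_two, Fin.isValue]
    ring
  all_goals simp [validPairs_cons, validPairs_nil, *]

/-- By Jacobi's formula the `5`-invariant is a signed sum over the twelve pentagons on
`{i, j, k, l, m}` of products of entries of the inverse matrix.  This makes it invariant, up to
sign, under permutations of its arguments. -/
theorem fiveInvariant_adjacent_swap [IsDomain R] {S : Finset κ} {M : Matrix κ κ R}
    (hM : ∀ x y, M x y = M y x) {i j k l m : κ} (hi : i ∈ S) (hj : j ∈ S) (hk : k ∈ S) (hl : l ∈ S)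
    (hm : m ∈ S) (hn : [i, j, k, l, m].Nodup) :
    fiveInvariant S M i j k l m = -fiveInvariant S M j i k l m ∧
    fiveInvariant S M i j k l m = -fiveInvariant S M i k j l m ∧
    fiveInvariant S M i j k l m = -fiveInvariant S M i j l k m ∧
    fiveInvariant S M i j k l m = -fiveInvariant S M i j k m l := by
  obtain ⟨δ, D, Y, h0, hJ, hs⟩ := exists_generic_minors S M
  set Z : κ → κ → κ → κ → κ → Polynomial R := fun i j k l m =>
    δ [(i, j), (k, l), (m, m)] * δ [(i, j), (l, k)] -
      δ [(i, j), (k, l)] * δ [(i, j), (l, k), (m, m)] with hZ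
  have hZ0 : ∀ i j k l m, fiveInvariant S M i j k l m = (Z i j k l m).eval 0 := by
    intro i j k l m
    simp only [hZ, fiveInvariant, Polynomial.eval_sub, Polynomial.eval_mul, h0]
  have hZ1 : ∀ i ∈ S, ∀ j ∈ S, ∀ k ∈ S, ∀ l ∈ S, ∀ m ∈ S, [i, j, k, l, m].Nodup →
      algebraMap _ (FractionRing (Polynomial R)) (Z i j k l m) = D ^ 2 * (
          Y i j * Y i k * Y j l * Y k m * Y l m +
          Y i j * Y i m * Y j k * Y k l * Y l m +
          Y i j * Y i l * Y j m * Y k l * Y k m +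
          Y i k * Y i m * Y j l * Y j m * Y k l +
          Y i l * Y i m * Y j k * Y j l * Y k m +
          Y i k * Y i l * Y j k * Y j m * Y l m -
          Y i k * Y i m * Y j k * Y j l * Y l m -
          Y i k * Y i l * Y j l * Y j m * Y k m -
          Y i j * Y i m * Y j l * Y k l * Y k m -
          Y i j * Y i k * Y j m * Y k l * Y l m -
          Y i j * Y i l * Y j k * Y k m * Y l m -
          Y i l * Y i m * Y j k * Y j m * Y k l) := by
    intro i hi j hj k hk l hl m hm hn
    simp only [List.nodup_cons, List.mem_cons, List.not_mem_nil, or_false, not_or] at hn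
    obtain ⟨⟨hij, hik, hil, him⟩, ⟨hjk, hjl, hjm⟩, ⟨hkl, hkm⟩, hlm, -⟩ := hn
    simp only [hZ, map_sub, map_mul]
    rw [hJ [(i, j), (k, l), (m, m)], hJ [(i, j), (l, k)], hJ [(i, j), (k, l)],
      hJ [(i, j), (l, k), (m, m)]]
    · simp [Matrix.det_fin_two, Matrix.det_fin_three, Fin.isValue]
      rw [hs hM j i, hs hM k i, hs hM l i, hs hM m i, hs hM l k, hs hM m k, hs hM m l]
      ring
    all_goals simp [validPairs_cons, validPairs_nil, *, Ne.symm]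
  have hinj := IsFractionRing.injective (Polynomial R) (FractionRing (Polynomial R))
  simp only [hZ0, ← Polynomial.eval_neg]
  have hn' := hn
  simp only [List.nodup_cons, List.mem_cons, List.not_mem_nil, or_false, not_or] at hn'
  obtain ⟨⟨hij, hik, hil, him⟩, ⟨hjk, hjl, hjm⟩, ⟨hkl, hkm⟩, hlm, -⟩ := hn'
  refine ⟨?_, ?_, ?_, ?_⟩ <;> congr 1 <;> apply hinj <;> simp only [map_neg]
  · rw [hZ1 i hi j hj k hk l hl m hm hn,
      hZ1 j hj i hi k hk l hl m hm (by simp [*, Ne.symm, eq_comm])]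
    rw [hs hM j i]; ring
  · rw [hZ1 i hi j hj k hk l hl m hm hn,
      hZ1 i hi k hk j hj l hl m hm (by simp [*, Ne.symm, eq_comm])]
    rw [hs hM k j]; ring
  · rw [hZ1 i hi j hj k hk l hl m hm hn,
      hZ1 i hi j hj l hl k hk m hm (by simp [*, Ne.symm, eq_comm])]
    rw [hs hM l k]; ring
  · rw [hZ1 i hi j hj k hk l hl m hm hn,
      hZ1 i hi j hj k hk m hm l hl (by simp [*, Ne.symm, eq_comm])]
    rw [hs hM m l]; ring

end Identities

/-! ### Dodgson polynomials as minors; independence of the vertex -/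

/-- If a vector spans a two-sided kernel, all cofactors in its support with equal weight agree. -/
theorem Matrix.adjugate_apply_eq_of_mulVec_eq_zero {ι R : Type*} [Fintype ι] [DecidableEq ι]
    [CommRing R] [IsDomain R] {A : Matrix ι ι R} {z : ι → R} (h1 : A.mulVec z = 0)
    (h2 : Matrix.vecMul z A = 0) {v w : ι} (hv : z v = 1) (hw : z w = 1) :
    A.adjugate v v = A.adjugate w w := by
  have hz : z ≠ 0 := fun h => by simp [h] at hv
  have e1 : (A.updateRow v (Pi.single v 1 - Pi.single w 1)).det = 0 := by
    rw [← Matrix.exists_mulVec_eq_zero_iff]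
    refine ⟨z, hz, ?_⟩
    rw [Matrix.updateRow_mulVec, h1]
    ext i
    by_cases hi : i = v
    · subst hi; simp [sub_dotProduct, hv, hw]
    · simp [hi]
  have e2 : (A.transpose.updateRow w (Pi.single v 1 - Pi.single w 1)).det = 0 := by
    rw [← Matrix.exists_mulVec_eq_zero_iff]
    refine ⟨z, hz, ?_⟩
    rw [Matrix.updateRow_mulVec, Matrix.mulVec_transpose, h2]
    ext i
    by_cases hi : i = w
    · subst hi; simp [sub_dotProduct, hv, hw]
    · simp [hi]
  rw [sub_eq_add_neg, ← neg_one_smul R (Pi.single w 1), Matrix.det_updateRow_add,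
    Matrix.det_updateRow_smul, ← Matrix.adjugate_apply, ← Matrix.adjugate_apply] at e1 e2
  rw [← Matrix.adjugate_transpose, Matrix.transpose_apply, Matrix.transpose_apply] at e2
  linear_combination e1 + e2

theorem rowSubst_apply_of_mem {κ R : Type*} [DecidableEq κ] [CommRing R] {S : Finset κ}
    {M : Matrix κ κ R} {p : List (κ × κ)} {x : S}
    (hx : x.1 ∈ p.map Prod.fst) (y : S) :
    rowSubst S M p x y = if (x.1, y.1) ∈ p then 1 else 0 := by
  simp only [rowSubst, Matrix.of_apply, if_pos hx]

theorem rowSubst_mulVec_eq_zero {κ R : Type*} [DecidableEq κ] [CommRing R] {S : Finset κ}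
    {M : Matrix κ κ R} {p : List (κ × κ)} {z : κ → R} (hz : ∀ q ∈ p, z q.2 = 0)
    (hM : ∀ x ∈ S, x ∉ p.map Prod.fst → ∑ y ∈ S, M x y * z y = 0) :
    (rowSubst S M p).mulVec (fun y => z y.1) = 0 := by
  ext x
  by_cases hx : x.1 ∈ p.map Prod.fst
  · refine Finset.sum_eq_zero fun y _ => ?_
    change rowSubst S M p x y * z y.1 = 0
    rw [rowSubst_apply_of_mem hx]
    split_ifs with h
    · rw [hz _ h, mul_zero]
    · rw [zero_mul]
  · rw [Pi.zero_apply, ← hM x.1 x.2 hx, ← Finset.sum_coe_sort]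
    refine Finset.sum_congr rfl fun y _ => ?_
    change rowSubst S M p x y * z y.1 = _
    rw [rowSubst_apply_of_notMem hx]

theorem vecMul_rowSubst_eq_zero {κ R : Type*} [DecidableEq κ] [CommRing R] {S : Finset κ}
    {M : Matrix κ κ R} {p : List (κ × κ)} {z : κ → R} (hz : ∀ q ∈ p, z q.1 = 0)
    (hM : ∀ y ∈ S, ∑ x ∈ S, z x * M x y = 0) :
    Matrix.vecMul (fun y => z y.1) (rowSubst S M p) = 0 := by
  ext y
  rw [Pi.zero_apply, ← hM y.1 y.2, ← Finset.sum_coe_sort]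
  refine Finset.sum_congr rfl fun x _ => ?_
  change z x.1 * rowSubst S M p x y = _
  by_cases hx : x.1 ∈ p.map Prod.fst
  · obtain ⟨q, hq, hqx⟩ := List.mem_map.1 hx
    rw [← hqx, hz q hq, zero_mul, zero_mul]
  · rw [rowSubst_apply_of_notMem hx]

namespace Multigraph

variable {V E : Type*}

theorem sum_incidence [DecidableEq V] (G : Multigraph V E) {e : E} (he : e ∈ G.edges) :
    ∑ u ∈ G.verts, G.incidence u e = 0 := by
  simp [incidence, Finset.sum_sub_distrib, G.src_mem e he, G.tgt_mem e he]

/-- The pair of edges `(i, j)`, as a pair of labels of a row and a column. -/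
abbrev edgePair (q : E × E) : (E ⊕ V) × (E ⊕ V) := (Sum.inl q.1, Sum.inl q.2)

theorem notMem_map_edgePair_inr {p : List (E × E)} {u : V} :
    (Sum.inr u : E ⊕ V) ∉ (p.map edgePair).map Prod.fst := by simp

theorem mem_map_edgePair_inl {p : List (E × E)} {i : E} :
    (Sum.inl i : E ⊕ V) ∈ (p.map edgePair).map Prod.fst ↔ i ∈ p.map Prod.fst := by simp

theorem mem_edgePair {p : List (E × E)} {i j : E} :
    ((Sum.inl i, Sum.inl j) : (E ⊕ V) × (E ⊕ V)) ∈ p.map edgePair ↔ (i, j) ∈ p := by simp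

theorem notMem_edgePair {p : List (E × E)} {i : E} {w : V} :
    ((Sum.inl i, Sum.inr w) : (E ⊕ V) × (E ⊕ V)) ∉ p.map edgePair := by simp

variable [DecidableEq V] [DecidableEq E]

/-- The expanded Laplacian with rows and columns labeled by all possible names of edges and
vertices. -/
noncomputable def laplacian (G : Multigraph V E) (K : Finset E) :
    Matrix (E ⊕ V) (E ⊕ V) (MvPolynomial E ℤ) :=
  Matrix.fromBlocks (Matrix.diagonal fun e => if e ∈ K then 0 else X e)
    (Matrix.of fun e u => C (G.incidence u e)) (Matrix.of fun u e => C (G.incidence u e)) 0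

/-- The labels of the rows of the expanded Laplacian of `G` without the row of the vertex `v`. -/
def labels (G : Multigraph V E) (v : V) : Finset (E ⊕ V) :=
  (G.edges.disjSum G.verts).erase (Sum.inr v)

theorem laplacian_symm (G : Multigraph V E) (K : Finset E) (x y : E ⊕ V) :
    G.laplacian K x y = G.laplacian K y x := by
  rcases x with x | x <;> rcases y with y | y <;> simp [laplacian, Matrix.diagonal_apply]
  by_cases h : x = y
  · subst h; rfl
  · rw [if_neg h, if_neg (Ne.symm h)]

theorem inl_mem_labels {G : Multigraph V E} {v : V} {e : E} :
    Sum.inl e ∈ G.labels v ↔ e ∈ G.edges := by simp [labels]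

theorem inr_mem_labels {G : Multigraph V E} {v u : V} :
    Sum.inr u ∈ G.labels v ↔ u ≠ v ∧ u ∈ G.verts := by simp [labels]

/-- The minors do not depend on the removed vertex: the vector that is `1` on the vertices and `0`
on the edges is in the left and in the right kernel of the Laplacian, so the diagonal entries of
the adjugate at the vertices agree. -/
theorem unitMinor_vertex_indep (G : Multigraph V E) (K : Finset E) (p : List (E × E)) {v w : V}
    (hv : v ∈ G.verts) (hw : w ∈ G.verts) :
    unitMinor (G.labels v) (G.laplacian K) (p.map edgePair) =
      unitMinor (G.labels w) (G.laplacian K) (p.map edgePair) := by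
  set S := G.edges.disjSum G.verts with hS
  have hv' : (Sum.inr v : E ⊕ V) ∈ S := by simpa [S] using hv
  have hw' : (Sum.inr w : E ⊕ V) ∈ S := by simpa [S] using hw
  have hz : ∀ q ∈ p.map (edgePair (V := V)), Sum.elim (fun _ : E => (0 : MvPolynomial E ℤ))
      (fun _ : V => 1) q.1 = 0 ∧ Sum.elim (fun _ : E => (0 : MvPolynomial E ℤ))
      (fun _ : V => 1) q.2 = 0 := by
    simp
  have h1 : (rowSubst S (G.laplacian K) (p.map edgePair)).mulVec
      (fun y => Sum.elim (fun _ : E => (0 : MvPolynomial E ℤ)) (fun _ : V => 1) y.1) = 0 := by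
    refine rowSubst_mulVec_eq_zero (fun q hq => (hz q hq).2) ?_
    intro x hx _
    rw [hS, Finset.sum_disjSum]
    rcases x with e | u
    · simp only [laplacian, Matrix.fromBlocks_apply₁₂, Matrix.of_apply, Sum.elim_inl, mul_zero,
        Sum.elim_inr, mul_one, Finset.sum_const_zero, zero_add]
      rw [← map_sum, G.sum_incidence (by simpa [S] using hx), map_zero]
    · simp [laplacian]
  have h2 : Matrix.vecMul
      (fun y : S => Sum.elim (fun _ : E => (0 : MvPolynomial E ℤ)) (fun _ : V => 1) y.1)
      (rowSubst S (G.laplacian K) (p.map edgePair)) = 0 := by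
    refine vecMul_rowSubst_eq_zero (fun q hq => (hz q hq).1) ?_
    intro y hy
    rw [hS, Finset.sum_disjSum]
    rcases y with e | u
    · simp only [laplacian, Matrix.fromBlocks_apply₂₁, Matrix.of_apply, Sum.elim_inl, zero_mul,
        Sum.elim_inr, one_mul, Finset.sum_const_zero, zero_add]
      rw [← map_sum, G.sum_incidence (by simpa [S] using hy), map_zero]
    · simp [laplacian]
  have h3 := Matrix.adjugate_apply_eq_of_mulVec_eq_zero h1 h2 (v := ⟨Sum.inr v, hv'⟩)
    (w := ⟨Sum.inr w, hw'⟩) rfl rfl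
  have h4 := unitMinor_erase (G.laplacian K) hv' (notMem_map_edgePair_inr (p := p))
  have h5 := unitMinor_erase (G.laplacian K) hw' (notMem_map_edgePair_inr (p := p))
  rw [unitMinor_cons _ hv' hv' notMem_map_edgePair_inr] at h4
  rw [unitMinor_cons _ hw' hw' notMem_map_edgePair_inr] at h5
  exact h4.symm.trans (h3.trans h5)

/-- The unit row at the vertex `v` of `dodgsonMatrix` removes `v` from the labels of the minor. -/
theorem det_dodgsonMatrix (G : Multigraph V E) (K : Finset E) (p : List (E × E)) {v : V}
    (hv : v ∈ G.verts) :
    (G.dodgsonMatrix v (p.map Prod.fst) (p.map Prod.snd) K).det =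
      unitMinor (G.labels v) (G.laplacian K) (p.map edgePair) := by
  have hv' : (Sum.inr v : E ⊕ V) ∈ G.edges.disjSum G.verts := by simpa using hv
  rw [labels, ← unitMinor_erase _ hv' notMem_map_edgePair_inr]
  have hz : (p.map Prod.fst).zip (p.map Prod.snd) = p := by
    rw [← List.unzip_fst, ← List.unzip_snd, List.zip_unzip]
  let f : G.edges ⊕ G.verts → (G.edges.disjSum G.verts : Finset (E ⊕ V)) :=
    fun x => ⟨Sum.map Subtype.val Subtype.val x, by rcases x with x | x <;> simp⟩
  have hf : f.Bijective := by
    constructor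
    · intro x y h
      have h' : Sum.map Subtype.val Subtype.val x = Sum.map Subtype.val Subtype.val y :=
        congrArg Subtype.val h
      exact (Sum.map_injective.2 ⟨Subtype.val_injective, Subtype.val_injective⟩) h'
    · rintro ⟨x | x, hx⟩
      · exact ⟨Sum.inl ⟨x, by simpa using hx⟩, rfl⟩
      · exact ⟨Sum.inr ⟨x, by simpa using hx⟩, rfl⟩
  rw [unitMinor, ← Matrix.det_submatrix_equiv_self (Equiv.ofBijective f hf)]
  congr 1
  ext1 x y
  rcases x with ⟨i, hi⟩ | ⟨u, hu⟩
  · have h1 : (Sum.inl i : E ⊕ V) ∈ (((Sum.inr v, Sum.inr v) : (E ⊕ V) × (E ⊕ V)) ::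
        p.map edgePair).map Prod.fst ↔ i ∈ p.map Prod.fst := by
      rw [List.map_cons, List.mem_cons, mem_map_edgePair_inl]
      simp
    by_cases h : i ∈ p.map Prod.fst
    · rw [Matrix.submatrix_apply, rowSubst_apply_of_mem (h1.2 h)]
      simp only [dodgsonMatrix, Matrix.of_apply, if_pos h, hz]
      rcases y with ⟨j, hj⟩ | ⟨w, hw⟩
      · simp only [f, Equiv.ofBijective_apply, Sum.map_inl, List.mem_cons, mem_edgePair]
        simp
      · simp only [f, Equiv.ofBijective_apply, Sum.map_inl, Sum.map_inr, List.mem_cons,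
          notMem_edgePair]
        simp
    · rw [Matrix.submatrix_apply, rowSubst_apply_of_notMem (fun hh => h (h1.1 hh))]
      simp only [dodgsonMatrix, Matrix.of_apply, if_neg h]
      rcases y with ⟨j, hj⟩ | ⟨w, hw⟩
      · simp [f, expandedLaplacian, laplacian, Matrix.diagonal_apply]
      · simp [f, expandedLaplacian, laplacian]
  · have h1 : (Sum.inr u : E ⊕ V) ∈ (((Sum.inr v, Sum.inr v) : (E ⊕ V) × (E ⊕ V)) ::
        p.map edgePair).map Prod.fst ↔ u = v := by
      simp
    by_cases h : u = v
    · rw [Matrix.submatrix_apply, rowSubst_apply_of_mem (h1.2 h)]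
      rcases y with ⟨j, hj⟩ | ⟨w, hw⟩
      · simp [f, dodgsonMatrix, h]
      · simp [f, dodgsonMatrix, h]
    · rw [Matrix.submatrix_apply, rowSubst_apply_of_notMem (fun hh => h (h1.1 hh))]
      simp only [dodgsonMatrix, Matrix.of_apply, if_neg h]
      rcases y with ⟨j, hj⟩ | ⟨w, hw⟩
      · simp [f, expandedLaplacian, laplacian]
      · simp [f, expandedLaplacian, laplacian]

/-- The Dodgson polynomial as a signed minor of the expanded Laplacian, for any choice of the
removed vertex `v`. -/
theorem dodgson_eq (G : Multigraph V E) (K : Finset E) (p : List (E × E)) {v : V}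
    (hv : v ∈ G.verts) (h1 : (p.map Prod.fst).Nodup) (h2 : (p.map Prod.snd).Nodup) :
    G.dodgson (p.map Prod.fst) (p.map Prod.snd) K =
      (-1) ^ (G.verts.card - 1) * unitMinor (G.labels v) (G.laplacian K) (p.map edgePair) := by
  have h : G.verts.Nonempty ∧ (p.map Prod.fst).length = (p.map Prod.snd).length ∧
      (p.map Prod.fst).Nodup ∧ (p.map Prod.snd).Nodup := ⟨⟨v, hv⟩, by simp, h1, h2⟩
  rw [dodgson, dif_pos h, det_dodgsonMatrix _ _ _ h.1.choose_spec,
    G.unitMinor_vertex_indep K p h.1.choose_spec hv]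

end Multigraph

/-! ### Rows of vertices, and dependence on the variables -/

section Stars

variable {κ R : Type*} [DecidableEq κ] [CommRing R] {S : Finset κ} {M : Matrix κ κ R}
  {p : List (κ × κ)}

/-- In row `u` the matrix has entries `±1` in the columns of `T` and zeros in all other columns
of `S`.  This is the row of a vertex `u` without self-loops and with the edges `T`. -/
structure IsStar (S : Finset κ) (M : Matrix κ κ R) (u : κ) (T : Finset κ) : Prop where
  mem : u ∈ S
  subset : T ⊆ S
  notMem : u ∉ T
  zero : ∀ y ∈ S, y ∉ T → M u y = 0
  sq : ∀ y ∈ T, M u y * M u y = 1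

theorem IsStar.mono {u : κ} {T S' : Finset κ} (h : IsStar S M u T) (hS : S' ⊆ S) (hu : u ∈ S') :
    IsStar S' M u (T ∩ S') where
  mem := hu
  subset := Finset.inter_subset_right
  notMem hm := h.notMem (Finset.mem_inter.1 hm).1
  zero y hy hyT := h.zero y (hS hy) fun hm => hyT (Finset.mem_inter.2 ⟨hm, hy⟩)
  sq y hy := h.sq y (Finset.mem_inter.1 hy).1

theorem ValidPairs.snd_zero {i j : κ} (hp : ValidPairs S p) (hi : i ∈ S)
    (hip : i ∉ p.map Prod.fst) (hjp : j ∈ p.map Prod.snd) : unitMinor S M ((i, j) :: p) = 0 :=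
  unitMinor_eq_zero_of_snd_mem M hi (fun q hq => (hp.2 q hq).1) hp.1 hip hjp

theorem IsStar.sum_row {u x : κ} {T : Finset κ} (h : IsStar S M u T) (hx : x ∈ S)
    (hu : u ∉ p.map Prod.fst) (hxp : x ∉ p.map Prod.fst) :
    ∑ y ∈ T, M u y * unitMinor S M ((x, y) :: p) = if u = x then unitMinor S M p else 0 := by
  rw [← sum_row_mul_unitMinor M h.mem hx hu hxp]
  refine Finset.sum_subset h.subset fun y hy hyT => ?_
  rw [h.zero y hy hyT, zero_mul]

theorem IsStar.row_single {u j : κ} {T : Finset κ} (h : IsStar S M u T) (hp : ValidPairs S p)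
    (hu : u ∉ p.map Prod.fst) (hj : j ∈ T) (hT : ∀ y ∈ T, y ≠ j → y ∈ p.map Prod.snd) :
    unitMinor S M p = M u j * unitMinor S M ((u, j) :: p) := by
  have := h.sum_row h.mem hu hu
  rw [if_pos rfl] at this
  rw [← this]
  exact Finset.sum_eq_single_of_mem j hj fun y hy hyj => by
    rw [hp.snd_zero h.mem hu (hT y hy hyj), mul_zero]

theorem IsStar.row_zero {u : κ} {T : Finset κ} (h : IsStar S M u T) (hp : ValidPairs S p)
    (hu : u ∉ p.map Prod.fst) (hT : ∀ y ∈ T, y ∈ p.map Prod.snd) : unitMinor S M p = 0 := by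
  have := h.sum_row h.mem hu hu
  rw [if_pos rfl] at this
  rw [← this]
  exact Finset.sum_eq_zero fun y hy => by rw [hp.snd_zero h.mem hu (hT y hy), mul_zero]

theorem IsStar.col_single (hM : ∀ x y, M x y = M y x) {u j : κ} {T : Finset κ}
    (h : IsStar S M u T) (hu : u ∉ p.map Prod.snd) (hj : j ∈ T) (hjp : j ∉ p.map Prod.fst)
    (hT : ∀ y ∈ T, y ≠ j → y ∈ p.map Prod.fst) :
    unitMinor S M p = M u j * unitMinor S M ((j, u) :: p) := by
  rw [← sum_col_mul_unitMinor M h.mem hu, hM u j]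
  refine Finset.sum_eq_single_of_mem j (Finset.mem_filter.2 ⟨h.subset hj, hjp⟩) fun y hy hyj => ?_
  obtain ⟨hyS, hyp⟩ := Finset.mem_filter.1 hy
  rw [hM, h.zero y hyS fun hyT => hyp (hT y hyT hyj), zero_mul]

theorem IsStar.col_zero (hM : ∀ x y, M x y = M y x) {u : κ} {T : Finset κ}
    (h : IsStar S M u T) (hu : u ∉ p.map Prod.snd) (hT : ∀ y ∈ T, y ∈ p.map Prod.fst) :
    unitMinor S M p = 0 := by
  rw [← sum_col_mul_unitMinor M h.mem hu]
  refine Finset.sum_eq_zero fun y hy => ?_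
  obtain ⟨hyS, hyp⟩ := Finset.mem_filter.1 hy
  rw [hM, h.zero y hyS fun hyT => hyp (hT y hyT), zero_mul]

/-- Expansion along row `x` of the matrix in which row `x` is replaced by row `u`: it has two equal
rows, so the sum vanishes.  It has one term for each edge at `u`. -/
theorem IsStar.row_relation {u x i j k : κ} (h : IsStar S M u {i, j, k}) (hij : i ≠ j)
    (hik : i ≠ k) (hjk : j ≠ k) (hx : x ∈ S) (hux : u ≠ x)
    (hu : u ∉ p.map Prod.fst) (hxp : x ∉ p.map Prod.fst) :
    M u i * unitMinor S M ((x, i) :: p) + M u j * unitMinor S M ((x, j) :: p) +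
      M u k * unitMinor S M ((x, k) :: p) = 0 := by
  have := h.sum_row hx hu hxp
  rw [if_neg hux, Finset.sum_insert (by simp [hij, hik]), Finset.sum_insert (by simp [hjk]),
    Finset.sum_singleton, ← add_assoc] at this
  exact this

theorem ValidPairs.mono_erase {x : κ} (hp : ValidPairs S p) (hx : ∀ q ∈ p, q.1 ≠ x ∧ q.2 ≠ x) :
    ValidPairs (S.erase x) p :=
  ⟨hp.1, fun q hq => ⟨Finset.mem_erase.2 ⟨(hx q hq).1, (hp.2 q hq).1⟩,
    Finset.mem_erase.2 ⟨(hx q hq).2, (hp.2 q hq).2⟩⟩⟩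

/-- Removal of a vertex `u` of degree three: the minor without the rows `ik` and the columns `jk` of
the edges `i`, `j`, `k` at `u` is, up to sign, the minor in which `u` and its edges are removed. -/
theorem IsStar.sq_remove_three (hM : ∀ x y, M x y = M y x) {u i j k : κ}
    (h : IsStar S M u {i, j, k}) (hij : i ≠ j) (hik : i ≠ k) (hjk : j ≠ k) (hp : ValidPairs S p)
    (hpu : ∀ q ∈ p, ∀ z ∈ [u, i, j, k], q.1 ≠ z ∧ q.2 ≠ z) :
    unitMinor S M ((i, j) :: (k, k) :: p) ^ 2 =
      unitMinor ((((S.erase j).erase i).erase u).erase k) M p ^ 2 := by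
  have hu : u ∈ S := h.mem
  have hi : i ∈ S := h.subset (by simp)
  have hj : j ∈ S := h.subset (by simp)
  have hk : k ∈ S := h.subset (by simp)
  have hne := h.notMem
  simp only [Finset.mem_insert, Finset.mem_singleton, not_or] at hne
  obtain ⟨hui, huj, huk⟩ := hne
  have hf : ∀ z ∈ [u, i, j, k], z ∉ p.map Prod.fst := by
    intro z hz hzp
    obtain ⟨q, hq, rfl⟩ := List.mem_map.1 hzp
    exact (hpu q hq _ hz).1 rfl
  have hs : ∀ z ∈ [u, i, j, k], z ∉ p.map Prod.snd := by
    intro z hz hzp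
    obtain ⟨q, hq, rfl⟩ := List.mem_map.1 hzp
    exact (hpu q hq _ hz).2 rfl
  simp only [List.forall_mem_cons] at hf hs
  obtain ⟨fu, fi, fj, fk, -⟩ := hf
  obtain ⟨su, si, sj, sk, -⟩ := hs
  have e1 : unitMinor S M ((i, j) :: (k, k) :: p) =
      M u i * unitMinor S M ((u, i) :: (i, j) :: (k, k) :: p) := by
    apply h.row_single
    · simp only [validPairs_cons, List.map_cons, List.mem_cons, not_or]
      exact ⟨⟨hik, fi⟩, hi, hj, fk, hk, hk, hp⟩
    · simp only [List.map_cons, List.mem_cons, not_or]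
      exact ⟨hui, huk, fu⟩
    · simp
    · intro y hy hyi
      simp only [Finset.mem_insert, Finset.mem_singleton] at hy
      rcases hy with rfl | rfl | rfl
      · exact absurd rfl hyi
      · simp
      · simp
  have e2 : unitMinor S M ((u, i) :: (i, j) :: (k, k) :: p) =
      M u j * unitMinor S M ((j, u) :: (u, i) :: (i, j) :: (k, k) :: p) := by
    apply h.col_single hM
    · simp only [List.map_cons, List.mem_cons, not_or]
      exact ⟨hui, huj, huk, su⟩
    · simp
    · simp only [List.map_cons, List.mem_cons, not_or]
      exact ⟨Ne.symm huj, hij.symm, hjk, fj⟩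
    · intro y hy hyi
      simp only [Finset.mem_insert, Finset.mem_singleton] at hy
      rcases hy with rfl | rfl | rfl
      · simp
      · exact absurd rfl hyi
      · simp
  have e3 : unitMinor S M ((j, u) :: (u, i) :: (i, j) :: (k, k) :: p) =
      -unitMinor S M ((j, i) :: (u, u) :: (i, j) :: (k, k) :: p) := by
    apply unitMinor_swap M hj hu hu hi (Ne.symm huj)
    · simp only [List.map_cons, List.mem_cons, not_or]
      exact ⟨hij.symm, hjk, fj⟩
    · simp only [List.map_cons, List.mem_cons, not_or]
      exact ⟨hui, huk, fu⟩
  have e4 : unitMinor S M ((j, i) :: (u, u) :: (i, j) :: (k, k) :: p) =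
      unitMinor S M ((j, i) :: (i, j) :: (u, u) :: (k, k) :: p) :=
    unitMinor_perm M ((List.Perm.swap _ _ _).cons _)
  have e5 : unitMinor S M ((j, i) :: (i, j) :: (u, u) :: (k, k) :: p) =
      -unitMinor S M ((j, j) :: (i, i) :: (u, u) :: (k, k) :: p) := by
    apply unitMinor_swap M hj hi hi hj hij.symm
    · simp only [List.map_cons, List.mem_cons, not_or]
      exact ⟨Ne.symm huj, hjk, fj⟩
    · simp only [List.map_cons, List.mem_cons, not_or]
      exact ⟨Ne.symm hui, hik, fi⟩
  have e6 : unitMinor S M ((j, j) :: (i, i) :: (u, u) :: (k, k) :: p) =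
      unitMinor ((((S.erase j).erase i).erase u).erase k) M p := by
    rw [unitMinor_erase M hj, unitMinor_erase M (by simp [hi, hij]),
      unitMinor_erase M (by simp [hu, hui, huj]),
      unitMinor_erase M (by simp [hk, hik.symm, hjk.symm, Ne.symm huk]) fk]
    · simp only [List.map_cons, List.mem_cons, not_or]
      exact ⟨huk, fu⟩
    · simp only [List.map_cons, List.mem_cons, not_or]
      exact ⟨Ne.symm hui, hik, fi⟩
    · simp only [List.map_cons, List.mem_cons, not_or]
      exact ⟨hij.symm, Ne.symm huj, hjk, fj⟩
  have s1 := h.sq i (by simp)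
  have s2 := h.sq j (by simp)
  rw [e1, e2, e3, e4, e5, e6]
  linear_combination (M u j * M u j * unitMinor ((((S.erase j).erase i).erase u).erase k) M p ^ 2)
    * s1 + unitMinor ((((S.erase j).erase i).erase u).erase k) M p ^ 2 * s2

/-- A vertex with the single edge `j` can be removed together with `j`; likewise an edge whose row
has a single entry, in the column of a vertex `j`, can be removed together with `j`. -/
theorem IsStar.remove_one (hM : ∀ x y, M x y = M y x) {u j : κ}
    (h : IsStar S M u {j}) (hp : ValidPairs S p)
    (hpu : ∀ q ∈ p, ∀ z ∈ [u, j], q.1 ≠ z ∧ q.2 ≠ z) :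
    unitMinor S M p = -unitMinor ((S.erase j).erase u) M p := by
  have hu : u ∈ S := h.mem
  have hj : j ∈ S := h.subset (by simp)
  have huj : u ≠ j := by simpa using h.notMem
  have hf : ∀ z ∈ [u, j], z ∉ p.map Prod.fst := by
    intro z hz hzp
    obtain ⟨q, hq, rfl⟩ := List.mem_map.1 hzp
    exact (hpu q hq _ hz).1 rfl
  have hs : ∀ z ∈ [u, j], z ∉ p.map Prod.snd := by
    intro z hz hzp
    obtain ⟨q, hq, rfl⟩ := List.mem_map.1 hzp
    exact (hpu q hq _ hz).2 rfl
  simp only [List.forall_mem_cons] at hf hs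
  obtain ⟨fu, fj, -⟩ := hf
  obtain ⟨su, sj, -⟩ := hs
  have e1 : unitMinor S M p = M u j * unitMinor S M ((u, j) :: p) :=
    h.row_single hp fu (by simp) fun y hy hyj => absurd (Finset.mem_singleton.1 hy) hyj
  have e2 : unitMinor S M ((u, j) :: p) = M u j * unitMinor S M ((j, u) :: (u, j) :: p) := by
    apply h.col_single hM
    · simp only [List.map_cons, List.mem_cons, not_or]
      exact ⟨huj, su⟩
    · simp
    · simp only [List.map_cons, List.mem_cons, not_or]
      exact ⟨huj.symm, fj⟩
    · exact fun y hy hyj => absurd (Finset.mem_singleton.1 hy) hyj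
  have e3 : unitMinor S M ((j, u) :: (u, j) :: p) = -unitMinor S M ((j, j) :: (u, u) :: p) :=
    unitMinor_swap M hj hu hu hj huj.symm fj fu
  have e4 : unitMinor S M ((j, j) :: (u, u) :: p) = unitMinor ((S.erase j).erase u) M p := by
    rw [unitMinor_erase M hj, unitMinor_erase M (by simp [hu, huj]) fu]
    simp only [List.map_cons, List.mem_cons, not_or]
    exact ⟨huj.symm, fj⟩
  rw [e1, e2, e3, e4, ← mul_assoc, h.sq j (by simp), one_mul]

/-- Removal of a vertex `u` of degree two. -/
theorem IsStar.remove_two (hM : ∀ x y, M x y = M y x) {u i j : κ}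
    (h : IsStar S M u {i, j}) (hij : i ≠ j) (hp : ValidPairs S p)
    (hpu : ∀ q ∈ p, ∀ z ∈ [u, i, j], q.1 ≠ z ∧ q.2 ≠ z) :
    unitMinor S M ((i, i) :: p) = -unitMinor (((S.erase i).erase j).erase u) M p := by
  have hi : i ∈ S := h.subset (by simp)
  have hj : j ∈ S := h.subset (by simp)
  have hui : u ≠ i := fun e => h.notMem (by simp [e])
  have h' : IsStar (S.erase i) M u {j} := by
    have := h.mono (Finset.erase_subset i S) (Finset.mem_erase.2 ⟨hui, h.mem⟩)
    convert this using 1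
    ext z
    simp only [Finset.mem_singleton, Finset.mem_inter, Finset.mem_insert, Finset.mem_erase]
    constructor
    · rintro rfl
      exact ⟨Or.inr rfl, hij.symm, hj⟩
    · tauto
  rw [unitMinor_erase M hi fun hm => ?_]
  · apply h'.remove_one hM (hp.mono_erase fun q hq => hpu q hq i (by simp))
    intro q hq z hz
    apply hpu q hq
    simp only [List.mem_cons] at hz ⊢
    tauto
  · obtain ⟨q, hq, hqi⟩ := List.mem_map.1 hm
    exact (hpu q hq i (by simp)).1 hqi

end Stars

section FreeOf

variable {E : Type*} {e : E} {P Q : MvPolynomial E ℤ}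

theorem freeOf_iff : FreeOf e P ↔ P ∈ supported ℤ ({e}ᶜ : Set E) := by
  rw [mem_supported, FreeOf]
  constructor
  · intro h x hx
    rintro rfl
    exact h hx
  · intro h hx
    exact h hx rfl

theorem FreeOf.add (hP : FreeOf e P) (hQ : FreeOf e Q) : FreeOf e (P + Q) :=
  freeOf_iff.2 (add_mem (freeOf_iff.1 hP) (freeOf_iff.1 hQ))

theorem FreeOf.sub (hP : FreeOf e P) (hQ : FreeOf e Q) : FreeOf e (P - Q) :=
  freeOf_iff.2 (sub_mem (freeOf_iff.1 hP) (freeOf_iff.1 hQ))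

theorem FreeOf.mul (hP : FreeOf e P) (hQ : FreeOf e Q) : FreeOf e (P * Q) :=
  freeOf_iff.2 (mul_mem (freeOf_iff.1 hP) (freeOf_iff.1 hQ))

theorem FreeOf.neg (hP : FreeOf e P) : FreeOf e (-P) :=
  freeOf_iff.2 (neg_mem (freeOf_iff.1 hP))

theorem FreeOf.pow (hP : FreeOf e P) (n : ℕ) : FreeOf e (P ^ n) :=
  freeOf_iff.2 (pow_mem (freeOf_iff.1 hP) n)

theorem freeOf_zero : FreeOf e (0 : MvPolynomial E ℤ) := freeOf_iff.2 (zero_mem _)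

theorem freeOf_one : FreeOf e (1 : MvPolynomial E ℤ) := freeOf_iff.2 (one_mem _)

theorem freeOf_ofNat (n : ℕ) [n.AtLeastTwo] :
    FreeOf e (OfNat.ofNat n : MvPolynomial E ℤ) := freeOf_iff.2 (ofNat_mem _ n)

theorem freeOf_X {f : E} (h : f ≠ e) : FreeOf e (X f : MvPolynomial E ℤ) :=
  freeOf_iff.2 ((X_mem_supported (R := ℤ)).2 h)

theorem freeOf_C (n : ℤ) : FreeOf e (C n : MvPolynomial E ℤ) :=
  freeOf_iff.2 (Subalgebra.algebraMap_mem _ n)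

theorem freeOf_det {ι : Type*} [Fintype ι] [DecidableEq ι] {A : Matrix ι ι (MvPolynomial E ℤ)}
    (h : ∀ i j, FreeOf e (A i j)) : FreeOf e A.det := by
  rw [freeOf_iff, Matrix.det_apply]
  refine sum_mem fun σ _ => ?_
  rw [Units.smul_def]
  exact zsmul_mem (prod_mem fun i _ => freeOf_iff.1 (h _ _)) _

end FreeOf

namespace Multigraph

variable {V E : Type*} [DecidableEq V] [DecidableEq E] (G : Multigraph V E) {S : Finset (E ⊕ V)}
  {p : List ((E ⊕ V) × (E ⊕ V))} {K K' : Finset E} {e : E}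

theorem unitMinor_expand (heS : Sum.inl e ∈ S) (hep : Sum.inl e ∉ p.map Prod.fst) (heK : e ∉ K) :
    unitMinor S (G.laplacian K) p =
      X e * unitMinor S (G.laplacian (insert e K)) ((Sum.inl e, Sum.inl e) :: p) +
        unitMinor S (G.laplacian (insert e K)) p := by
  have h1 := sum_row_mul_unitMinor (G.laplacian K) heS heS hep hep
  have h2 := sum_row_mul_unitMinor (G.laplacian (insert e K)) heS heS hep hep
  rw [if_pos rfl] at h1 h2
  have h3 : ∀ y, unitMinor S (G.laplacian K) ((Sum.inl e, y) :: p) =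
      unitMinor S (G.laplacian (insert e K)) ((Sum.inl e, y) :: p) := by
    intro y
    refine unitMinor_congr fun x hx hxp z hz => ?_
    have hxe : x ≠ Sum.inl e := fun h => hxp (by simp [h])
    rcases x with f | f <;> rcases z with g | g <;> simp [laplacian, Matrix.diagonal_apply]
    have hfe : f ≠ e := fun h => hxe (by rw [h])
    simp [hfe]
  rw [← h1, ← h2, ← sub_eq_iff_eq_add, ← Finset.sum_sub_distrib]
  rw [Finset.sum_eq_single_of_mem _ heS]
  · rw [h3]
    simp [laplacian, heK]
  · intro y hy hye
    rw [h3]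
    rcases y with f | f
    · have hfe : e ≠ f := fun h => hye (by rw [h])
      simp [laplacian, hfe]
    · simp [laplacian]

theorem unitMinor_insert (hp : ValidPairs S p)
    (he : Sum.inl e ∉ S ∨ Sum.inl e ∈ p.map Prod.fst ∨ Sum.inl e ∈ p.map Prod.snd) :
    unitMinor S (G.laplacian K) p = unitMinor S (G.laplacian (insert e K)) p := by
  by_cases heK : e ∈ K
  · rw [Finset.insert_eq_of_mem heK]
  by_cases h : Sum.inl e ∉ S ∨ Sum.inl e ∈ p.map Prod.fst
  · refine unitMinor_congr fun x hx hxp z hz => ?_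
    have hxe : x ≠ Sum.inl e := by
      rintro rfl
      tauto
    rcases x with f | f <;> rcases z with g | g <;> simp [laplacian, Matrix.diagonal_apply]
    have hfe : f ≠ e := fun h => hxe (by rw [h])
    simp [hfe]
  · push Not at h
    have h1 : Sum.inl e ∈ p.map Prod.snd := by tauto
    rw [G.unitMinor_expand h.1 h.2 heK, hp.snd_zero h.1 h.2 h1, mul_zero, zero_add]

/-- The variables of edges that index a removed row or column, or do not occur in `S`, do not
matter. -/
theorem unitMinor_congr_vars (hp : ValidPairs S p)
    (h : ∀ e, Sum.inl e ∈ S → Sum.inl e ∉ p.map Prod.fst → Sum.inl e ∉ p.map Prod.snd →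
      (e ∈ K ↔ e ∈ K')) :
    unitMinor S (G.laplacian K) p = unitMinor S (G.laplacian K') p := by
  classical
  have aux : ∀ F : Finset E, (∀ e ∈ F, Sum.inl e ∉ S ∨ Sum.inl e ∈ p.map Prod.fst ∨
      Sum.inl e ∈ p.map Prod.snd) → ∀ K : Finset E,
      unitMinor S (G.laplacian K) p = unitMinor S (G.laplacian (F ∪ K)) p := by
    intro F
    induction F using Finset.induction_on with
    | empty => simp
    | insert a F _ ih =>
      intro hF K
      rw [ih (fun e he => hF e (Finset.mem_insert_of_mem he)) K, Finset.insert_union]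
      exact G.unitMinor_insert hp (hF a (Finset.mem_insert_self a F))
  set F := (K ∪ K').filter fun e => Sum.inl e ∉ S ∨ Sum.inl e ∈ p.map Prod.fst ∨
      Sum.inl e ∈ p.map Prod.snd with hF
  have hF' : ∀ e ∈ F, Sum.inl e ∉ S ∨ Sum.inl e ∈ p.map Prod.fst ∨
      Sum.inl e ∈ p.map Prod.snd := fun e he => (Finset.mem_filter.1 he).2
  rw [aux F hF' K, aux F hF' K']
  congr 2
  ext e
  have := h e
  simp only [hF, Finset.mem_union, Finset.mem_filter]
  tauto

theorem freeOf_unitMinor (hp : ValidPairs S p)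
    (he : e ∈ K ∨ Sum.inl e ∈ p.map Prod.fst ∨ Sum.inl e ∈ p.map Prod.snd ∨ Sum.inl e ∉ S) :
    FreeOf e (unitMinor S (G.laplacian K) p) := by
  have h : unitMinor S (G.laplacian K) p = unitMinor S (G.laplacian (insert e K)) p := by
    apply G.unitMinor_congr_vars hp
    intro f hf hf1 hf2
    rw [Finset.mem_insert]
    by_cases hfe : f = e
    · subst hfe; tauto
    · tauto
  rw [h]
  refine freeOf_det fun x y => ?_
  simp only [rowSubst, Matrix.of_apply]
  split_ifs
  · exact freeOf_one
  · exact freeOf_zero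
  · rcases x with ⟨f | f, _⟩ <;> rcases y with ⟨g | g, _⟩
    · simp only [laplacian, Matrix.fromBlocks_apply₁₁, Matrix.diagonal_apply]
      split_ifs with h1 h2
      · exact freeOf_zero
      · exact freeOf_X fun h3 => h2 (h3 ▸ Finset.mem_insert_self _ _)
      · exact freeOf_zero
    · exact freeOf_C _
    · exact freeOf_C _
    · exact freeOf_zero

end Multigraph

/-! ### Deletion, contraction and removal of vertices -/

namespace Multigraph

variable {V E : Type*} [DecidableEq V] [DecidableEq E] {G : Multigraph V E}

/-- The pairs in `p` are pairs of edges of `G`, without repetition in either component. -/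
structure EdgePairs (G : Multigraph V E) (p : List (E × E)) : Prop where
  fst_nodup : (p.map Prod.fst).Nodup
  snd_nodup : (p.map Prod.snd).Nodup
  mem : ∀ q ∈ p, q.1 ∈ G.edges ∧ q.2 ∈ G.edges

theorem EdgePairs.valid {p : List (E × E)} (hp : G.EdgePairs p) (v : V) :
    ValidPairs (G.labels v) (p.map edgePair) := by
  constructor
  · have := hp.fst_nodup.map (Sum.inl_injective (α := E) (β := V))
    simpa [List.map_map, Function.comp_def] using this
  · simp only [List.mem_map]
    rintro _ ⟨q, hq, rfl⟩
    exact ⟨inl_mem_labels.2 (hp.mem q hq).1, inl_mem_labels.2 (hp.mem q hq).2⟩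

theorem EdgePairs.dodgson_eq {p : List (E × E)} (hp : G.EdgePairs p) (K : Finset E) {v : V}
    (hv : v ∈ G.verts) : G.dodgson (p.map Prod.fst) (p.map Prod.snd) K =
      (-1) ^ (G.verts.card - 1) * unitMinor (G.labels v) (G.laplacian K) (p.map edgePair) :=
  G.dodgson_eq K p hv hp.fst_nodup hp.snd_nodup

theorem EdgePairs.cons {V E : Type*} {G : Multigraph V E} {p : List (E × E)}
    (hp : G.EdgePairs p) {e : E} (he : e ∈ G.edges) (hep : ∀ q ∈ p, q.1 ≠ e ∧ q.2 ≠ e) :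
    G.EdgePairs ((e, e) :: p) := by
  refine ⟨?_, ?_, ?_⟩
  · rw [List.map_cons, List.nodup_cons]
    refine ⟨fun h => ?_, hp.fst_nodup⟩
    obtain ⟨q, hq, hqe⟩ := List.mem_map.1 h
    exact (hep q hq).1 hqe
  · rw [List.map_cons, List.nodup_cons]
    refine ⟨fun h => ?_, hp.snd_nodup⟩
    obtain ⟨q, hq, hqe⟩ := List.mem_map.1 h
    exact (hep q hq).2 hqe
  · simp only [List.forall_mem_cons]
    exact ⟨⟨he, he⟩, hp.mem⟩

theorem EdgePairs.append_diag {V E : Type*} {G : Multigraph V E} {p : List (E × E)}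
    (hp : G.EdgePairs p) (D : List E) (hD : D.Nodup)
    (hDG : ∀ f ∈ D, f ∈ G.edges) (hd : ∀ f ∈ D, ∀ q ∈ p, q.1 ≠ f ∧ q.2 ≠ f) :
    G.EdgePairs (D.map (fun f => (f, f)) ++ p) := by
  induction D with
  | nil => simpa using hp
  | cons f D ih =>
    rw [List.map_cons, List.cons_append]
    have hn := List.nodup_cons.1 hD
    apply (ih hn.2 (fun g hg => hDG g (List.mem_cons_of_mem _ hg))
      (fun g hg => hd g (List.mem_cons_of_mem _ hg))).cons (hDG f (by simp))
    intro q hq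
    rcases List.mem_append.1 hq with hq | hq
    · obtain ⟨g, hg, rfl⟩ := List.mem_map.1 hq
      have : g ≠ f := fun h => hn.1 (h ▸ hg)
      exact ⟨this, this⟩
    · exact hd f (by simp) q hq

theorem dodgson_deleteEdge {p : List (E × E)} (hp : G.EdgePairs p) {e : E} (he : e ∈ G.edges)
    (hep : ∀ q ∈ p, q.1 ≠ e ∧ q.2 ≠ e) (K : Finset E) :
    (G.deleteEdge e).dodgson (p.map Prod.fst) (p.map Prod.snd) K =
      G.dodgson (e :: p.map Prod.fst) (e :: p.map Prod.snd) K := by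
  have hp' : (G.deleteEdge e).EdgePairs p := ⟨hp.fst_nodup, hp.snd_nodup, fun q hq =>
    ⟨Finset.mem_erase.2 ⟨(hep q hq).1, (hp.mem q hq).1⟩,
      Finset.mem_erase.2 ⟨(hep q hq).2, (hp.mem q hq).2⟩⟩⟩
  have hv : G.src e ∈ G.verts := G.src_mem e he
  have h1 := (hp.cons he hep).dodgson_eq K hv
  rw [List.map_cons, List.map_cons, List.map_cons, unitMinor_erase _ (inl_mem_labels.2 he)] at h1
  · rw [h1, hp'.dodgson_eq K hv]
    have h2 : (G.deleteEdge e).labels (G.src e) = (G.labels (G.src e)).erase (Sum.inl e) := by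
      ext x
      rcases x with x | x <;> simp [labels, deleteEdge]
    rw [h2]
    rfl
  · rw [mem_map_edgePair_inl]
    intro h
    obtain ⟨q, hq, hqe⟩ := List.mem_map.1 h
    exact (hep q hq).1 hqe

/-- Contraction of an edge sets its variable to zero: with `α_e = 0` the row and the column of `e`
only identify the two end points of `e`. -/
theorem dodgson_contractEdge {p : List (E × E)} (hp : G.EdgePairs p) {e : E}
    (he : e ∈ G.edges ∧ G.src e ≠ G.tgt e)
    (hep : ∀ q ∈ p, q.1 ≠ e ∧ q.2 ≠ e) {K : Finset E} (heK : e ∉ K) :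
    (G.contractEdge e he).dodgson (p.map Prod.fst) (p.map Prod.snd) K =
      G.dodgson (p.map Prod.fst) (p.map Prod.snd) (insert e K) := by
  have hp' : (G.contractEdge e he).EdgePairs p := ⟨hp.fst_nodup, hp.snd_nodup, fun q hq =>
    ⟨Finset.mem_erase.2 ⟨(hep q hq).1, (hp.mem q hq).1⟩,
      Finset.mem_erase.2 ⟨(hep q hq).2, (hp.mem q hq).2⟩⟩⟩
  have hv : G.src e ∈ G.verts := G.src_mem e he.1
  have ht : G.tgt e ∈ G.verts := G.tgt_mem e he.1
  have hv' : G.src e ∈ (G.contractEdge e he).verts := Finset.mem_erase.2 ⟨he.2, hv⟩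
  rw [hp'.dodgson_eq K hv', hp.dodgson_eq _ hv]
  have hstar : IsStar (G.labels (G.src e)) (G.laplacian (insert e K)) (Sum.inl e)
      {Sum.inr (G.tgt e)} := by
    refine ⟨inl_mem_labels.2 he.1, ?_, by simp, ?_, ?_⟩
    · simpa [inr_mem_labels] using ⟨he.2.symm, ht⟩
    · intro y hy hyt
      rcases y with f | u
      · simp only [laplacian, Matrix.fromBlocks_apply₁₁, Matrix.diagonal_apply]
        split_ifs with h1 h2
        · rfl
        · exact absurd (h1 ▸ Finset.mem_insert_self e K) h2
        · rfl
      · rw [inr_mem_labels] at hy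
        have h1 : G.tgt e ≠ u := fun h => hyt (by simp [h])
        simp [laplacian, incidence, hy.1.symm, h1]
    · simp [laplacian, incidence, he.2]
  rw [hstar.remove_one (G.laplacian_symm _) (hp.valid _)]
  · have h1 : (G.contractEdge e he).labels (G.src e) =
        ((G.labels (G.src e)).erase (Sum.inr (G.tgt e))).erase (Sum.inl e) := by
      ext x
      rcases x with x | x <;> simp [labels, contractEdge]
      tauto
    have h2 : unitMinor (((G.labels (G.src e)).erase (Sum.inr (G.tgt e))).erase (Sum.inl e))
        ((G.contractEdge e he).laplacian K) (p.map edgePair) =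
        unitMinor (((G.labels (G.src e)).erase (Sum.inr (G.tgt e))).erase (Sum.inl e))
        (G.laplacian (insert e K)) (p.map edgePair) := by
      have hinc : ∀ u f, u ≠ G.src e → u ≠ G.tgt e →
          (G.contractEdge e he).incidence u f = G.incidence u f := by
        intro u f hus hut
        simp only [incidence, contractEdge]
        split_ifs <;> simp_all
      refine unitMinor_congr fun x hx _ y hy => ?_
      rcases x with f | u <;> rcases y with g | w
      · have hfe : f ≠ e := by rintro rfl; simp at hx
        simp [laplacian, Matrix.diagonal_apply, hfe]
      · have hw : w ≠ G.src e ∧ w ≠ G.tgt e := by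
          simp [inr_mem_labels] at hy
          tauto
        simp [laplacian, hinc w f hw.1 hw.2]
      · have hw : u ≠ G.src e ∧ u ≠ G.tgt e := by
          simp [inr_mem_labels] at hx
          tauto
        simp [laplacian, hinc u g hw.1 hw.2]
      · simp [laplacian]
    rw [h1, h2]
    have h3 : (G.contractEdge e he).verts.card + 1 = G.verts.card :=
      Finset.card_erase_add_one ht
    have h4 : 0 < (G.contractEdge e he).verts.card := Finset.card_pos.2 ⟨_, hv'⟩
    obtain ⟨m, hm⟩ := Nat.exists_eq_add_of_lt h4
    rw [← h3, hm]
    simp only [zero_add, Nat.add_sub_cancel, pow_succ]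
    ring
  · simp only [List.mem_map]
    rintro _ ⟨q, hq, rfl⟩ z hz
    simp only [List.mem_cons, List.not_mem_nil, or_false] at hz
    rcases hz with rfl | rfl
    · simpa using hep q hq
    · simp

/-- A self-loop with variable zero is a zero row of the Laplacian; this matches `G / e = 0`. -/
theorem dodgson_eq_zero_of_loop {p : List (E × E)} (hp : G.EdgePairs p) {e : E} (he : e ∈ G.edges)
    (hloop : G.src e = G.tgt e) (hep : ∀ q ∈ p, q.1 ≠ e) (K : Finset E) (heK : e ∈ K) :
    G.dodgson (p.map Prod.fst) (p.map Prod.snd) K = 0 := by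
  rw [hp.dodgson_eq K (G.src_mem e he)]
  have hstar : IsStar (G.labels (G.src e)) (G.laplacian K) (Sum.inl e) ∅ := by
    refine ⟨inl_mem_labels.2 he, by simp, by simp, ?_, by simp⟩
    intro y hy _
    rcases y with f | u
    · simp only [laplacian, Matrix.fromBlocks_apply₁₁, Matrix.diagonal_apply, heK, if_true]
      simp
    · simp [laplacian, incidence, hloop]
  rw [hstar.row_zero (hp.valid _) _ (by simp), mul_zero]
  rw [mem_map_edgePair_inl]
  intro h
  obtain ⟨q, hq, hqe⟩ := List.mem_map.1 h
  exact hep q hq hqe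

end Multigraph

namespace GraphSum

variable {V E : Type*} [DecidableEq V] [DecidableEq E]

open Multigraph

theorem foldl_contract_zero (C : List E) :
    C.foldl (fun H' e => contract e H') (0 : GraphSum V E) = 0 := by
  induction C with
  | nil => rfl
  | cons e C ih => rw [List.foldl_cons, map_zero, ih]

/-- Iterated contraction sets the variables to zero.  An edge of `C` may become a self-loop on the
way; then both sides vanish. -/
theorem dodgson_foldl_contract {p : List (E × E)} (C : List E) {K : Finset E} (hC : C.Nodup)
    (hCp : ∀ q ∈ p, q.1 ∉ C ∧ q.2 ∉ C) (hCK : ∀ e ∈ C, e ∉ K) (G : Multigraph V E)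
    (hp : G.EdgePairs p) (hCG : ∀ e ∈ C, e ∈ G.edges) :
    dodgson (p.map Prod.fst) (p.map Prod.snd) K
      (C.foldl (fun H' e => contract e H') (FreeAbelianGroup.of G)) =
      G.dodgson (p.map Prod.fst) (p.map Prod.snd) (K ∪ C.toFinset) := by
  induction C generalizing G K with
  | nil => simp [dodgson]
  | cons e C ih =>
    obtain ⟨heC, hC⟩ := List.nodup_cons.1 hC
    have hep : ∀ q ∈ p, q.1 ≠ e ∧ q.2 ≠ e := fun q hq =>
      ⟨fun h => (hCp q hq).1 (by simp [h]), fun h => (hCp q hq).2 (by simp [h])⟩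
    have heG := hCG e (by simp)
    have heK := hCK e (by simp)
    have hins : K ∪ (e :: C).toFinset = insert e (K ∪ C.toFinset) := by
      rw [List.toFinset_cons, Finset.union_insert]
    rw [List.foldl_cons, hins]
    have h1 : contract e (FreeAbelianGroup.of G) = G.contract e :=
      FreeAbelianGroup.lift_apply_of _ _
    rw [h1, Multigraph.contract]
    split_ifs with h
    · have hp' : (G.contractEdge e h).EdgePairs p := ⟨hp.fst_nodup, hp.snd_nodup, fun q hq =>
        ⟨Finset.mem_erase.2 ⟨(hep q hq).1, (hp.mem q hq).1⟩,
          Finset.mem_erase.2 ⟨(hep q hq).2, (hp.mem q hq).2⟩⟩⟩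
      rw [ih hC (fun q hq => ⟨fun hm => (hCp q hq).1 (List.mem_cons_of_mem _ hm),
        fun hm => (hCp q hq).2 (List.mem_cons_of_mem _ hm)⟩)
        (fun f hf => hCK f (List.mem_cons_of_mem _ hf)) _ hp'
        (fun f hf => Finset.mem_erase.2 ⟨fun hfe => heC (hfe ▸ hf),
          hCG f (List.mem_cons_of_mem _ hf)⟩)]
      refine dodgson_contractEdge hp h hep ?_
      simp [heK, heC]
    · rw [foldl_contract_zero, map_zero]
      have hloop : G.src e = G.tgt e := by
        by_contra hne
        exact h ⟨heG, hne⟩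
      rw [dodgson_eq_zero_of_loop hp heG hloop (fun q hq => (hep q hq).1) _
        (Finset.mem_insert_self _ _)]

/-- Deletion of `e` amounts to removing the row and the column of `e`, contraction of `e` amounts to
`α_e = 0`. -/
theorem dodgson_minor {p : List (E × E)} (D C : List E) {K : Finset E} (hDC : (D ++ C).Nodup)
    (hp : ∀ q ∈ p, q.1 ∉ D ++ C ∧ q.2 ∉ D ++ C) (hCK : ∀ e ∈ C, e ∉ K) (G : Multigraph V E)
    (hpG : G.EdgePairs p) (hG : ∀ e ∈ D ++ C, e ∈ G.edges) :
    dodgson (p.map Prod.fst) (p.map Prod.snd) K (minor (FreeAbelianGroup.of G) D C) =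
      G.dodgson (D ++ p.map Prod.fst) (D ++ p.map Prod.snd) (K ∪ C.toFinset) := by
  induction D generalizing G with
  | nil => exact dodgson_foldl_contract C hDC hp hCK G hpG hG
  | cons e D ih =>
    rw [List.cons_append] at hDC hp hG
    obtain ⟨heDC, hDC⟩ := List.nodup_cons.1 hDC
    have hep : ∀ q ∈ p, q.1 ≠ e ∧ q.2 ≠ e := fun q hq =>
      ⟨fun h => (hp q hq).1 (by simp [h]), fun h => (hp q hq).2 (by simp [h])⟩
    have h1 : minor (FreeAbelianGroup.of G) (e :: D) C =
        minor (FreeAbelianGroup.of (G.deleteEdge e)) D C := by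
      simp only [minor, List.foldl_cons]
      rfl
    have heG := hG e (by simp)
    have hpG' : (G.deleteEdge e).EdgePairs p := ⟨hpG.fst_nodup, hpG.snd_nodup, fun q hq =>
      ⟨Finset.mem_erase.2 ⟨(hep q hq).1, (hpG.mem q hq).1⟩,
        Finset.mem_erase.2 ⟨(hep q hq).2, (hpG.mem q hq).2⟩⟩⟩
    have hp' : ∀ q ∈ p, q.1 ∉ D ++ C ∧ q.2 ∉ D ++ C := fun q hq =>
      ⟨fun hm => (hp q hq).1 (List.mem_cons_of_mem _ hm),
        fun hm => (hp q hq).2 (List.mem_cons_of_mem _ hm)⟩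
    have hDG : ∀ f ∈ D ++ C, f ∈ G.edges := fun f hf => hG f (List.mem_cons_of_mem _ hf)
    have hDn : D.Nodup := (List.nodup_append.1 hDC).1
    rw [h1, ih hDC hp' _ hpG' (fun f hf => Finset.mem_erase.2
      ⟨fun hfe => heDC (hfe ▸ hf), hDG f hf⟩)]
    have h2 : G.EdgePairs (D.map (fun f => (f, f)) ++ p) := by
      refine hpG.append_diag D hDn (fun f hf => hDG f (List.mem_append_left _ hf)) ?_
      exact fun f hf q hq => ⟨fun h => (hp' q hq).1 (by simp [h, hf]),
        fun h => (hp' q hq).2 (by simp [h, hf])⟩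
    have h3 := dodgson_deleteEdge h2 heG (fun q hq => by
      rcases List.mem_append.1 hq with hq | hq
      · obtain ⟨g, hg, rfl⟩ := List.mem_map.1 hq
        have : g ≠ e := fun h => heDC (h ▸ List.mem_append_left _ hg)
        exact ⟨this, this⟩
      · exact hep q hq) (K ∪ C.toFinset)
    simpa [List.map_map, Function.comp_def] using h3

end GraphSum

namespace Multigraph

variable {V E : Type*} [DecidableEq V] [DecidableEq E] {G : Multigraph V E}

/-- `u` is a vertex of `G` whose edges are the edges in `T`, none of which is a self-loop. -/
structure HasStar (G : Multigraph V E) (u : V) (T : Finset E) : Prop where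
  mem : u ∈ G.verts
  incident : G.incidentEdges u = T
  no_loop : ∀ e ∈ T, G.src e ≠ G.tgt e

theorem IsThreeValent.hasStar {u : V} {i j k : E} (h : G.IsThreeValent u i j k) :
    G.HasStar u {i, j, k} := ⟨h.mem, h.incident, by rw [← h.incident]; exact h.no_loop⟩

theorem mem_incidentEdges {V E : Type*} [DecidableEq V] {G : Multigraph V E} {u : V} {e : E} :
    e ∈ G.incidentEdges u ↔ e ∈ G.edges ∧ (G.src e = u ∨ G.tgt e = u) := Finset.mem_filter

theorem HasStar.mem_iff {V E : Type*} [DecidableEq V] {G : Multigraph V E}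
    {u : V} {T : Finset E} (h : G.HasStar u T) {e : E} :
    e ∈ T ↔ e ∈ G.edges ∧ (G.src e = u ∨ G.tgt e = u) := by
  rw [← h.incident, mem_incidentEdges]

theorem HasStar.removeVerts {u w : V} {T T' : Finset E} (h : G.HasStar w T) (h' : G.HasStar u T')
    (huw : w ≠ u) : (G.removeVerts {u}).HasStar w (T \ T') := by
  refine ⟨Finset.mem_sdiff.2 ⟨h.mem, by simpa using huw⟩, ?_,
    fun e he => h.no_loop e (Finset.mem_sdiff.1 he).1⟩
  ext e
  rw [mem_incidentEdges, Finset.mem_sdiff, h.mem_iff, h'.mem_iff]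
  simp only [Multigraph.removeVerts, Finset.mem_filter, Finset.mem_singleton]
  tauto

theorem HasStar.isStar {u v : V} {T : Finset E} (h : G.HasStar u T) (huv : u ≠ v) (K : Finset E) :
    IsStar (G.labels v) (G.laplacian K) (Sum.inr u) (T.image Sum.inl) := by
  refine ⟨inr_mem_labels.2 ⟨huv, h.mem⟩, ?_, by simp, ?_, ?_⟩
  · intro y hy
    obtain ⟨e, he, rfl⟩ := Finset.mem_image.1 hy
    exact inl_mem_labels.2 (h.mem_iff.1 he).1
  · intro y hy hyT
    rcases y with e | w
    · have h1 : e ∉ T := fun he => hyT (Finset.mem_image_of_mem _ he)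
      rw [h.mem_iff] at h1
      have h2 := inl_mem_labels.1 hy
      have h3 : G.src e ≠ u ∧ G.tgt e ≠ u := by tauto
      simp [laplacian, incidence, h3]
    · simp [laplacian]
  · intro y hy
    obtain ⟨e, he, rfl⟩ := Finset.mem_image.1 hy
    have h1 := h.no_loop e he
    rcases (h.mem_iff.1 he).2 with h2 | h2
    · have h3 : G.tgt e ≠ u := fun h3 => h1 (h2.trans h3.symm)
      simp [laplacian, incidence, h2, h3]
    · have h3 : G.src e ≠ u := fun h3 => h1 (h3.trans h2.symm)
      simp [laplacian, incidence, h2, h3]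

theorem HasStar.labels_removeVerts {u v : V} {T : Finset E} (h : G.HasStar u T) :
    (G.removeVerts {u}).labels v = G.labels v \ insert (Sum.inr u) (T.image Sum.inl) := by
  ext x
  rcases x with e | w
  · rw [inl_mem_labels, Finset.mem_sdiff, inl_mem_labels]
    have := h.mem_iff (e := e)
    simp [Multigraph.removeVerts]
    tauto
  · rw [inr_mem_labels, Finset.mem_sdiff, inr_mem_labels]
    simp [Multigraph.removeVerts]
    tauto

theorem removeVerts_removeVerts {V E : Type*} [DecidableEq V] {G : Multigraph V E}
    (S T : Finset V) :
    (G.removeVerts S).removeVerts T = G.removeVerts (S ∪ T) := by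
  have h1 : (G.verts \ S) \ T = G.verts \ (S ∪ T) := by
    ext x; simp; tauto
  have h2 : (G.edges.filter fun e => G.src e ∉ S ∧ G.tgt e ∉ S).filter
      (fun e => G.src e ∉ T ∧ G.tgt e ∉ T) =
      G.edges.filter fun e => G.src e ∉ S ∪ T ∧ G.tgt e ∉ S ∪ T := by
    ext x; simp; tauto
  simp only [removeVerts, mk.injEq]
  exact ⟨h1, h2, trivial, trivial⟩

end Multigraph

/-! ### Uniqueness of the reduction, and its steps at vertices of degree two and three -/

section QuadraticSteps

variable {E : Type*} {e : E}

/-- Polynomials of degree at most four in `α_e` have unique coefficients. -/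
theorem quartic_coeff_unique {a₀ a₁ a₂ a₃ a₄ b₀ b₁ b₂ b₃ b₄ : MvPolynomial E ℤ}
    (ha : ∀ P ∈ [a₀, a₁, a₂, a₃, a₄], FreeOf e P) (hb : ∀ P ∈ [b₀, b₁, b₂, b₃, b₄], FreeOf e P)
    (h : a₄ * X e ^ 4 + a₃ * X e ^ 3 + a₂ * X e ^ 2 + a₁ * X e + a₀ =
      b₄ * X e ^ 4 + b₃ * X e ^ 3 + b₂ * X e ^ 2 + b₁ * X e + b₀) :
    a₀ = b₀ ∧ a₁ = b₁ ∧ a₂ = b₂ ∧ a₃ = b₃ ∧ a₄ = b₄ := by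
  classical
  let φ : MvPolynomial E ℤ →ₐ[ℤ] Polynomial (MvPolynomial E ℤ) :=
    aeval fun f => if f = e then Polynomial.X else Polynomial.C (X f)
  have hφ : ∀ P, FreeOf e P → φ P = Polynomial.C P := by
    intro P hP
    have := MvPolynomial.hom_congr_vars (f₁ := φ.toRingHom)
      (f₂ := (Polynomial.C : MvPolynomial E ℤ →+* _)) (p₁ := P) (p₂ := P)
      (RingHom.ext_int _ _) ?_ rfl
    · exact this
    · intro i hi _
      have : i ≠ e := fun h => hP (h ▸ hi)
      simp [φ, this]
  have hX : φ (X e) = Polynomial.X := by simp [φ]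
  simp only [List.forall_mem_cons, List.not_mem_nil, IsEmpty.forall_iff, implies_true,
    and_true] at ha hb
  obtain ⟨ha0, ha1, ha2, ha3, ha4⟩ := ha
  obtain ⟨hb0, hb1, hb2, hb3, hb4⟩ := hb
  have h1 := congrArg φ h
  simp only [map_add, map_mul, map_pow, hX, hφ _ ha0, hφ _ ha1, hφ _ ha2, hφ _ ha3, hφ _ ha4,
    hφ _ hb0, hφ _ hb1, hφ _ hb2, hφ _ hb3, hφ _ hb4] at h1
  have hc := fun n => congrArg (fun q => Polynomial.coeff q n) h1
  simp only [Polynomial.coeff_add, Polynomial.coeff_C_mul, Polynomial.coeff_X_pow,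
    Polynomial.coeff_X, Polynomial.coeff_C] at hc
  have c0 := hc 0
  have c1 := hc 1
  have c2 := hc 2
  have c3 := hc 3
  have c4 := hc 4
  norm_num at c0 c1 c2 c3 c4
  exact ⟨c0, c1, c2, c3, c4⟩

/-- Both kinds of steps express the result `Q` in the same way by the invariants of degree two and
three of the binary quartic form attached to `P`. -/
theorem QuadraticStep.quartic_invariants {P Q : MvPolynomial E ℤ} (h : QuadraticStep e P Q) :
    ∃ a₀ a₁ a₂ a₃ a₄ : MvPolynomial E ℤ, (∀ R ∈ [a₀, a₁, a₂, a₃, a₄], FreeOf e R) ∧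
      P = a₄ * X e ^ 4 + a₃ * X e ^ 3 + a₂ * X e ^ 2 + a₁ * X e + a₀ ∧
      12 * a₄ * a₀ - 3 * a₃ * a₁ + a₂ ^ 2 = Q ^ 2 ∧
      2 * a₂ ^ 3 + 27 * a₄ * a₁ ^ 2 + 27 * a₀ * a₃ ^ 2 - 72 * a₄ * a₂ * a₀ - 9 * a₃ * a₂ * a₁ =
        2 * Q ^ 3 := by
  rcases h with ⟨A, B, C, hA, hB, hC⟩ | ⟨A, B, C, D, F, hA, hB, hC, hD, hF⟩
  · refine ⟨C ^ 2, 2 * B * C, B ^ 2 + 2 * A * C, 2 * A * B, A ^ 2, ?_, ?_, ?_, ?_⟩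
    · simp only [List.forall_mem_cons]
      refine ⟨?_, ?_, ?_, ?_, ?_, by simp⟩ <;>
      repeat' first
        | with_reducible assumption
        | with_reducible apply FreeOf.add
        | with_reducible apply FreeOf.mul
        | with_reducible apply FreeOf.pow
        | with_reducible apply freeOf_ofNat
    all_goals ring
  · refine ⟨C * F ^ 2, B * F ^ 2 + 2 * C * D * F, A * F ^ 2 + 2 * B * D * F + C * D ^ 2,
      2 * A * D * F + B * D ^ 2, A * D ^ 2, ?_, ?_, ?_, ?_⟩
    · simp only [List.forall_mem_cons]
      refine ⟨?_, ?_, ?_, ?_, ?_, by simp⟩ <;>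
      repeat' first
        | with_reducible assumption
        | with_reducible apply FreeOf.add
        | with_reducible apply FreeOf.mul
        | with_reducible apply FreeOf.pow
        | with_reducible apply freeOf_ofNat
    all_goals ring

/-- The result of a step is unique: its square and its cube are determined by `P`, and a
polynomial over `ℤ` is determined by its square up to sign, and the sign by the cube. -/
theorem QuadraticStep.unique {P Q Q' : MvPolynomial E ℤ} (h : QuadraticStep e P Q)
    (h' : QuadraticStep e P Q') : Q = Q' := by
  obtain ⟨a₀, a₁, a₂, a₃, a₄, ha, hP, h2, h3⟩ := h.quartic_invariants
  obtain ⟨b₀, b₁, b₂, b₃, b₄, hb, hP', h2', h3'⟩ := h'.quartic_invariants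
  obtain ⟨rfl, rfl, rfl, rfl, rfl⟩ := quartic_coeff_unique ha hb (hP.symm.trans hP')
  have e2 : Q ^ 2 = Q' ^ 2 := h2.symm.trans h2'
  have e3 : 2 * Q ^ 3 = 2 * Q' ^ 3 := h3.symm.trans h3'
  rcases sq_eq_sq_iff_eq_or_eq_neg.1 e2 with h | h
  · exact h
  · have h4 : 4 * Q' ^ 3 = 0 := by rw [h] at e3; linear_combination -e3
    have h5 : Q' ^ 3 = 0 := by
      rcases mul_eq_zero.1 h4 with h4 | h4
      · norm_num at h4
      · exact h4
    have h6 : Q' = 0 := by simpa using h5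
    rw [h, h6, neg_zero]

/-- The step of a square of a product of two factors that are linear in `α_e` gives the square of
their resultant. -/
theorem quadraticStep_linear_mul_linear {A B C D : MvPolynomial E ℤ} (hA : FreeOf e A)
    (hB : FreeOf e B) (hC : FreeOf e C) (hD : FreeOf e D) :
    QuadraticStep e (((X e * A + B) * (X e * C + D)) ^ 2) ((A * D - B * C) ^ 2) := by
  have := QuadraticStep.square (e := e) (A * C) (A * D + B * C) (B * D) (hA.mul hC)
    ((hA.mul hD).add (hB.mul hC)) (hB.mul hD)
  convert this using 1 <;> ring

end QuadraticSteps

namespace Multigraph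

variable {V E : Type*} [DecidableEq V] [DecidableEq E] {G : Multigraph V E}

theorem IsQuadraticInvariant.three_le_length {s : List E} {P : MvPolynomial E ℤ}
    (h : G.IsQuadraticInvariant s P) : 3 ≤ s.length := by
  induction h with
  | base => simp
  | step s e P Q _ _ _ _ ih => rw [List.length_append]; omega

theorem IsQuadraticInvariant.cases_append {t : List E} {Q : MvPolynomial E ℤ}
    (h : G.IsQuadraticInvariant t Q) :
    (∃ i j k, t = [i, j, k] ∧ Q = (G.dodgson [i, k] [j, k] ∅ * G.dodgson [i] [j] {k}) ^ 2) ∨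
      ∃ s e P, t = s ++ [e] ∧ G.IsQuadraticInvariant s P ∧ QuadraticStep e P Q := by
  cases h with
  | base i j k => exact Or.inl ⟨i, j, k, rfl, rfl⟩
  | step s e P Q hP _ _ hQ => exact Or.inr ⟨s, e, P, rfl, hP, hQ⟩

theorem IsQuadraticInvariant.unique {s : List E} {P Q : MvPolynomial E ℤ}
    (hP : G.IsQuadraticInvariant s P) (hQ : G.IsQuadraticInvariant s Q) : P = Q := by
  induction hP generalizing Q with
  | base i j k =>
    rcases hQ.cases_append with ⟨i', j', k', h, rfl⟩ | ⟨s, e, P, h, hP, -⟩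
    · simp only [List.cons.injEq, and_true] at h
      obtain ⟨rfl, rfl, rfl⟩ := h
      rfl
    · have h1 := hP.three_le_length
      have h2 := congrArg List.length h
      simp at h2
      omega
  | step s e P P' hs _ _ hstep ih =>
    rcases hQ.cases_append with ⟨i', j', k', h, rfl⟩ | ⟨s', e', P'', h, hP', hstep'⟩
    · have h1 := hs.three_le_length
      have h2 := congrArg List.length h
      simp at h2
      omega
    · obtain ⟨rfl, h2⟩ := List.append_inj' h rfl
      simp only [List.cons.injEq, and_true] at h2
      subst h2
      rw [← ih hP'] at hstep'
      exact hstep.unique hstep'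

end Multigraph

section Expansions

variable {E : Type*}

/-- The expansion of a Dodgson polynomial in the variables of the edges `i`, `j`, `k` at a vertex of
degree three: the three quadratic coefficients agree and there is no cubic term. -/
structure StarExpansion (i j k : E) (g g₀ gi gj gk t : MvPolynomial E ℤ) : Prop where
  eq : g = g₀ * (X i * X j + X i * X k + X j * X k) + gi * X i + gj * X j + gk * X k + t
  free : ∀ P ∈ [g₀, gi, gj, gk, t], ∀ e ∈ [i, j, k], FreeOf e P

theorem StarExpansion.sub {i j k : E} {g g₀ gi gj gk t h h₀ hi hj hk s : MvPolynomial E ℤ}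
    (hg : StarExpansion i j k g g₀ gi gj gk t) (hh : StarExpansion i j k h h₀ hi hj hk s) :
    StarExpansion i j k (g - h) (g₀ - h₀) (gi - hi) (gj - hj) (gk - hk) (t - s) := by
  refine ⟨by rw [hg.eq, hh.eq]; ring, ?_⟩
  have h1 := hg.free
  have h2 := hh.free
  simp only [List.forall_mem_cons] at h1 h2 ⊢
  obtain ⟨⟨_, _, _, _⟩, ⟨_, _, _, _⟩, ⟨_, _, _, _⟩, ⟨_, _, _, _⟩, ⟨_, _, _, _⟩, _⟩ := h1
  obtain ⟨⟨_, _, _, _⟩, ⟨_, _, _, _⟩, ⟨_, _, _, _⟩, ⟨_, _, _, _⟩, ⟨_, _, _, _⟩, _⟩ := h2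
  refine ⟨⟨?_, ?_, ?_, by simp⟩, ⟨?_, ?_, ?_, by simp⟩, ⟨?_, ?_, ?_, by simp⟩,
    ⟨?_, ?_, ?_, by simp⟩, ⟨?_, ?_, ?_, by simp⟩, by simp⟩ <;>
  apply FreeOf.sub <;> assumption

/-- The reduction of `(Ψ g)²` in the three variables at a vertex of degree three, where `Ψ` is the
Symanzik polynomial of a graph with that vertex.  The resultant `W` of `Ψ` and `g` in `α_i` has
total degree two in `α_j`, `α_k`, hence its discriminant in `α_j` is quadratic in `α_k`, and its
leading coefficient is the result. -/
theorem Multigraph.IsQuadraticInvariant.reduce_star {V : Type*} [DecidableEq V] [DecidableEq E]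
    {G : Multigraph V E} {s : List E} {i j k : E}
    {f f₀ fi fj fk ft g g₀ gi gj gk t : MvPolynomial E ℤ}
    (hs : G.IsQuadraticInvariant s ((f * g) ^ 2)) (hi : i ∈ G.edges) (hj : j ∈ G.edges)
    (hk : k ∈ G.edges) (his : i ∉ s) (hjs : j ∉ s) (hks : k ∉ s) (hij : i ≠ j) (hik : i ≠ k)
    (hjk : j ≠ k)
    (hf : StarExpansion i j k f f₀ (-(fj + fk)) (-(fi + fk)) (-(fi + fj)) ft)
    (hfree : ∀ P ∈ [fi, fj, fk], ∀ e ∈ [i, j, k], FreeOf e P)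
    (hrel : f₀ * ft = fi * fj + fi * fk + fj * fk)
    (hg : StarExpansion i j k g g₀ gi gj gk t) :
    G.IsQuadraticInvariant (s ++ [i, j, k])
      (f₀ * (f₀ * kaellen gi gj gk - 4 * g₀ * (fi * gi + fj * gj + fk * gk + ft * g₀))) := by
  have h1 := hf.free
  have h2 := hg.free
  simp only [List.forall_mem_cons] at h1 h2 hfree
  obtain ⟨⟨_, _, _, _⟩, ⟨_, _, _, _⟩, ⟨_, _, _, _⟩, ⟨_, _, _, _⟩, ⟨_, _, _, _⟩, _⟩ := h1
  obtain ⟨⟨_, _, _, _⟩, ⟨_, _, _, _⟩, ⟨_, _, _, _⟩, ⟨_, _, _, _⟩, ⟨_, _, _, _⟩, _⟩ := h2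
  obtain ⟨⟨_, _, _, _⟩, ⟨_, _, _, _⟩, ⟨_, _, _, _⟩, _⟩ := hfree
  have hX1 : FreeOf i (X j : MvPolynomial E ℤ) := freeOf_X hij.symm
  have hX2 : FreeOf i (X k : MvPolynomial E ℤ) := freeOf_X hik.symm
  have hX3 : FreeOf j (X k : MvPolynomial E ℤ) := freeOf_X hjk.symm
  -- the coefficients of the resultant `W = a * X j ^ 2 + (b * X k + b') * X j + c`, where `c` is
  -- again quadratic in `X k`
  set a : MvPolynomial E ℤ := -(fi + fk) * g₀ - f₀ * gj with ha
  set b : MvPolynomial E ℤ := f₀ * (gi - gj - gk) - 2 * fi * g₀ with hb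
  set b' : MvPolynomial E ℤ := ft * g₀ - (fi + fk) * gi + (fj + fk) * gj - f₀ * t with hb'
  set c₂ : MvPolynomial E ℤ := -(fi + fj) * g₀ - f₀ * gk with hc₂
  set c₁ : MvPolynomial E ℤ := ft * g₀ - (fi + fj) * gi + (fj + fk) * gk - f₀ * t with hc₁
  set c₀ : MvPolynomial E ℤ := ft * gi + (fj + fk) * t with hc₀
  have s1 : G.IsQuadraticInvariant (s ++ [i])
      ((a * X j ^ 2 + (b * X k + b') * X j + (c₂ * X k ^ 2 + c₁ * X k + c₀)) ^ 2) := by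
    refine .step s i _ _ hs hi his ?_
    have := quadraticStep_linear_mul_linear (e := i) (A := f₀ * (X j + X k) - (fj + fk))
      (B := f₀ * (X j * X k) + -(fi + fk) * X j + -(fi + fj) * X k + ft)
      (C := g₀ * (X j + X k) + gi) (D := g₀ * (X j * X k) + gj * X j + gk * X k + t) ?_ ?_ ?_ ?_
    · convert this using 1
      · rw [hf.eq, hg.eq]; ring
      · simp only [ha, hb, hb', hc₂, hc₁, hc₀]; ring
    all_goals
      repeat' first
        | with_reducible assumption
        | with_reducible apply FreeOf.add
        | with_reducible apply FreeOf.sub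
        | with_reducible apply FreeOf.mul
  have s2 : G.IsQuadraticInvariant (s ++ [i] ++ [j])
      ((b * X k + b') ^ 2 - 4 * a * (c₂ * X k ^ 2 + c₁ * X k + c₀)) := by
    refine .step _ j _ _ s1 hj (by simp [hjs, hij.symm]) (.square _ _ _ ?_ ?_ ?_) <;>
    simp only [ha, hb, hb', hc₂, hc₁, hc₀] <;>
    repeat' first
      | with_reducible assumption
      | with_reducible apply FreeOf.add
      | with_reducible apply FreeOf.sub
      | with_reducible apply FreeOf.mul
      | with_reducible apply FreeOf.pow
      | with_reducible apply FreeOf.neg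
      | with_reducible apply freeOf_ofNat
  have s3 : G.IsQuadraticInvariant (s ++ [i] ++ [j] ++ [k]) (b ^ 2 - 4 * a * c₂) := by
    refine .step _ k _ _ s2 hk (by simp [hks, hik.symm, hjk.symm]) ?_
    -- the square factor is `0 * X k + 1`
    have := QuadraticStep.root (e := k) (b ^ 2 - 4 * a * c₂) (2 * b * b' - 4 * a * c₁)
      (b' ^ 2 - 4 * a * c₀) 0 1 ?_ ?_ ?_ freeOf_zero freeOf_one
    · convert this using 1 <;> ring
    all_goals
      simp only [ha, hb, hb', hc₂, hc₁, hc₀]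
      repeat' first
        | with_reducible assumption
        | with_reducible apply FreeOf.add
        | with_reducible apply FreeOf.sub
        | with_reducible apply FreeOf.mul
        | with_reducible apply FreeOf.pow
        | with_reducible apply FreeOf.neg
        | with_reducible apply freeOf_ofNat
  have hres : f₀ * (f₀ * kaellen gi gj gk - 4 * g₀ * (fi * gi + fj * gj + fk * gk + ft * g₀)) =
      b ^ 2 - 4 * a * c₂ := by
    simp only [ha, hb, hc₂, kaellen]
    linear_combination (-4 * g₀ ^ 2) * hrel
  rw [hres]
  simpa using s3

/-- The reduction of `(Ψ g)²` in the two variables at a vertex of degree two. -/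
theorem Multigraph.IsQuadraticInvariant.reduce_pair {V : Type*} [DecidableEq V] [DecidableEq E]
    {G : Multigraph V E} {s : List E} {i j : E} {F F' gi gj t : MvPolynomial E ℤ}
    (hs : G.IsQuadraticInvariant s
      (((F * (X i + X j) + F') * (gi * X i + gj * X j + t)) ^ 2)) (hi : i ∈ G.edges)
    (hj : j ∈ G.edges) (his : i ∉ s) (hjs : j ∉ s) (hij : i ≠ j)
    (hfree : ∀ P ∈ [F, F', gi, gj, t], ∀ e ∈ [i, j], FreeOf e P) :
    G.IsQuadraticInvariant (s ++ [i, j]) ((F * (gi - gj)) ^ 2) := by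
  simp only [List.forall_mem_cons] at hfree
  obtain ⟨⟨_, _, _⟩, ⟨_, _, _⟩, ⟨_, _, _⟩, ⟨_, _, _⟩, ⟨_, _, _⟩, _⟩ := hfree
  have hX1 : FreeOf i (X j : MvPolynomial E ℤ) := freeOf_X hij.symm
  have s1 : G.IsQuadraticInvariant (s ++ [i])
      ((0 * X j ^ 2 + (F * (gj - gi)) * X j + (F * t - F' * gi)) ^ 2) := by
    refine .step s i _ _ hs hi his ?_
    have := quadraticStep_linear_mul_linear (e := i) (A := F) (B := F * X j + F')
      (C := gi) (D := gj * X j + t) ?_ ?_ ?_ ?_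
    · convert this using 1 <;> ring
    all_goals
      repeat' first
        | with_reducible assumption
        | with_reducible apply FreeOf.add
        | with_reducible apply FreeOf.mul
  have s2 : G.IsQuadraticInvariant (s ++ [i] ++ [j])
      ((F * (gj - gi)) ^ 2 - 4 * 0 * (F * t - F' * gi)) := by
    refine .step _ j _ _ s1 hj (by simp [hjs, hij.symm]) (.square _ _ _ freeOf_zero ?_ ?_) <;>
    repeat' first
      | with_reducible assumption
      | with_reducible apply FreeOf.sub
      | with_reducible apply FreeOf.mul
  have hres : (F * (gi - gj)) ^ 2 = (F * (gj - gi)) ^ 2 - 4 * 0 * (F * t - F' * gi) := by ring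
  rw [hres]
  simpa using s2

end Expansions

/-! ### The 4- and the 5-invariant -/

/-- A function on lists that is invariant under adjacent transpositions is invariant under all
permutations. -/
theorem List.Perm.eq_of_adjacent_swap {α β : Type*} {F : List α → β} {Q : List α → Prop}
    (hQ : ∀ a b, a.Perm b → Q a → Q b)
    (h : ∀ pre x y t, Q (pre ++ x :: y :: t) → F (pre ++ x :: y :: t) = F (pre ++ y :: x :: t))
    {a b : List α} (hab : a.Perm b) (ha : Q a) : F a = F b := by
  suffices ∀ pre, Q (pre ++ a) → F (pre ++ a) = F (pre ++ b) from this [] ha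
  clear ha
  induction hab with
  | nil => intros; rfl
  | cons x _ ih =>
    intro pre hpre
    have := ih (pre ++ [x]) (by simpa using hpre)
    simpa using this
  | swap x y t => exact fun pre hpre => h pre y x t hpre
  | trans h1 _ ih1 ih2 =>
    intro pre hpre
    exact (ih1 pre hpre).trans (ih2 pre (hQ _ _ (h1.append_left pre) hpre))

namespace Multigraph

variable {V E : Type*} [DecidableEq V] [DecidableEq E] {G : Multigraph V E}

theorem edgePairs_nil {V E : Type*} {G : Multigraph V E} : G.EdgePairs [] :=
  ⟨List.nodup_nil, List.nodup_nil, by simp⟩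

theorem edgePairs_cons_iff {V E : Type*} {G : Multigraph V E} {p : List (E × E)} {i j : E} :
    G.EdgePairs ((i, j) :: p) ↔
    (i ∉ p.map Prod.fst ∧ j ∉ p.map Prod.snd ∧ i ∈ G.edges ∧ j ∈ G.edges) ∧ G.EdgePairs p := by
  constructor
  · rintro ⟨h1, h2, h3⟩
    rw [List.map_cons, List.nodup_cons] at h1 h2
    rw [List.forall_mem_cons] at h3
    exact ⟨⟨h1.1, h2.1, h3.1⟩, h1.2, h2.2, h3.2⟩
  · rintro ⟨⟨h1, h2, h3⟩, h4⟩
    refine ⟨?_, ?_, List.forall_mem_cons.2 ⟨h3, h4.mem⟩⟩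
    · rw [List.map_cons, List.nodup_cons]
      exact ⟨h1, h4.fst_nodup⟩
    · rw [List.map_cons, List.nodup_cons]
      exact ⟨h2, h4.snd_nodup⟩

theorem EdgePairs.dodgson_sq {p : List (E × E)} (hp : G.EdgePairs p) (K : Finset E) {v : V}
    (hv : v ∈ G.verts) : G.dodgson (p.map Prod.fst) (p.map Prod.snd) K ^ 2 =
      unitMinor (G.labels v) (G.laplacian K) (p.map edgePair) ^ 2 := by
  rw [hp.dodgson_eq K hv, mul_pow, ← pow_mul, mul_comm (_ - 1), pow_mul, neg_one_sq, one_pow,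
    one_mul]

theorem EdgePairs.congr_vars {p : List (E × E)} (hp : G.EdgePairs p) (v : V) {K K' : Finset E}
    (h : ∀ e ∈ G.edges, e ∉ p.map Prod.fst → e ∉ p.map Prod.snd → (e ∈ K ↔ e ∈ K')) :
    unitMinor (G.labels v) (G.laplacian K) (p.map edgePair) =
      unitMinor (G.labels v) (G.laplacian K') (p.map edgePair) := by
  apply G.unitMinor_congr_vars (hp.valid v)
  intro e h1 h2 h3
  refine h e (inl_mem_labels.1 h1) (fun h => h2 (mem_map_edgePair_inl.2 h)) fun h => h3 ?_
  obtain ⟨q, hq, rfl⟩ := List.mem_map.1 h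
  exact List.mem_map.2 ⟨_, List.mem_map_of_mem hq, rfl⟩

theorem EdgePairs.expand {p : List (E × E)} (v : V) {K : Finset E} {e : E}
    (he : e ∈ G.edges) (hep : e ∉ p.map Prod.fst) (heK : e ∉ K) :
    unitMinor (G.labels v) (G.laplacian K) (p.map edgePair) =
      X e * unitMinor (G.labels v) (G.laplacian (insert e K)) (((e, e) :: p).map edgePair) +
        unitMinor (G.labels v) (G.laplacian (insert e K)) (p.map edgePair) :=
  G.unitMinor_expand (inl_mem_labels.2 he) (fun h => hep (mem_map_edgePair_inl.1 h)) heK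

theorem EdgePairs.freeOf {p : List (E × E)} (hp : G.EdgePairs p) (v : V) {K : Finset E} {e : E}
    (h : e ∈ K ∨ e ∈ p.map Prod.fst ∨ e ∈ p.map Prod.snd) :
    FreeOf e (unitMinor (G.labels v) (G.laplacian K) (p.map edgePair)) := by
  apply G.freeOf_unitMinor (hp.valid v)
  rcases h with h | h | h
  · exact Or.inl h
  · exact Or.inr (Or.inl (mem_map_edgePair_inl.2 h))
  · obtain ⟨q, hq, rfl⟩ := List.mem_map.1 h
    exact Or.inr (Or.inr (Or.inl (List.mem_map.2 ⟨_, List.mem_map_of_mem hq, rfl⟩)))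

/-- The quadratic `4`-invariant: by the Desnanot-Jacobi identity, the resultant in `α_l` of the two
factors `Ψ^{ik,jk}` and `Ψ^{i,j}_k` is the product of `Ψ^{ik,jl}` and `Ψ^{il,jk}`. -/
theorem isQuadraticInvariant_four {v : V} (hv : v ∈ G.verts) {i j k l : E}
    (hn : [i, j, k, l].Nodup) (hG : ∀ e ∈ [i, j, k, l], e ∈ G.edges) {K : Finset E}
    (hK : ∀ e, e ∈ K ↔ e ∈ [i, j, k, l]) :
    G.IsQuadraticInvariant [i, j, k, l]
      ((unitMinor (G.labels v) (G.laplacian K) ([(i, j), (k, l)].map edgePair) *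
        unitMinor (G.labels v) (G.laplacian K) ([(i, j), (l, k)].map edgePair)) ^ 2) := by
  simp only [List.forall_mem_cons] at hG
  obtain ⟨hi, hj, hk, hl, -⟩ := hG
  simp only [List.nodup_cons, List.mem_cons, List.not_mem_nil, or_false, not_or] at hn
  obtain ⟨⟨hij, hik, hil⟩, ⟨hjk, hjl⟩, hkl, -⟩ := hn
  have p1 : G.EdgePairs [(i, j), (k, k)] := by
    simp [edgePairs_cons_iff, edgePairs_nil, *]
  have p2 : G.EdgePairs [(i, j)] := by
    simp [edgePairs_cons_iff, edgePairs_nil, *]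
  have p3 : G.EdgePairs [(l, l), (i, j), (k, k)] := by
    simp [edgePairs_cons_iff, *, Ne.symm hil, Ne.symm hjl, Ne.symm hkl]
  have p4 : G.EdgePairs [(l, l), (i, j)] := by
    simp [edgePairs_cons_iff, *, Ne.symm hil, Ne.symm hjl]
  have hKl : K = insert l {i, j, k} := by
    ext e
    simp only [hK, List.mem_cons, List.not_mem_nil, or_false, Finset.mem_insert,
      Finset.mem_singleton]
    tauto
  have hb : G.IsQuadraticInvariant [i, j, k]
      ((unitMinor (G.labels v) (G.laplacian {i, j, k}) ([(i, j), (k, k)].map edgePair) *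
        unitMinor (G.labels v) (G.laplacian {i, j, k}) ([(i, j)].map edgePair)) ^ 2) := by
    have h0 := IsQuadraticInvariant.base (G := G) i j k hi hj hk (by simp [*])
    rw [mul_pow] at h0 ⊢
    have h1 := p1.dodgson_sq ∅ hv
    have h2 := p2.dodgson_sq {k} hv
    rw [p1.congr_vars v (K' := {i, j, k})
      (fun e _ h1 h2 => by simp at h1 h2; simp [h1, h2])] at h1
    rw [p2.congr_vars v (K' := {i, j, k})
      (fun e _ h1 h2 => by simp at h1 h2; simp [h1, h2])] at h2
    rw [← h1, ← h2]
    exact h0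
  have hlK : l ∉ ({i, j, k} : Finset E) := by simp [Ne.symm hil, Ne.symm hjl, Ne.symm hkl]
  refine .step [i, j, k] l _ _ hb hl (by simp [Ne.symm hil, Ne.symm hjl, Ne.symm hkl]) ?_
  rw [EdgePairs.expand v (p := [(i, j), (k, k)]) hl (by simp [Ne.symm hil, Ne.symm hkl]) hlK,
    EdgePairs.expand v (p := [(i, j)]) hl (by simp [Ne.symm hil]) hlK, ← hKl]
  have hl' : l ∈ K := by simp [hK]
  have hstep := quadraticStep_linear_mul_linear (p3.freeOf v (Or.inl hl'))
    (p1.freeOf v (Or.inl hl')) (p4.freeOf v (Or.inl hl')) (p2.freeOf v (Or.inl hl'))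
  convert hstep using 1
  have hdj := unitMinor_desnanot_jacobi (G.laplacian K) (S := G.labels v) (i := Sum.inl i)
    (j := Sum.inl j) (k := Sum.inl k) (l := Sum.inl l) (by simpa [inl_mem_labels])
    (by simpa [inl_mem_labels]) (by simpa [inl_mem_labels]) (by simpa [inl_mem_labels])
    (by simpa using hik) (by simpa using hil) (by simpa using hkl)
  have e3 : unitMinor (G.labels v) (G.laplacian K) ([(l, l), (i, j), (k, k)].map edgePair) =
      unitMinor (G.labels v) (G.laplacian K) ([(i, j), (k, k), (l, l)].map edgePair) :=
    unitMinor_perm _ ((List.perm_append_singleton (l, l) [(i, j), (k, k)]).symm.map _)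
  have e4 : unitMinor (G.labels v) (G.laplacian K) ([(l, l), (i, j)].map edgePair) =
      unitMinor (G.labels v) (G.laplacian K) ([(i, j), (l, l)].map edgePair) :=
    unitMinor_perm _ ((List.perm_append_singleton (l, l) [(i, j)]).symm.map _)
  rw [e3, e4]
  simp only [List.map_cons, List.map_nil] at hdj ⊢
  rw [← hdj]
  ring

/-- The quadratic `5`-invariant is the square of the resultant in `α_m` of the two factors of the
`4`-invariant. -/
theorem isQuadraticInvariant_five {v : V} (hv : v ∈ G.verts) {i j k l m : E}
    (hn : [i, j, k, l, m].Nodup) (hG : ∀ e ∈ [i, j, k, l, m], e ∈ G.edges) {K : Finset E}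
    (hK : ∀ e, e ∈ K ↔ e ∈ [i, j, k, l, m]) :
    G.IsQuadraticInvariant [i, j, k, l, m]
      (fiveInvariant (G.labels v) (G.laplacian K) (Sum.inl i) (Sum.inl j) (Sum.inl k) (Sum.inl l)
        (Sum.inl m) ^ 2) := by
  have hKm : K = insert m [i, j, k, l].toFinset := by
    ext e
    simp only [hK, List.mem_cons, List.not_mem_nil, or_false, Finset.mem_insert, List.mem_toFinset]
    tauto
  have h4 := isQuadraticInvariant_four hv (i := i) (j := j) (k := k) (l := l)
    (K := [i, j, k, l].toFinset) (hn.sublist (List.sublist_append_left [i, j, k, l] [m]))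
    (fun e he => hG e (by simp at he ⊢; tauto)) (by simp)
  simp only [List.forall_mem_cons] at hG
  obtain ⟨hi, hj, hk, hl, hm, -⟩ := hG
  simp only [List.nodup_cons, List.mem_cons, List.not_mem_nil, or_false, not_or] at hn
  obtain ⟨⟨hij, hik, hil, him⟩, ⟨hjk, hjl, hjm⟩, ⟨hkl, hkm⟩, hlm, -⟩ := hn
  have p1 : G.EdgePairs [(i, j), (k, l)] := by
    simp [edgePairs_cons_iff, edgePairs_nil, *]
  have p2 : G.EdgePairs [(i, j), (l, k)] := by
    simp [edgePairs_cons_iff, edgePairs_nil, *]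
  have p3 : G.EdgePairs [(m, m), (i, j), (k, l)] := by
    simp [edgePairs_cons_iff, *, Ne.symm him, Ne.symm hjm, Ne.symm hkm, Ne.symm hlm]
  have p4 : G.EdgePairs [(m, m), (i, j), (l, k)] := by
    simp [edgePairs_cons_iff, *, Ne.symm him, Ne.symm hjm, Ne.symm hkm, Ne.symm hlm]
  have hmK : m ∉ [i, j, k, l].toFinset := by
    simp [Ne.symm him, Ne.symm hjm, Ne.symm hkm, Ne.symm hlm]
  refine .step [i, j, k, l] m _ _ h4 hm (by simpa using hmK) ?_
  rw [EdgePairs.expand v (p := [(i, j), (k, l)]) hm (by simp [Ne.symm him, Ne.symm hkm]) hmK,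
    EdgePairs.expand v (p := [(i, j), (l, k)]) hm (by simp [Ne.symm him, Ne.symm hlm]) hmK, ← hKm]
  have hm' : m ∈ K := by simp [hK]
  have hstep := quadraticStep_linear_mul_linear (p3.freeOf v (Or.inl hm'))
    (p1.freeOf v (Or.inl hm')) (p4.freeOf v (Or.inl hm')) (p2.freeOf v (Or.inl hm'))
  convert hstep using 1
  have e3 : unitMinor (G.labels v) (G.laplacian K) ([(m, m), (i, j), (k, l)].map edgePair) =
      unitMinor (G.labels v) (G.laplacian K) ([(i, j), (k, l), (m, m)].map edgePair) :=
    unitMinor_perm _ ((List.perm_append_singleton (m, m) [(i, j), (k, l)]).symm.map _)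
  have e4 : unitMinor (G.labels v) (G.laplacian K) ([(m, m), (i, j), (l, k)].map edgePair) =
      unitMinor (G.labels v) (G.laplacian K) ([(i, j), (l, k), (m, m)].map edgePair) :=
    unitMinor_perm _ ((List.perm_append_singleton (m, m) [(i, j), (l, k)]).symm.map _)
  rw [e3, e4]
  rfl

/-- The quadratic `5`-invariant does not depend on the order of the edges. -/
theorem isQuadraticInvariant_five_of_perm {v : V} (hv : v ∈ G.verts) {s : List E} {i j k l m : E}
    (hs : s.Perm [i, j, k, l, m]) (hn : [i, j, k, l, m].Nodup)
    (hG : ∀ e ∈ [i, j, k, l, m], e ∈ G.edges) {K : Finset E}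
    (hK : ∀ e, e ∈ K ↔ e ∈ [i, j, k, l, m]) :
    G.IsQuadraticInvariant s
      (fiveInvariant (G.labels v) (G.laplacian K) (Sum.inl i) (Sum.inl j) (Sum.inl k) (Sum.inl l)
        (Sum.inl m) ^ 2) := by
  let F : List E → MvPolynomial E ℤ := fun t => match t with
    | [i, j, k, l, m] => fiveInvariant (G.labels v) (G.laplacian K) (Sum.inl i) (Sum.inl j)
        (Sum.inl k) (Sum.inl l) (Sum.inl m) ^ 2
    | _ => 0
  have key : F s = F [i, j, k, l, m] := by
    refine List.Perm.eq_of_adjacent_swap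
      (Q := fun t => t.Nodup ∧ (∀ e ∈ t, e ∈ G.edges) ∧ t.length = 5) ?_ ?_ hs
      ⟨hs.nodup_iff.2 hn, fun e he => hG e (hs.mem_iff.1 he), hs.length_eq⟩
    · exact fun a b hab ⟨h1, h2, h3⟩ =>
        ⟨hab.nodup_iff.1 h1, fun e he => h2 e (hab.mem_iff.2 he), hab.length_eq ▸ h3⟩
    · rintro pre x y t ⟨h1, h2, h3⟩
      have hadj : ∀ i j k l m : E, [i, j, k, l, m].Nodup → (∀ e ∈ [i, j, k, l, m], e ∈ G.edges) →
          _ := fun i j k l m hn hG => fiveInvariant_adjacent_swap (S := G.labels v)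
            (M := G.laplacian K) (G.laplacian_symm K) (i := Sum.inl i) (j := Sum.inl j)
            (k := Sum.inl k) (l := Sum.inl l) (m := Sum.inl m)
            (inl_mem_labels.2 (hG i (by simp))) (inl_mem_labels.2 (hG j (by simp)))
            (inl_mem_labels.2 (hG k (by simp))) (inl_mem_labels.2 (hG l (by simp)))
            (inl_mem_labels.2 (hG m (by simp))) (hn.map Sum.inl_injective)
      rcases pre with _ | ⟨a, _ | ⟨b, _ | ⟨c, _ | ⟨d, pre⟩⟩⟩⟩
      · rcases t with _ | ⟨c, _ | ⟨d, _ | ⟨f, _ | ⟨g, t⟩⟩⟩⟩ <;> simp at h3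
        have := (hadj _ _ _ _ _ h1 h2).1
        simp [F, this]
      · rcases t with _ | ⟨c, _ | ⟨d, _ | ⟨f, t⟩⟩⟩ <;> simp at h3
        have := (hadj _ _ _ _ _ h1 h2).2.1
        simp [F, this]
      · rcases t with _ | ⟨c, _ | ⟨d, t⟩⟩ <;> simp at h3
        have := (hadj _ _ _ _ _ h1 h2).2.2.1
        simp [F, this]
      · rcases t with _ | ⟨d, t⟩ <;> simp at h3
        have := (hadj _ _ _ _ _ h1 h2).2.2.2
        simp [F, this]
      · simp at h3
        omega
  have hlen := hs.length_eq
  rcases s with _ | ⟨a, _ | ⟨b, _ | ⟨c, _ | ⟨d, _ | ⟨f, _ | ⟨g, s⟩⟩⟩⟩⟩⟩ <;> simp at hlen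
  have h5 : G.IsQuadraticInvariant _ (F [a, b, c, d, f]) :=
    isQuadraticInvariant_five hv (hs.nodup_iff.2 hn) (fun e he => hG e (hs.mem_iff.1 he))
      (K := K) (fun e => (hK e).trans hs.mem_iff.symm)
  rw [key] at h5
  exact h5

end Multigraph

/-! ### The quadratic 6-invariant of two vertices of degree three -/

namespace Multigraph

variable {V E : Type*} [DecidableEq V] [DecidableEq E] {G : Multigraph V E}

theorem HasStar.isStar_three {u v : V} {i j k : E} (h : G.HasStar u {i, j, k}) (huv : u ≠ v)
    (K : Finset E) : IsStar (G.labels v) (G.laplacian K) (Sum.inr u)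
      {Sum.inl i, Sum.inl j, Sum.inl k} := by
  simpa [Finset.image_insert] using h.isStar huv K

theorem HasStar.rotate {u : V} {i j k : E} (h : G.HasStar u {i, j, k}) : G.HasStar u {j, k, i} := by
  have : ({j, k, i} : Finset E) = {i, j, k} := by ext; simp; tauto
  rwa [this]

theorem HasStar.swap {u : V} {i j k : E} (h : G.HasStar u {i, j, k}) : G.HasStar u {j, i, k} := by
  rwa [Finset.insert_comm]

theorem HasStar.mem_edges {V E : Type*} [DecidableEq V] {G : Multigraph V E}
    {u : V} {T : Finset E} (h : G.HasStar u T) {e : E} (he : e ∈ T) :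
    e ∈ G.edges := (h.mem_iff.1 he).1

theorem notMem_map_edgePair_inr_snd {V E : Type*} {p : List (E × E)} {u : V} :
    (Sum.inr u : E ⊕ V) ∉ (p.map edgePair).map Prod.snd := by simp

theorem HasStar.sq_unitMinor_removeVerts {u v : V} {i j k : E} (h : G.HasStar u {i, j, k})
    (huv : u ≠ v) (hn : [i, j, k].Nodup) (K : Finset E) {p : List (E × E)} (hp : G.EdgePairs p)
    (hpu : ∀ q ∈ p, ∀ e ∈ [i, j, k], q.1 ≠ e ∧ q.2 ≠ e) :
    unitMinor (G.labels v) (G.laplacian K) (((i, j) :: (k, k) :: p).map edgePair) ^ 2 =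
      unitMinor ((G.removeVerts {u}).labels v) (G.laplacian K) (p.map edgePair) ^ 2 := by
  simp only [List.nodup_cons, List.mem_cons, List.not_mem_nil, or_false, not_or] at hn
  obtain ⟨⟨hij, hik⟩, hjk, -⟩ := hn
  have h1 : (G.removeVerts {u}).labels v = ((((G.labels v).erase (Sum.inl j)).erase
      (Sum.inl i)).erase (Sum.inr u)).erase (Sum.inl k) := by
    rw [h.labels_removeVerts]
    ext x
    simp only [Finset.mem_sdiff, Finset.mem_erase, Finset.image_insert, Finset.image_singleton,
      Finset.mem_insert, Finset.mem_singleton]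
    tauto
  rw [h1]
  refine (h.isStar_three huv K).sq_remove_three (G.laplacian_symm K) (by simpa using hij)
    (by simpa using hik) (by simpa using hjk) (hp.valid v) ?_
  intro r hr z hz
  obtain ⟨q, hq, rfl⟩ := List.mem_map.1 hr
  have h2 := hpu q hq
  simp only [List.forall_mem_cons] at h2
  simp only [List.mem_cons, List.not_mem_nil, or_false] at hz
  rcases hz with rfl | rfl | rfl | rfl
  · simp
  · simpa using h2.1
  · simpa using h2.2.1
  · simpa using h2.2.2.1

theorem unitMinor_swap_edges {v : V} {p : List (E × E)} {i j k l : E} (hi : i ∈ G.edges)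
    (hj : j ∈ G.edges) (hk : k ∈ G.edges) (hl : l ∈ G.edges) (hik : i ≠ k)
    (hip : i ∉ p.map Prod.fst) (hkp : k ∉ p.map Prod.fst) (K : Finset E) :
    unitMinor (G.labels v) (G.laplacian K) (((i, j) :: (k, l) :: p).map edgePair) =
      -unitMinor (G.labels v) (G.laplacian K) (((i, l) :: (k, j) :: p).map edgePair) := by
  simp only [List.map_cons]
  exact unitMinor_swap _ (inl_mem_labels.2 hi) (inl_mem_labels.2 hj) (inl_mem_labels.2 hk)
    (inl_mem_labels.2 hl) (by simpa using hik) (fun h => hip (mem_map_edgePair_inl.1 h))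
    (fun h => hkp (mem_map_edgePair_inl.1 h))

/-- For five edges that contain the three edges `i`, `j`, `k` at the vertex `u`, the `5`-invariant
factorizes.  Reducing the edge `a` at a second vertex `w` of degree three leaves the
square of the Symanzik polynomial of `G` without `u` and `w`, times a Dodgson polynomial. -/
theorem isQuadraticInvariant_six {u w v : V} {i j k a b c : E} (hu : G.HasStar u {i, j, k})
    (hw : G.HasStar w {a, b, c}) (hv : v ∈ G.verts) (huv : u ≠ v) (hwv : w ≠ v) (huw : w ≠ u)
    (hn : [i, j, k, a, b, c].Nodup) {s : List E} (hs : s.Perm [j, b, k, c, i]) {K : Finset E}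
    (hK : ∀ e, e ∈ K ↔ e ∈ [i, j, k, a, b, c]) :
    G.IsQuadraticInvariant (s ++ [a])
      ((unitMinor (G.labels v) (G.laplacian K) ([(j, b), (k, c)].map edgePair) *
        unitMinor ((G.removeVerts {u, w}).labels v) (G.laplacian K) []) ^ 2) := by
  have hKa : K = insert a [j, b, k, c, i].toFinset := by
    ext e
    simp only [hK, List.mem_cons, List.not_mem_nil, or_false, Finset.mem_insert, List.mem_toFinset]
    clear * -
    tauto
  have hi := hu.mem_edges (e := i) (by simp)
  have hj := hu.mem_edges (e := j) (by simp)
  have hk := hu.mem_edges (e := k) (by simp)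
  have ha := hw.mem_edges (e := a) (by simp)
  have hb := hw.mem_edges (e := b) (by simp)
  have hc := hw.mem_edges (e := c) (by simp)
  simp only [List.nodup_cons, List.mem_cons, List.not_mem_nil, or_false, not_or] at hn
  obtain ⟨⟨hij, hik, hia, hib, hic⟩, ⟨hjk, hja, hjb, hjc⟩, ⟨hka, hkb, hkc⟩, ⟨hab, hac⟩, hbc,
    -⟩ := hn
  have haK : a ∉ [j, b, k, c, i].toFinset := by
    simp [Ne.symm hja, Ne.symm hka, Ne.symm hia, hab, hac]
  have h5 := isQuadraticInvariant_five_of_perm hv hs (K := [j, b, k, c, i].toFinset)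
    (by simp [hjb, hjk, hjc, hbc, Ne.symm hkb, Ne.symm hib, hkc, Ne.symm hij, Ne.symm hik,
      Ne.symm hic])
    (by simp [*]) (by simp)
  have q1 : G.EdgePairs [(j, b), (k, c)] := by
    simp [edgePairs_cons_iff, edgePairs_nil, hj, hb, hk, hc, hjk, hbc]
  have q2 : G.EdgePairs [(j, b), (c, k), (i, i)] := by
    simp [edgePairs_cons_iff, edgePairs_nil, hj, hb, hk, hc, hi, Ne.symm hkb, Ne.symm hij,
      Ne.symm hib, Ne.symm hic, Ne.symm hik, hjc]
  have q3 : G.EdgePairs [(a, a), (j, b), (k, c)] := by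
    simp [edgePairs_cons_iff, edgePairs_nil, hj, hb, hk, hc, ha, hjk, hbc, Ne.symm hja,
      Ne.symm hka, hab, hac]
  have q4 : G.EdgePairs [(a, a), (j, b), (c, k), (i, i)] := by
    rw [edgePairs_cons_iff]
    refine ⟨?_, q2⟩
    simp [ha, Ne.symm hja, Ne.symm hka, Ne.symm hia, hab, hac]
  have q5 : G.EdgePairs [(c, b), (a, a)] := by
    simp [edgePairs_cons_iff, edgePairs_nil, hb, hc, ha, Ne.symm hac, Ne.symm hab]
  set K5 := [j, b, k, c, i].toFinset with hK5
  have z1 : unitMinor (G.labels v) (G.laplacian K5) ([(j, b), (k, c), (i, i)].map edgePair) = 0 :=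
    (hu.isStar_three huv K5).col_zero (G.laplacian_symm K5) notMem_map_edgePair_inr_snd (by simp)
  have z2 : unitMinor (G.labels v) (G.laplacian K) ([(a, a), (j, b), (k, c)].map edgePair) = 0 :=
    (hw.isStar_three hwv K).row_zero (q3.valid v) notMem_map_edgePair_inr (by simp)
  have hfive : fiveInvariant (G.labels v) (G.laplacian K5) (Sum.inl j) (Sum.inl b) (Sum.inl k)
      (Sum.inl c) (Sum.inl i) ^ 2 =
      (unitMinor (G.labels v) (G.laplacian K5) ([(j, b), (k, c)].map edgePair) *
        unitMinor (G.labels v) (G.laplacian K5) ([(j, b), (c, k), (i, i)].map edgePair)) ^ 2 := by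
    simp only [List.map_cons, List.map_nil] at z1 ⊢
    rw [fiveInvariant, z1]
    ring
  rw [hfive, EdgePairs.expand v (p := [(j, b), (k, c)]) ha (by simp [Ne.symm hja, Ne.symm hka]) haK,
    EdgePairs.expand v (p := [(j, b), (c, k), (i, i)]) ha
      (by simp [Ne.symm hja, hac, Ne.symm hia]) haK, ← hKa, z2] at h5
  have haK' : a ∈ K := by simp [hK]
  refine .step s a _ _ h5 ha (fun h => haK (by simpa [hK5] using hs.mem_iff.1 h)) ?_
  have hstep := quadraticStep_linear_mul_linear (freeOf_zero (e := a))
    (q1.freeOf v (Or.inl haK')) (q4.freeOf v (Or.inl haK')) (q2.freeOf v (Or.inl haK'))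
  convert hstep using 1
  rw [zero_mul, zero_sub, neg_sq, mul_pow, mul_pow]
  have e1 : unitMinor (G.labels v) (G.laplacian K)
      ([(a, a), (j, b), (c, k), (i, i)].map edgePair) =
      unitMinor (G.labels v) (G.laplacian K) ([(j, b), (c, k), (i, i), (a, a)].map edgePair) :=
    unitMinor_perm _ ((List.perm_append_singleton (a, a) [(j, b), (c, k), (i, i)]).symm.map _)
  have e2 : unitMinor (G.labels v) (G.laplacian K)
      ([(j, b), (c, k), (i, i), (a, a)].map edgePair) =
      -unitMinor (G.labels v) (G.laplacian K) ([(j, k), (c, b), (i, i), (a, a)].map edgePair) :=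
    unitMinor_swap_edges (p := [(i, i), (a, a)]) hj hb hc hk hjc (by simp [Ne.symm hij, hja])
      (by simp [Ne.symm hic, Ne.symm hac]) K
  have e3 : unitMinor (G.labels v) (G.laplacian K)
      ([(j, k), (c, b), (i, i), (a, a)].map edgePair) =
      unitMinor (G.labels v) (G.laplacian K) ([(j, k), (i, i), (c, b), (a, a)].map edgePair) :=
    unitMinor_perm _ (((List.Perm.swap _ _ _).cons _).map _)
  have hu' : G.HasStar u {j, k, i} := hu.rotate
  have hw' : G.HasStar w {c, b, a} := hw.rotate.swap
  have e4 := hu'.sq_unitMinor_removeVerts huv (by simp [hjk, Ne.symm hij, Ne.symm hik]) K q5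
    (by simp [Ne.symm hjc, Ne.symm hkc, Ne.symm hic, Ne.symm hjb, Ne.symm hkb, Ne.symm hib,
      Ne.symm hja, Ne.symm hka, Ne.symm hia])
  have hw2 : (G.removeVerts {u}).HasStar w {c, b, a} := by
    have := hw'.removeVerts hu' huw
    convert this using 1
    rw [eq_comm, Finset.sdiff_eq_self_iff_disjoint]
    simp [hjc, hkc, hic, hjb, hkb, hib, hja, hka, hia]
  have e5 := hw2.sq_unitMinor_removeVerts hwv (by simp [Ne.symm hbc, Ne.symm hac, Ne.symm hab]) K
    edgePairs_nil (by simp)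
  rw [removeVerts_removeVerts] at e5
  change unitMinor ((G.removeVerts {u}).labels v) (G.laplacian K)
    ([(c, b), (a, a)].map edgePair) ^ 2 =
    unitMinor ((G.removeVerts ({u} ∪ {w})).labels v) (G.laplacian K) [] ^ 2 at e5
  rw [e1, e2, neg_sq, e3, e4, e5, Finset.insert_eq u {w}]

/-- At a vertex of degree three any two of its edges may be exchanged as second entries. -/
theorem HasStar.sq_unitMinor_exchange {w v : V} {a b c x y : E} (hw : G.HasStar w {a, b, c})
    (hwv : w ≠ v) (hn : [a, b, c].Nodup) (hx : x ∈ G.edges) (hy : y ∈ G.edges) (hxy : x ≠ y)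
    (K : Finset E) :
    unitMinor (G.labels v) (G.laplacian K) ([(x, a), (y, c)].map edgePair) ^ 2 =
      unitMinor (G.labels v) (G.laplacian K) ([(x, b), (y, c)].map edgePair) ^ 2 := by
  have hc : c ∈ G.edges := (hw.mem_iff.1 (by simp)).1
  simp only [List.nodup_cons, List.mem_cons, List.not_mem_nil, or_false, not_or] at hn
  obtain ⟨⟨hab, hac⟩, hbc,
    -⟩ := hn
  have hs := hw.isStar_three hwv K
  have hrel := hs.row_relation (p := [(y, c)].map edgePair) (x := Sum.inl x) (by simpa using hab)
    (by simpa using hac) (by simpa using hbc) (inl_mem_labels.2 hx) (by simp)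
    notMem_map_edgePair_inr (by simpa using hxy)
  have hval : ValidPairs (G.labels v) ([(y, c)].map edgePair) := by
    refine EdgePairs.valid ?_ v
    simp [edgePairs_cons_iff, edgePairs_nil, hy, hc]
  have hz := hval.snd_zero (M := G.laplacian K) (i := Sum.inl x) (j := Sum.inl c)
    (inl_mem_labels.2 hx) (by simpa using hxy) (by simp)
  have s1 := hs.sq (Sum.inl a) (by simp)
  have s2 := hs.sq (Sum.inl b) (by simp)
  rw [hz, mul_zero, add_zero] at hrel
  simp only [List.map_cons, List.map_nil] at hrel ⊢
  set P := unitMinor (G.labels v) (G.laplacian K)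
    [(Sum.inl x, Sum.inl a), (Sum.inl y, Sum.inl c)]
  set Q := unitMinor (G.labels v) (G.laplacian K)
    [(Sum.inl x, Sum.inl b), (Sum.inl y, Sum.inl c)]
  set m := G.laplacian K (Sum.inr w) (Sum.inl a)
  set m' := G.laplacian K (Sum.inr w) (Sum.inl b)
  linear_combination (m * P - m' * Q) * hrel - P ^ 2 * s1 + Q ^ 2 * s2

theorem sq_unitMinor_transpose {v : V} {a b x y : E} (ha : a ∈ G.edges) (hb : b ∈ G.edges)
    (hx : x ∈ G.edges) (hy : y ∈ G.edges) (hab : a ≠ b) (hxy : x ≠ y) (K : Finset E) :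
    unitMinor (G.labels v) (G.laplacian K) ([(a, x), (b, y)].map edgePair) =
      unitMinor (G.labels v) (G.laplacian K) ([(x, a), (y, b)].map edgePair) := by
  have h : G.EdgePairs [(x, a), (y, b)] := by
    simp [edgePairs_cons_iff, edgePairs_nil, ha, hb, hx, hy, hab, hxy]
  exact unitMinor_transpose (G.laplacian_symm K) (h.valid v) (by simpa using hab)

/-- The quadratic `6`-invariant of the edges at two non-adjacent vertices of degree three does not
depend on the order of the edges. -/
theorem isQuadraticInvariant_six_of_perm {u w v : V} {i j k a b c : E} (hu : G.HasStar u {i, j, k})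
    (hw : G.HasStar w {a, b, c}) (hv : v ∈ G.verts) (huv : u ≠ v) (hwv : w ≠ v) (huw : w ≠ u)
    (hn : [i, j, k, a, b, c].Nodup) {s : List E} (hs : s.Perm [j, b, k, c, i, a]) {K : Finset E}
    (hK : ∀ e, e ∈ K ↔ e ∈ [i, j, k, a, b, c]) :
    G.IsQuadraticInvariant s
      ((unitMinor (G.labels v) (G.laplacian K) ([(j, b), (k, c)].map edgePair) *
        unitMinor ((G.removeVerts {u, w}).labels v) (G.laplacian K) []) ^ 2) := by
  have hi := hu.mem_edges (e := i) (by simp)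
  have hj := hu.mem_edges (e := j) (by simp)
  have hk := hu.mem_edges (e := k) (by simp)
  have ha := hw.mem_edges (e := a) (by simp)
  have hb := hw.mem_edges (e := b) (by simp)
  have hc := hw.mem_edges (e := c) (by simp)
  have hn' := hn
  simp only [List.nodup_cons, List.mem_cons, List.not_mem_nil, or_false, not_or] at hn'
  obtain ⟨⟨hij, hik, hia, hib, hic⟩, ⟨hjk, hja, hjb, hjc⟩, ⟨hka, hkb, hkc⟩, ⟨hab, hac⟩, hbc,
    -⟩ := hn'
  obtain ⟨s, n, rfl⟩ : ∃ t n, s = t ++ [n] := by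
    rcases List.eq_nil_or_concat s with rfl | ⟨t, n, rfl⟩
    · exact absurd hs.length_eq (by simp)
    · exact ⟨t, n, by simp⟩
  have hs' : (n :: s).Perm [j, b, k, c, i, a] := (List.perm_append_singleton n s).symm.trans hs
  have hrest : ∀ rest, [j, b, k, c, i, a].Perm (n :: rest) → s.Perm rest := fun rest hr =>
    (hs'.trans hr).cons_inv
  have hnmem : n ∈ [j, b, k, c, i, a] := hs'.mem_iff.1 (by simp)
  have huw' : (G.removeVerts {w, u}) = G.removeVerts {u, w} := by rw [Finset.pair_comm]
  have hsplit : ∀ i' j' k' a' b' c' : E, [i, j, k, a, b, c].Perm [i', j', k', a', b', c'] →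
      n = a' → [i', j', k', a', b', c'].Nodup ∧ s.Perm [j', b', k', c', i'] ∧
        (∀ e, e ∈ K ↔ e ∈ [i', j', k', a', b', c']) := by
    rintro i' j' k' a' b' c' hp rfl
    refine ⟨hp.nodup_iff.1 hn, hrest _ ?_, fun e => (hK e).trans hp.mem_iff⟩
    have p1 : [j, b, k, c, i, a].Perm [i, j, k, a, b, c] := by
      rw [List.perm_iff_count]
      intro x
      simp only [List.count_cons, List.count_nil]
      ring
    have p2 : [i', j', k', n, b', c'].Perm [n, j', b', k', c', i'] := by
      rw [List.perm_iff_count]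
      intro x
      simp only [List.count_cons, List.count_nil]
      ring
    exact (p1.trans hp).trans p2
  have hnu : [i, j, k].Nodup := by simp [hij, hik, hjk]
  have hnw : [a, b, c].Nodup := by simp [hab, hac, hbc]
  simp only [List.mem_cons, List.not_mem_nil, or_false] at hnmem
  set W : List (E × E) → MvPolynomial E ℤ := fun p =>
    unitMinor (G.labels v) (G.laplacian K) (p.map edgePair) with hW
  have hswap : ∀ q r : E × E, W [q, r] = W [r, q] := fun q r =>
    unitMinor_perm _ ((List.Perm.swap _ _ _).map _)
  have hex1 : ∀ x y, x ∈ G.edges → y ∈ G.edges → x ≠ y →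
      W [(x, a), (y, c)] ^ 2 = W [(x, b), (y, c)] ^ 2 := fun x y hx hy hxy =>
    hw.sq_unitMinor_exchange hwv hnw hx hy hxy K
  have hex2 : ∀ x y, x ∈ G.edges → y ∈ G.edges → x ≠ y →
      W [(x, a), (y, b)] ^ 2 = W [(x, c), (y, b)] ^ 2 := fun x y hx hy hxy =>
    hw.rotate.rotate.swap.sq_unitMinor_exchange hwv
      (by simp [hac, hab, Ne.symm hbc]) hx hy hxy K
  have hex3 : ∀ x y, x ∈ G.edges → y ∈ G.edges → x ≠ y →
      W [(x, i), (y, k)] ^ 2 = W [(x, j), (y, k)] ^ 2 := fun x y hx hy hxy =>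
    hu.sq_unitMinor_exchange huv hnu hx hy hxy K
  have hex4 : ∀ x y, x ∈ G.edges → y ∈ G.edges → x ≠ y →
      W [(x, i), (y, j)] ^ 2 = W [(x, k), (y, j)] ^ 2 := fun x y hx hy hxy =>
    hu.rotate.rotate.swap.sq_unitMinor_exchange huv
      (by simp [hik, hij, Ne.symm hjk]) hx hy hxy K
  have htr : W [(b, j), (c, k)] = W [(j, b), (k, c)] :=
    sq_unitMinor_transpose hb hc hj hk hbc hjk K
  have hcount : ∀ t : List E, (∀ x, List.count x [i, j, k, a, b, c] = List.count x t) →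
      [i, j, k, a, b, c].Perm t := fun t ht => List.perm_iff_count.2 ht
  have key : ∀ p q : E × E, W [p, q] ^ 2 = W [(j, b), (k, c)] ^ 2 →
      G.IsQuadraticInvariant (s ++ [n]) ((W [p, q] *
        unitMinor ((G.removeVerts {u, w}).labels v) (G.laplacian K) []) ^ 2) →
      G.IsQuadraticInvariant (s ++ [n]) ((W [(j, b), (k, c)] *
        unitMinor ((G.removeVerts {u, w}).labels v) (G.laplacian K) []) ^ 2) := by
    intro p q h1 h2
    rwa [mul_pow, h1, ← mul_pow] at h2
  -- A last edge at `w` takes the place of `a` after a permutation of `a`, `b`, `c`; for a last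
  -- edge at `u` the two vertices are exchanged as well, and the minor is transposed.
  rcases hnmem with h | h | h | h | h | h
  · obtain ⟨h1, h2, h3⟩ := hsplit a b c j i k
      (hcount _ fun x => by simp only [List.count_cons, List.count_nil]; ring) h
    have := isQuadraticInvariant_six hw hu.swap hv hwv huv huw.symm h1 h2 h3
    rw [huw', ← h] at this
    exact key (b, i) (c, k) ((hex3 b c hb hc hbc).trans (by rw [htr])) this
  · obtain ⟨h1, h2, h3⟩ := hsplit i j k b a c
      (hcount _ fun x => by simp only [List.count_cons, List.count_nil]; ring) h
    have := isQuadraticInvariant_six hu hw.swap hv huv hwv huw h1 h2 h3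
    rw [← h] at this
    exact key (j, a) (k, c) (hex1 j k hj hk hjk) this
  · obtain ⟨h1, h2, h3⟩ := hsplit a b c k j i
      (hcount _ fun x => by simp only [List.count_cons, List.count_nil]; ring) h
    have := isQuadraticInvariant_six hw hu.rotate.swap hv hwv huv huw.symm h1 h2 h3
    rw [huw', ← h] at this
    exact key (b, j) (c, i) (by rw [hswap, hex4 c b hc hb (Ne.symm hbc), hswap, htr]) this
  · obtain ⟨h1, h2, h3⟩ := hsplit i j k c b a
      (hcount _ fun x => by simp only [List.count_cons, List.count_nil]; ring) h
    have := isQuadraticInvariant_six hu hw.rotate.swap hv huv hwv huw h1 h2 h3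
    rw [← h] at this
    exact key (j, b) (k, a) (by rw [hswap, hex2 k j hk hj (Ne.symm hjk), hswap]) this
  · obtain ⟨h1, h2, h3⟩ := hsplit a b c i j k
      (hcount _ fun x => by simp only [List.count_cons, List.count_nil]; ring) h
    have := isQuadraticInvariant_six hw hu hv hwv huv huw.symm h1 h2 h3
    rw [huw', ← h] at this
    exact key (b, j) (c, k) (by rw [htr]) this
  · obtain ⟨h1, h2, h3⟩ := hsplit i j k a b c (.refl _) h
    have := isQuadraticInvariant_six hu hw hv huv hwv huw h1 h2 h3
    rw [← h] at this
    exact this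

end Multigraph

/-! ### Expansion at an oriented vertex of degree three -/

theorem StarExpansion.add {E : Type*} {i j k : E}
    {g g₀ gi gj gk t h h₀ hi hj hk s : MvPolynomial E ℤ}
    (hg : StarExpansion i j k g g₀ gi gj gk t) (hh : StarExpansion i j k h h₀ hi hj hk s) :
    StarExpansion i j k (g + h) (g₀ + h₀) (gi + hi) (gj + hj) (gk + hk) (t + s) := by
  refine ⟨by rw [hg.eq, hh.eq]; ring, ?_⟩
  have h1 := hg.free
  have h2 := hh.free
  simp only [List.forall_mem_cons] at h1 h2 ⊢
  obtain ⟨⟨_, _, _, _⟩, ⟨_, _, _, _⟩, ⟨_, _, _, _⟩, ⟨_, _, _, _⟩, ⟨_, _, _, _⟩, _⟩ := h1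
  obtain ⟨⟨_, _, _, _⟩, ⟨_, _, _, _⟩, ⟨_, _, _, _⟩, ⟨_, _, _, _⟩, ⟨_, _, _, _⟩, _⟩ := h2
  refine ⟨⟨?_, ?_, ?_, by simp⟩, ⟨?_, ?_, ?_, by simp⟩, ⟨?_, ?_, ?_, by simp⟩,
    ⟨?_, ?_, ?_, by simp⟩, ⟨?_, ?_, ?_, by simp⟩, by simp⟩ <;>
  apply FreeOf.add <;> assumption

theorem StarExpansion.neg_one_pow_mul {E : Type*} {i j k : E} {g g₀ gi gj gk t : MvPolynomial E ℤ}
    (hg : StarExpansion i j k g g₀ gi gj gk t) (n : ℕ) :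
    StarExpansion i j k ((-1) ^ n * g) ((-1) ^ n * g₀) ((-1) ^ n * gi) ((-1) ^ n * gj)
      ((-1) ^ n * gk) ((-1) ^ n * t) := by
  refine ⟨by rw [hg.eq]; ring, ?_⟩
  have h1 := hg.free
  simp only [List.forall_mem_cons] at h1 ⊢
  obtain ⟨⟨_, _, _, _⟩, ⟨_, _, _, _⟩, ⟨_, _, _, _⟩, ⟨_, _, _, _⟩, ⟨_, _, _, _⟩, _⟩ := h1
  refine ⟨⟨?_, ?_, ?_, by simp⟩, ⟨?_, ?_, ?_, by simp⟩, ⟨?_, ?_, ?_, by simp⟩,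
    ⟨?_, ?_, ?_, by simp⟩, ⟨?_, ?_, ?_, by simp⟩, by simp⟩ <;>
  exact (freeOf_one.neg.pow n).mul (by assumption)

namespace Multigraph

variable {V E : Type*} [DecidableEq V] [DecidableEq E] {G : Multigraph V E}

/-- The Dodgson polynomial of `G` without its overall sign: the signed minor of the expanded
Laplacian without the row and the column of the vertex `v`, without the rows in `p.map Prod.fst`,
and without the columns in `p.map Prod.snd`. -/
noncomputable def edgeMinor (G : Multigraph V E) (v : V) (K : Finset E) (p : List (E × E)) :
    MvPolynomial E ℤ :=
  unitMinor (G.labels v) (G.laplacian K) (p.map edgePair)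

theorem edgeMinor_perm {v : V} {K : Finset E} {p q : List (E × E)} (h : p.Perm q) :
    G.edgeMinor v K p = G.edgeMinor v K q := unitMinor_perm _ (h.map _)

theorem edgeMinor_expand {p : List (E × E)} (v : V) {K : Finset E} {e : E}
    (he : e ∈ G.edges) (hep : e ∉ p.map Prod.fst) (heK : e ∉ K) :
    G.edgeMinor v K p =
      X e * G.edgeMinor v (insert e K) ((e, e) :: p) + G.edgeMinor v (insert e K) p :=
  EdgePairs.expand v he hep heK

theorem EdgePairs.swap {V E : Type*} {G : Multigraph V E} {p : List (E × E)}
    (hp : G.EdgePairs p) : G.EdgePairs (p.map Prod.swap) := by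
  refine ⟨?_, ?_, ?_⟩
  · simpa [List.map_map, Function.comp_def] using hp.snd_nodup
  · simpa [List.map_map, Function.comp_def] using hp.fst_nodup
  · intro q hq
    obtain ⟨r, hr, rfl⟩ := List.mem_map.1 hq
    exact ⟨(hp.mem r hr).2, (hp.mem r hr).1⟩

theorem EdgePairs.edgeMinor_swap {p : List (E × E)} (hp : G.EdgePairs p) (v : V) (K : Finset E) :
    G.edgeMinor v K (p.map Prod.swap) = G.edgeMinor v K p := by
  have h := unitMinor_transpose (G.laplacian_symm K) (hp.valid v) (by
    have := hp.snd_nodup.map (Sum.inl_injective (α := E) (β := V))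
    simpa [List.map_map, Function.comp_def] using this)
  rw [edgeMinor, edgeMinor, ← h]
  simp [List.map_map, Function.comp_def, edgePair]

theorem HasStar.edgeMinor_diag {x v : V} {i j k : E} (hx : G.HasStar x {i, j, k}) (hxv : x ≠ v)
    (hn : [i, j, k].Nodup) {ε : ℤ} (hε : ∀ e ∈ [i, j, k], G.incidence x e = ε)
    {p : List (E × E)} (hp : G.EdgePairs ((i, i) :: p))
    (hpx : ∀ q ∈ p, ∀ e ∈ [i, j, k], q.1 ≠ e ∧ q.2 ≠ e) (K : Finset E) :
    G.edgeMinor v K ((j, j) :: (i, i) :: p) = -G.edgeMinor v K ((j, k) :: (i, i) :: p) := by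
  have hj := hx.mem_edges (e := j) (by simp)
  have hjp : j ∉ p.map Prod.fst := by
    intro h
    obtain ⟨q, hq, hqj⟩ := List.mem_map.1 h
    exact (hpx q hq j (by simp)).1 hqj
  simp only [List.nodup_cons, List.mem_cons, List.not_mem_nil, or_false, not_or] at hn
  obtain ⟨⟨hij, hik⟩, hjk, -⟩ := hn
  have hs := hx.isStar_three hxv K
  have hjp' : (Sum.inl j : E ⊕ V) ∉ (((i, i) :: p).map edgePair).map Prod.fst := by
    rw [mem_map_edgePair_inl, List.map_cons, List.mem_cons, not_or]
    exact ⟨Ne.symm hij, hjp⟩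
  have hrel := hs.row_relation (p := ((i, i) :: p).map edgePair) (x := Sum.inl j)
    (by simpa using hij) (by simpa using hik) (by simpa using hjk) (inl_mem_labels.2 hj) (by simp)
    notMem_map_edgePair_inr hjp'
  have hz := (hp.valid v).snd_zero (M := G.laplacian K) (i := Sum.inl j) (j := Sum.inl i)
    (inl_mem_labels.2 hj) hjp' (by simp)
  have hM : ∀ e ∈ [i, j, k], G.laplacian K (Sum.inr x) (Sum.inl e) = C ε := by
    intro e he
    rw [← hε e he]
    simp [laplacian]
  have hsq := hs.sq (Sum.inl i) (by simp)
  rw [hz, hM i (by simp), hM j (by simp), hM k (by simp)] at hrel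
  rw [hM i (by simp)] at hsq
  simp only [edgeMinor, List.map_cons] at hrel ⊢
  linear_combination (C ε) * hrel - (unitMinor (G.labels v) (G.laplacian K)
    ((Sum.inl j, Sum.inl j) :: (Sum.inl i, Sum.inl i) :: p.map edgePair) +
    unitMinor (G.labels v) (G.laplacian K)
    ((Sum.inl j, Sum.inl k) :: (Sum.inl i, Sum.inl i) :: p.map edgePair)) * hsq

theorem EdgePairs.cons_of_avoid {V E : Type*} {G : Multigraph V E} {p : List (E × E)}
    (hp : G.EdgePairs p) {i j : E} (hi : i ∈ G.edges)
    (hj : j ∈ G.edges) (hpi : ∀ q ∈ p, q.1 ≠ i) (hpj : ∀ q ∈ p, q.2 ≠ j) :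
    G.EdgePairs ((i, j) :: p) := by
  refine edgePairs_cons_iff.2 ⟨⟨?_, ?_, hi, hj⟩, hp⟩
  · intro h
    obtain ⟨q, hq, hqe⟩ := List.mem_map.1 h
    exact hpi q hq hqe
  · intro h
    obtain ⟨q, hq, hqe⟩ := List.mem_map.1 h
    exact hpj q hq hqe

/-- At an oriented vertex of degree three the quadratic coefficients agree. -/
theorem HasStar.edgeMinor_diag_eq {x v : V} {i j k : E} (hx : G.HasStar x {i, j, k}) (hxv : x ≠ v)
    (hn : [i, j, k].Nodup) {ε : ℤ} (hε : ∀ e ∈ [i, j, k], G.incidence x e = ε)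
    {p : List (E × E)} (hp : G.EdgePairs p)
    (hpx : ∀ q ∈ p, ∀ e ∈ [i, j, k], q.1 ≠ e ∧ q.2 ≠ e) (K : Finset E) :
    G.edgeMinor v K ((j, j) :: (i, i) :: p) = G.edgeMinor v K ((k, k) :: (i, i) :: p) := by
  have hi := hx.mem_edges (e := i) (by simp)
  have hj := hx.mem_edges (e := j) (by simp)
  have hk := hx.mem_edges (e := k) (by simp)
  have hp1 : G.EdgePairs ((i, i) :: p) := hp.cons hi fun q hq => hpx q hq i (by simp)
  have hpx' : ∀ q ∈ p.map Prod.swap, ∀ e ∈ [i, k, j], q.1 ≠ e ∧ q.2 ≠ e := by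
    intro q hq e he
    obtain ⟨r, hr, rfl⟩ := List.mem_map.1 hq
    have := hpx r hr e (by simp at he ⊢; tauto)
    exact ⟨this.2, this.1⟩
  have hx' : G.HasStar x {i, k, j} := by
    have : ({i, k, j} : Finset E) = {i, j, k} := by ext; simp; tauto
    rwa [this]
  have hn' := hn
  simp only [List.nodup_cons, List.mem_cons, List.not_mem_nil, or_false, not_or] at hn'
  obtain ⟨⟨hij, hik⟩, hjk, -⟩ := hn'
  have hp2 : G.EdgePairs ((k, k) :: (i, i) :: p) := by
    refine hp1.cons hk fun q hq => ?_
    rcases List.mem_cons.1 hq with rfl | hq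
    · exact ⟨hik, hik⟩
    · exact hpx q hq k (by simp)
  have hp3 : G.EdgePairs ((j, k) :: (i, i) :: p) := by
    refine hp1.cons_of_avoid hj hk (fun q hq => ?_) (fun q hq => ?_) <;>
    rcases List.mem_cons.1 hq with rfl | hq
    · exact hij
    · exact (hpx q hq j (by simp)).1
    · exact hik
    · exact (hpx q hq k (by simp)).2
  have h1 := hx.edgeMinor_diag hxv hn hε hp1 hpx K
  have h2 := hx'.edgeMinor_diag hxv (p := p.map Prod.swap)
    (by simp [hij, hik, Ne.symm hjk]) (fun e he => hε e (by simp at he ⊢; tauto)) hp1.swap hpx' K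
  rw [h1, ← hp3.edgeMinor_swap, ← hp2.edgeMinor_swap]
  simp only [List.map_cons, Prod.swap_prod_mk]
  rw [h2]

theorem EdgePairs.freeOf_edgeMinor {p : List (E × E)} (hp : G.EdgePairs p) (v : V) {K : Finset E}
    {e : E} (h : e ∈ K) : FreeOf e (G.edgeMinor v K p) := hp.freeOf v (Or.inl h)

/-- The expansion of a minor in the variables at an oriented vertex of degree three. -/
theorem HasStar.starExpansion {x v : V} {i j k : E} (hx : G.HasStar x {i, j, k}) (hxv : x ≠ v)
    (hn : [i, j, k].Nodup) {ε : ℤ} (hε : ∀ e ∈ [i, j, k], G.incidence x e = ε)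
    {p : List (E × E)} (hp : G.EdgePairs p)
    (hpx : ∀ q ∈ p, ∀ e ∈ [i, j, k], q.1 ≠ e ∧ q.2 ≠ e) {K L : Finset E}
    (hK : ∀ e ∈ [i, j, k], e ∉ K) (hL : L = insert k (insert j (insert i K))) :
    StarExpansion i j k (G.edgeMinor v K p) (G.edgeMinor v L ((i, i) :: (j, j) :: p))
      (G.edgeMinor v L ((i, i) :: p)) (G.edgeMinor v L ((j, j) :: p))
      (G.edgeMinor v L ((k, k) :: p)) (G.edgeMinor v L p) := by
  have hi := hx.mem_edges (e := i) (by simp)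
  have hj := hx.mem_edges (e := j) (by simp)
  have hk := hx.mem_edges (e := k) (by simp)
  have q1 : G.EdgePairs ((i, i) :: p) := hp.cons hi fun q hq => hpx q hq i (by simp)
  have q2 : G.EdgePairs ((j, j) :: p) := hp.cons hj fun q hq => hpx q hq j (by simp)
  have q3 : G.EdgePairs ((k, k) :: p) := hp.cons hk fun q hq => hpx q hq k (by simp)
  have hn' := hn
  simp only [List.nodup_cons, List.mem_cons, List.not_mem_nil, or_false, not_or] at hn'
  obtain ⟨⟨hij, hik⟩, hjk, -⟩ := hn'
  have q4 : G.EdgePairs ((i, i) :: (j, j) :: p) := by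
    refine q2.cons hi fun q hq => ?_
    rcases List.mem_cons.1 hq with rfl | hq
    · exact ⟨Ne.symm hij, Ne.symm hij⟩
    · exact hpx q hq i (by simp)
  have q5 : G.EdgePairs ((k, k) :: (j, j) :: (i, i) :: p) := by
    refine ((q1.cons hj fun q hq => ?_).cons hk fun q hq => ?_)
    · rcases List.mem_cons.1 hq with rfl | hq
      · exact ⟨hij, hij⟩
      · exact hpx q hq j (by simp)
    · rcases List.mem_cons.1 hq with rfl | hq
      · exact ⟨hjk, hjk⟩
      rcases List.mem_cons.1 hq with rfl | hq
      · exact ⟨hik, hik⟩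
      · exact hpx q hq k (by simp)
  have havoid : ∀ e ∈ [i, j, k], e ∉ p.map Prod.fst := by
    intro e he h
    obtain ⟨q, hq, hqe⟩ := List.mem_map.1 h
    exact (hpx q hq e he).1 hqe
  have hjK : j ∉ insert i K := by simp [Ne.symm hij, hK j (by simp)]
  have hkK : k ∉ insert j (insert i K) := by simp [Ne.symm hik, Ne.symm hjk, hK k (by simp)]
  constructor
  · have hz : G.edgeMinor v L ((k, k) :: (j, j) :: (i, i) :: p) = 0 :=
      (hx.isStar_three hxv L).row_zero (q5.valid v) notMem_map_edgePair_inr (by simp)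
    have hp1 : G.edgeMinor v L ((j, j) :: (i, i) :: p) = G.edgeMinor v L ((i, i) :: (j, j) :: p) :=
      edgeMinor_perm (List.Perm.swap _ _ _)
    have h1 := hx.edgeMinor_diag_eq hxv hn hε hp hpx L
    have h2 := hx.swap.edgeMinor_diag_eq hxv (by simp [Ne.symm hij, hik, hjk])
      (fun e he => hε e (by simp at he ⊢; tauto)) hp
      (fun q hq e he => hpx q hq e (by simp at he ⊢; tauto)) L
    rw [edgeMinor_expand v (p := p) (K := K) hi (havoid i (by simp)) (hK i (by simp)),
      edgeMinor_expand v (p := (i, i) :: p) hj (by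
        simpa [Ne.symm hij] using havoid j (by simp)) hjK,
      edgeMinor_expand v (p := p) hj (havoid j (by simp)) hjK,
      edgeMinor_expand v (p := (j, j) :: (i, i) :: p) hk (by
        simpa [Ne.symm hik, Ne.symm hjk] using havoid k (by simp)) hkK,
      edgeMinor_expand v (p := (i, i) :: p) hk (by
        simpa [Ne.symm hik] using havoid k (by simp)) hkK,
      edgeMinor_expand v (p := (j, j) :: p) hk (by
        simpa [Ne.symm hjk] using havoid k (by simp)) hkK,
      edgeMinor_expand v (p := p) hk (havoid k (by simp)) hkK, ← hL, hz, ← h1, ← h2, hp1]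
    ring
  · have hmem : ∀ e ∈ [i, j, k], e ∈ L := by
      intro e he
      rw [hL]
      simp only [List.mem_cons, List.not_mem_nil, or_false, Finset.mem_insert] at he ⊢
      tauto
    intro P hP e he
    have he' := hmem e he
    simp only [List.mem_cons, List.not_mem_nil, or_false] at hP
    rcases hP with rfl | rfl | rfl | rfl | rfl
    · exact q4.freeOf_edgeMinor v he'
    · exact q1.freeOf_edgeMinor v he'
    · exact q2.freeOf_edgeMinor v he'
    · exact q3.freeOf_edgeMinor v he'
    · exact hp.freeOf_edgeMinor v he'

/-- The expansion of the Symanzik polynomial in the variables at an oriented vertex of degree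
three, together with the quadratic relation between its coefficients. -/
theorem HasStar.starExpansion_nil {x v : V} {i j k : E} (hx : G.HasStar x {i, j, k}) (hxv : x ≠ v)
    (hn : [i, j, k].Nodup) {ε : ℤ} (hε : ∀ e ∈ [i, j, k], G.incidence x e = ε) {K L : Finset E}
    (hK : ∀ e ∈ [i, j, k], e ∉ K) (hL : L = insert k (insert j (insert i K))) :
    StarExpansion i j k (G.edgeMinor v K []) (G.edgeMinor v L [(i, i), (j, j)])
      (-(G.edgeMinor v L [(i, k)] + G.edgeMinor v L [(i, j)]))
      (-(G.edgeMinor v L [(j, k)] + G.edgeMinor v L [(i, j)]))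
      (-(G.edgeMinor v L [(j, k)] + G.edgeMinor v L [(i, k)])) (G.edgeMinor v L []) ∧
    G.edgeMinor v L [(i, i), (j, j)] * G.edgeMinor v L [] =
      G.edgeMinor v L [(j, k)] * G.edgeMinor v L [(i, k)] +
      G.edgeMinor v L [(j, k)] * G.edgeMinor v L [(i, j)] +
      G.edgeMinor v L [(i, k)] * G.edgeMinor v L [(i, j)] := by
  have h := hx.starExpansion hxv hn hε edgePairs_nil (by simp) hK hL
  have hi := hx.mem_edges (e := i) (by simp)
  have hj := hx.mem_edges (e := j) (by simp)
  have hk := hx.mem_edges (e := k) (by simp)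
  have hs := hx.isStar_three hxv L
  simp only [List.nodup_cons, List.mem_cons, List.not_mem_nil, or_false, not_or] at hn
  obtain ⟨⟨hij, hik⟩, hjk, -⟩ := hn
  have hM : ∀ e ∈ [i, j, k], G.laplacian L (Sum.inr x) (Sum.inl e) = C ε := by
    intro e he
    rw [← hε e he]
    simp [laplacian]
  have hsq := hs.sq (Sum.inl i) (by simp)
  rw [hM i (by simp)] at hsq
  have hrel : ∀ y ∈ G.edges, G.edgeMinor v L [(y, i)] + G.edgeMinor v L [(y, j)] +
      G.edgeMinor v L [(y, k)] = 0 := by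
    intro y hy
    have := hs.row_relation (p := []) (x := Sum.inl y)
      (by simpa using hij) (by simpa using hik) (by simpa using hjk) (inl_mem_labels.2 hy) (by simp)
      (by simp) (by simp)
    rw [hM i (by simp), hM j (by simp), hM k (by simp)] at this
    simp only [edgeMinor, List.map_cons, List.map_nil]
    linear_combination (C ε) * this - (unitMinor (G.labels v) (G.laplacian L)
      [(Sum.inl y, Sum.inl i)] + unitMinor (G.labels v) (G.laplacian L) [(Sum.inl y, Sum.inl j)] +
      unitMinor (G.labels v) (G.laplacian L) [(Sum.inl y, Sum.inl k)]) * hsq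
  have htr : ∀ y z, y ∈ G.edges → z ∈ G.edges →
      G.edgeMinor v L [(y, z)] = G.edgeMinor v L [(z, y)] := by
    intro y z hy hz
    have : G.EdgePairs [(z, y)] := by simp [edgePairs_cons_iff, edgePairs_nil, hy, hz]
    exact this.edgeMinor_swap v L
  have e1 : G.edgeMinor v L [(i, i)] =
      -(G.edgeMinor v L [(i, k)] + G.edgeMinor v L [(i, j)]) := by
    linear_combination hrel i hi
  have e2 : G.edgeMinor v L [(j, j)] =
      -(G.edgeMinor v L [(j, k)] + G.edgeMinor v L [(i, j)]) := by
    linear_combination hrel j hj - htr j i hj hi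
  have e3 : G.edgeMinor v L [(k, k)] =
      -(G.edgeMinor v L [(j, k)] + G.edgeMinor v L [(i, k)]) := by
    linear_combination hrel k hk - htr k i hk hi - htr k j hk hj
  have hd : G.edgeMinor v L [(i, i)] * G.edgeMinor v L [(j, j)] -
      G.edgeMinor v L [(i, i), (j, j)] * G.edgeMinor v L [] =
      G.edgeMinor v L [(i, j)] * G.edgeMinor v L [(j, i)] :=
    unitMinor_dodgson (G.laplacian L) (inl_mem_labels.2 hi) (inl_mem_labels.2 hj)
      (by simpa using hij)
  rw [← e1, ← e2, ← e3]
  refine ⟨h, ?_⟩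
  rw [e1, e2, htr j i hj hi] at hd
  linear_combination -hd

end Multigraph

/-! ### Reduction at vertices of degree two and at the oriented vertex -/

theorem mem_insert_insert_of_mem_pair {α : Type*} [DecidableEq α] {i j e : α} (K : Finset α)
    (he : e ∈ [i, j]) : e ∈ insert j (insert i K) := by
  simp only [List.mem_cons, List.not_mem_nil, or_false, Finset.mem_insert] at he ⊢
  tauto

theorem mem_insert_insert_insert_of_mem_triple {α : Type*} [DecidableEq α] {i j k e : α}
    (K : Finset α) (he : e ∈ [i, j, k]) : e ∈ insert k (insert j (insert i K)) := by
  simp only [List.mem_cons, List.not_mem_nil, or_false, Finset.mem_insert] at he ⊢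
  tauto

namespace Multigraph

variable {V E : Type*} [DecidableEq V] [DecidableEq E] {G : Multigraph V E}

/-- If the edge `k` joins the vertices `y` and `z` of degree three, then a minor without the rows of
the other four edges at `y` and `z` vanishes. -/
theorem HasStar.edgeMinor_eq_zero {y z v : V} {i j k l m : E} (hy : G.HasStar y {k, i, j})
    (hz : G.HasStar z {k, l, m}) (hyz : y ≠ z) (hyv : y ≠ v) (hzv : z ≠ v) {p : List (E × E)}
    (hk : k ∉ p.map Prod.fst) (hp : ∀ e ∈ [i, j, l, m], e ∈ p.map Prod.fst) (K : Finset E) :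
    G.edgeMinor v K p = 0 := by
  rw [edgeMinor, (hz.isStar_three hzv K).col_single (G.laplacian_symm K) notMem_map_edgePair_inr_snd
    (j := Sum.inl k) (by simp) (fun h => hk (mem_map_edgePair_inl.1 h)),
    (hy.isStar_three hyv K).col_zero (G.laplacian_symm K), mul_zero]
  · rw [List.map_cons, List.mem_cons, not_or]
    exact ⟨by simpa using hyz, notMem_map_edgePair_inr_snd⟩
  · intro x hx
    rw [List.map_cons, List.mem_cons]
    simp only [Finset.mem_insert, Finset.mem_singleton] at hx
    rcases hx with rfl | rfl | rfl
    · exact Or.inl rfl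
    · exact Or.inr (mem_map_edgePair_inl.2 (hp _ (by simp)))
    · exact Or.inr (mem_map_edgePair_inl.2 (hp _ (by simp)))
  · intro x hx hxk
    simp only [Finset.mem_insert, Finset.mem_singleton] at hx
    rcases hx with rfl | rfl | rfl
    · exact absurd rfl hxk
    · exact mem_map_edgePair_inl.2 (hp _ (by simp))
    · exact mem_map_edgePair_inl.2 (hp _ (by simp))

/-- Expansion in two variables `α_i`, `α_j` without a mixed term. -/
theorem edgeMinor_expand_two {v : V} {i j : E} (hi : i ∈ G.edges) (hj : j ∈ G.edges) (hij : i ≠ j)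
    {p : List (E × E)} (hip : i ∉ p.map Prod.fst) (hjp : j ∉ p.map Prod.fst) {K : Finset E}
    (hiK : i ∉ K) (hjK : j ∉ K)
    (hz : G.edgeMinor v (insert j (insert i K)) ((j, j) :: (i, i) :: p) = 0) :
    G.edgeMinor v K p = G.edgeMinor v (insert j (insert i K)) ((i, i) :: p) * X i +
      G.edgeMinor v (insert j (insert i K)) ((j, j) :: p) * X j +
      G.edgeMinor v (insert j (insert i K)) p := by
  have hjK' : j ∉ insert i K := by simp [hij.symm, hjK]
  rw [edgeMinor_expand v (p := p) (K := K) hi hip hiK,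
    edgeMinor_expand v (p := (i, i) :: p) hj (by simpa [hij.symm] using hjp) hjK',
    edgeMinor_expand v (p := p) hj hjp hjK', hz]
  ring

/-- The Symanzik polynomial of a graph with a vertex `y` of degree two. -/
theorem HasStar.edgeMinor_nil_of_pair {y v : V} {i j : E} (hy : G.HasStar y {i, j}) (hyv : y ≠ v)
    (hij : i ≠ j) {K : Finset E} (hiK : i ∉ K) (hjK : j ∉ K) :
    G.edgeMinor v K [] =
      -(G.removeVerts {y}).edgeMinor v (insert j (insert i K)) [] * (X i + X j) +
        G.edgeMinor v (insert j (insert i K)) [] := by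
  have hi := hy.mem_edges (e := i) (by simp)
  have hj := hy.mem_edges (e := j) (by simp)
  set L := insert j (insert i K) with hL
  have hs : IsStar (G.labels v) (G.laplacian L) (Sum.inr y) {Sum.inl i, Sum.inl j} := by
    simpa [Finset.image_insert] using hy.isStar hyv L
  have hlab : ((((G.labels v).erase (Sum.inl i)).erase (Sum.inl j)).erase (Sum.inr y)) =
      (G.removeVerts {y}).labels v := by
    rw [hy.labels_removeVerts]
    ext x
    simp only [Finset.mem_sdiff, Finset.mem_erase, Finset.image_insert, Finset.image_singleton,
      Finset.mem_insert, Finset.mem_singleton]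
    tauto
  have hq : G.EdgePairs [(j, j), (i, i)] := by
    simp [edgePairs_cons_iff, edgePairs_nil, hi, hj, hij.symm]
  have h1 := hs.remove_two (G.laplacian_symm L) (by simpa using hij) validPairs_nil (by simp)
  have hs' : IsStar (G.labels v) (G.laplacian L) (Sum.inr y) {Sum.inl j, Sum.inl i} := by
    rwa [Finset.pair_comm]
  have h2 := hs'.remove_two (G.laplacian_symm L) (by simpa using hij.symm) validPairs_nil (by simp)
  rw [hlab] at h1
  rw [Finset.erase_right_comm (a := Sum.inl j), hlab] at h2
  have hz : G.edgeMinor v L [(j, j), (i, i)] = 0 :=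
    hs.row_zero (hq.valid v) notMem_map_edgePair_inr (by simp)
  rw [edgeMinor_expand_two hi hj hij (by simp) (by simp) hiK hjK hz, ← hL]
  have h1' : G.edgeMinor v L [(i, i)] = -(G.removeVerts {y}).edgeMinor v L [] := h1
  have h2' : G.edgeMinor v L [(j, j)] = -(G.removeVerts {y}).edgeMinor v L [] := h2
  rw [h1', h2']
  ring

/-- Reduction of `(Ψ g)²` at a vertex `y` of degree two in `Γ`, where `Ψ` is the Symanzik
polynomial of `Γ`: since `Ψ = (α_i + α_j) F + F'`, the resultant in `α_i` is linear in `α_j` with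
leading coefficient `F (gj - gi)`.  Up to sign, `F` belongs to `Γ` without `y`. -/
theorem IsQuadraticInvariant.reduce_two_valent {Γ : Multigraph V E} {s : List E} {K : Finset E}
    {v y : V} {i j : E} {g gi gj t : MvPolynomial E ℤ}
    (hs : G.IsQuadraticInvariant s ((Γ.edgeMinor v K [] * g) ^ 2)) (hy : Γ.HasStar y {i, j})
    (hyv : y ≠ v) (hi : i ∈ G.edges) (hj : j ∈ G.edges) (hij : i ≠ j) (hiK : i ∉ K) (hjK : j ∉ K)
    (his : i ∉ s) (hjs : j ∉ s) (hg : g = gi * X i + gj * X j + t)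
    (hfree : ∀ P ∈ [gi, gj, t], ∀ e ∈ [i, j], FreeOf e P) :
    G.IsQuadraticInvariant (s ++ [i, j])
      (((Γ.removeVerts {y}).edgeMinor v (insert j (insert i K)) [] * (gi - gj)) ^ 2) := by
  rw [hy.edgeMinor_nil_of_pair hyv hij hiK hjK, hg] at hs
  have h := hs.reduce_pair hi hj his hjs hij ?_
  · rwa [neg_mul, neg_sq] at h
  · intro P hP e he
    have he' := mem_insert_insert_of_mem_pair K he
    rw [List.mem_cons, List.mem_cons] at hP
    rcases hP with rfl | rfl | hP
    · exact (edgePairs_nil.freeOf_edgeMinor v he').neg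
    · exact edgePairs_nil.freeOf_edgeMinor v he'
    · exact hfree P hP e he

theorem HasStar.exists_incidence {V E : Type*} [DecidableEq V] {G : Multigraph V E}
    {x : V} {T : Finset E} (hx : G.HasStar x T)
    (ho : G.IsOrientedAt x) : ∃ ε : ℤ, ∀ e ∈ T, G.incidence x e = ε := by
  rcases ho with h | h
  · refine ⟨1, fun e he => ?_⟩
    have hl := hx.no_loop e he
    have h1 := h e (by rwa [hx.incident]) hl
    have h2 : G.tgt e ≠ x := fun h2 => hl (h1.trans h2.symm)
    simp [incidence, h1, h2]
  · refine ⟨-1, fun e he => ?_⟩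
    have hl := hx.no_loop e he
    have h1 := h e (by rwa [hx.incident]) hl
    have h2 : G.src e ≠ x := fun h2 => hl (h2.trans h1.symm)
    simp [incidence, h1, h2]

/-- The sign `(-1) ^ (|V| - 1)` of the Dodgson polynomials of `Γ` cancels, because every term of the
reduced invariant contains two of them. -/
theorem HasStar.reducedInvariant_eq {Γ : Multigraph V E} {H : GraphSum V E} {L : Finset E} {v x : V}
    {e₂ e₃ b c i j k : E} (hx : Γ.HasStar x {i, j, k}) (hv : v ∈ Γ.verts) (hn : [i, j, k].Nodup)
    (hL : ∀ {e}, e ∈ [i, j, k] → e ∈ L) (hLΓ : ∀ e ∈ Γ.edges, e ∈ L → e ∈ [i, j, k]) :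
    reducedInvariant Γ H e₂ e₃ b c i j k =
      Γ.edgeMinor v L [(i, i), (j, j)] * (Γ.edgeMinor v L [(i, i), (j, j)] *
        kaellen (GraphSum.dodgson [e₂, e₃, i] [b, c, i] {j, k} H)
          (GraphSum.dodgson [e₂, e₃, j] [b, c, j] {i, k} H)
          (GraphSum.dodgson [e₂, e₃, k] [b, c, k] {i, j} H) -
        4 * GraphSum.dodgson [e₂, e₃, i, j] [b, c, i, j] {k} H *
          (Γ.edgeMinor v L [(j, k)] * GraphSum.dodgson [e₂, e₃, i] [b, c, i] {j, k} H +
            Γ.edgeMinor v L [(i, k)] * GraphSum.dodgson [e₂, e₃, j] [b, c, j] {i, k} H +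
            Γ.edgeMinor v L [(i, j)] * GraphSum.dodgson [e₂, e₃, k] [b, c, k] {i, j} H +
            Γ.edgeMinor v L [] * GraphSum.dodgson [e₂, e₃, i, j] [b, c, i, j] {k} H)) := by
  have hi := hx.mem_edges (e := i) (by simp)
  have hj := hx.mem_edges (e := j) (by simp)
  have hk := hx.mem_edges (e := k) (by simp)
  simp only [List.nodup_cons, List.mem_cons, List.not_mem_nil, or_false, not_or] at hn
  obtain ⟨⟨hij, hik⟩, hjk, -⟩ := hn
  have hcv : ∀ (p : List (E × E)) (K' : Finset E), Γ.EdgePairs p →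
      (∀ e, e ∉ p.map Prod.fst → e ∉ p.map Prod.snd → (e ∈ K' ↔ e ∈ [i, j, k])) →
      Γ.dodgson (p.map Prod.fst) (p.map Prod.snd) K' =
        (-1) ^ (Γ.verts.card - 1) * Γ.edgeMinor v L p := by
    intro p K' hp hK'
    rw [hp.dodgson_eq K' hv, edgeMinor, hp.congr_vars v]
    intro e he h1 h2
    exact (hK' e h1 h2).trans ⟨hL, hLΓ e he⟩
  have qq : ∀ y ∈ Γ.edges, ∀ z ∈ Γ.edges, Γ.EdgePairs [(y, z)] := by
    intro y hy z hz
    simp [edgePairs_cons_iff, edgePairs_nil, hy, hz]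
  have hsg : ((-1) ^ (Γ.verts.card - 1) : MvPolynomial E ℤ) ^ 2 = 1 := by
    rw [← pow_mul, mul_comm, pow_mul, neg_one_sq, one_pow]
  have d0 := hcv [(i, i), (j, j)] {k} (by simp [edgePairs_cons_iff, edgePairs_nil, hi, hj, hij])
    (fun e h1 _ => by simp at h1; simp [h1])
  have d1 := hcv [(j, k)] {i} (qq j hj k hk) (fun e h1 h2 => by simp at h1 h2; simp [h1, h2])
  have d2 := hcv [(i, k)] {j} (qq i hi k hk) (fun e h1 h2 => by simp at h1 h2; simp [h1, h2])
  have d3 := hcv [(i, j)] {k} (qq i hi j hj) (fun e h1 h2 => by simp at h1 h2; simp [h1, h2])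
  have d4 := hcv [] {i, j, k} edgePairs_nil (by simp)
  simp only [List.map_cons, List.map_nil] at d0 d1 d2 d3 d4
  rw [reducedInvariant, d0, d1, d2, d3, d4]
  generalize ((-1) ^ (Γ.verts.card - 1) : MvPolynomial E ℤ) = σ at hsg ⊢
  generalize Γ.edgeMinor v L [(i, i), (j, j)] = f₀
  generalize Γ.edgeMinor v L [(j, k)] = fi
  generalize Γ.edgeMinor v L [(i, k)] = fj
  generalize Γ.edgeMinor v L [(i, j)] = fk
  generalize Γ.edgeMinor v L [] = f
  generalize GraphSum.dodgson [e₂, e₃, i, j] [b, c, i, j] {k} H = g₀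
  generalize GraphSum.dodgson [e₂, e₃, i] [b, c, i] {j, k} H = gi
  generalize GraphSum.dodgson [e₂, e₃, j] [b, c, j] {i, k} H = gj
  generalize GraphSum.dodgson [e₂, e₃, k] [b, c, k] {i, j} H = gk
  linear_combination (f₀ * (f₀ * kaellen gi gj gk -
    4 * g₀ * (fi * gi + fj * gj + fk * gk + f * g₀))) * hsg

/-- The last three reductions, in the variables at the oriented vertex `x`. -/
theorem IsQuadraticInvariant.reduce_oriented {Γ : Multigraph V E} {H : GraphSum V E} {s : List E}
    {K : Finset E} {v x : V} {e₂ e₃ b c i j k : E} {g t : MvPolynomial E ℤ} {ε : ℤ}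
    (hs : G.IsQuadraticInvariant s ((Γ.edgeMinor v K [] * g) ^ 2))
    (hg : g ^ 2 = GraphSum.dodgson [e₂, e₃] [b, c] ∅ H ^ 2) (hx : Γ.HasStar x {i, j, k})
    (hxv : x ≠ v) (hv : v ∈ Γ.verts) (hn : [i, j, k].Nodup)
    (hε : ∀ e ∈ [i, j, k], Γ.incidence x e = ε) (hG : ∀ e ∈ [i, j, k], e ∈ G.edges)
    (hsn : ∀ e ∈ [i, j, k], e ∉ s) (hK : ∀ e ∈ [i, j, k], e ∉ K)
    (hKΓ : ∀ e ∈ K, e ∉ Γ.edges)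
    (hH : StarExpansion i j k (GraphSum.dodgson [e₂, e₃] [b, c] ∅ H)
      (GraphSum.dodgson [e₂, e₃, i, j] [b, c, i, j] {k} H)
      (GraphSum.dodgson [e₂, e₃, i] [b, c, i] {j, k} H)
      (GraphSum.dodgson [e₂, e₃, j] [b, c, j] {i, k} H)
      (GraphSum.dodgson [e₂, e₃, k] [b, c, k] {i, j} H) t) :
    G.IsQuadraticInvariant (s ++ [i, j, k]) (reducedInvariant Γ H e₂ e₃ b c i j k) := by
  obtain ⟨hexp, hrel⟩ := hx.starExpansion_nil hxv hn hε hK rfl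
  have hi := hx.mem_edges (e := i) (by simp)
  have hj := hx.mem_edges (e := j) (by simp)
  have hk := hx.mem_edges (e := k) (by simp)
  rw [mul_pow, hg, ← mul_pow] at hs
  set L := insert k (insert j (insert i K)) with hL
  have hn' := hn
  simp only [List.nodup_cons, List.mem_cons, List.not_mem_nil, or_false, not_or] at hn'
  obtain ⟨⟨hij, hik⟩, hjk, -⟩ := hn'

  have qq : ∀ y ∈ Γ.edges, ∀ z ∈ Γ.edges, Γ.EdgePairs [(y, z)] := by
    intro y hy z hz
    simp [edgePairs_cons_iff, edgePairs_nil, hy, hz]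
  have hfree : ∀ P ∈ [Γ.edgeMinor v L [(j, k)], Γ.edgeMinor v L [(i, k)],
      Γ.edgeMinor v L [(i, j)]], ∀ e ∈ [i, j, k], FreeOf e P := by
    intro P hP e he
    have he' : e ∈ L := mem_insert_insert_insert_of_mem_triple K he
    simp only [List.mem_cons, List.not_mem_nil, or_false] at hP
    rcases hP with rfl | rfl | rfl
    · exact (qq j hj k hk).freeOf_edgeMinor v he'
    · exact (qq i hi k hk).freeOf_edgeMinor v he'
    · exact (qq i hi j hj).freeOf_edgeMinor v he'
  have hres := hs.reduce_star (hG i (by simp)) (hG j (by simp)) (hG k (by simp))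
    (hsn i (by simp)) (hsn j (by simp)) (hsn k (by simp)) hij hik hjk hexp hfree hrel hH
  rwa [hx.reducedInvariant_eq hv hn (mem_insert_insert_insert_of_mem_triple K) ?_]
  intro e he heL
  rw [Finset.mem_insert, Finset.mem_insert, Finset.mem_insert] at heL
  have := hKΓ e
  clear * - this heL he
  simp only [List.mem_cons, List.not_mem_nil, or_false]
  tauto

end Multigraph

namespace GraphSum

open Multigraph

variable {V E : Type*} [DecidableEq V] [DecidableEq E] {G : Multigraph V E}

theorem dodgson_minor_eq {v : V} (hv : v ∈ G.verts) (D C : List E) {q : List (E × E)}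
    {K L : Finset E} (hDC : (D ++ C).Nodup) (hq : ∀ r ∈ q, r.1 ∉ D ++ C ∧ r.2 ∉ D ++ C)
    (hCK : ∀ e ∈ C, e ∉ K) (hqG : G.EdgePairs q) (hG : ∀ e ∈ D ++ C, e ∈ G.edges)
    (hL : ∀ e, e ∉ D → e ∉ q.map Prod.fst → e ∉ q.map Prod.snd → (e ∈ K ∨ e ∈ C ↔ e ∈ L)) :
    dodgson (q.map Prod.fst) (q.map Prod.snd) K (minor (FreeAbelianGroup.of G) D C) =
      (-1) ^ (G.verts.card - 1) * G.edgeMinor v L (D.map (fun f => (f, f)) ++ q) := by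
  have hq' : G.EdgePairs (D.map (fun f => (f, f)) ++ q) :=
    hqG.append_diag D (List.nodup_append.1 hDC).1 (fun f hf => hG f (List.mem_append_left _ hf))
      fun f hf r hr => ⟨fun h => (hq r hr).1 (by simp [h, hf]),
        fun h => (hq r hr).2 (by simp [h, hf])⟩
  have h1 := hq'.dodgson_eq (K ∪ C.toFinset) hv
  have h2 := hq'.congr_vars v (K := K ∪ C.toFinset) (K' := L) (by
    intro e _ h3 h4
    simp only [List.map_append, List.map_map, List.mem_append, not_or] at h3 h4
    have h5 : e ∉ D := fun h => h3.1 (List.mem_map.2 ⟨e, h, rfl⟩)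
    rw [← hL e h5 h3.2 h4.2, Finset.mem_union, List.mem_toFinset])
  rw [dodgson_minor D C hDC hq hCK G hqG hG, edgeMinor, ← h2, ← h1]
  simp [List.map_map, Function.comp_def]

end GraphSum

/-! ### Coefficients of the Dodgson polynomial of a minor -/

namespace Multigraph

variable {V E : Type*} [DecidableEq V] [DecidableEq E] {G : Multigraph V E}

/-- The expansion of `Ψ^{23,bc}` of a minor in the variables at the oriented vertex. -/
theorem HasStar.starExpansion_minor {v x : V} {e₂ e₃ b c i j k : E} {ε : ℤ}
    (hx : G.HasStar x {i, j, k}) (hxv : x ≠ v) (hv : v ∈ G.verts)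
    (hε : ∀ e ∈ [i, j, k], G.incidence x e = ε) (D Cs : List E)
    (hn : ([e₂, e₃, b, c, i, j, k] ++ (D ++ Cs)).Nodup)
    (hG : ∀ e ∈ [e₂, e₃, b, c, i, j, k] ++ (D ++ Cs), e ∈ G.edges) :
    ∃ t, StarExpansion i j k
      (GraphSum.dodgson [e₂, e₃] [b, c] ∅ (GraphSum.minor (FreeAbelianGroup.of G) D Cs))
      (GraphSum.dodgson [e₂, e₃, i, j] [b, c, i, j] {k}
        (GraphSum.minor (FreeAbelianGroup.of G) D Cs))
      (GraphSum.dodgson [e₂, e₃, i] [b, c, i] {j, k}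
        (GraphSum.minor (FreeAbelianGroup.of G) D Cs))
      (GraphSum.dodgson [e₂, e₃, j] [b, c, j] {i, k}
        (GraphSum.minor (FreeAbelianGroup.of G) D Cs))
      (GraphSum.dodgson [e₂, e₃, k] [b, c, k] {i, j}
        (GraphSum.minor (FreeAbelianGroup.of G) D Cs)) t := by
  obtain ⟨hn1, hDC, hd⟩ := List.nodup_append.1 hn
  have hdis : ∀ e ∈ [e₂, e₃, b, c, i, j, k], e ∉ D ++ Cs := fun e he he' => hd e he e he' rfl
  have hDe : ∀ e ∈ D ++ Cs, e ∈ G.edges := fun e he => hG e (List.mem_append_right _ he)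
  have hGe : ∀ e ∈ [e₂, e₃, b, c, i, j, k], e ∈ G.edges :=
    fun e he => hG e (List.mem_append_left _ he)
  have hr1 := List.nodup_reverse.2 hn1
  simp only [List.forall_mem_cons, List.mem_append, not_or] at hdis hGe
  obtain ⟨h2D, h3D, hbD, hcD, hiD, hjD, hkD, -⟩ := hdis
  obtain ⟨h2, h3, hb, hc, hi, hj, hk, -⟩ := hGe
  simp only [List.reverse_cons, List.reverse_nil, List.nil_append, List.cons_append,
    List.nodup_cons, List.mem_cons, List.not_mem_nil, or_false, not_or] at hn1 hr1
  have p0 : G.EdgePairs [(e₂, b), (e₃, c)] := by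
    simp [edgePairs_cons_iff, edgePairs_nil, h2, h3, hb, hc, hn1]
  have hav : ∀ f ∈ D, ∀ q ∈ [(e₂, b), (e₃, c)], q.1 ≠ f ∧ q.2 ≠ f := by
    intro f hf q hq
    have hne : ∀ {y}, y ∉ D ∧ y ∉ Cs → y ≠ f := fun h h' => h.1 (h' ▸ hf)
    simp only [List.mem_cons, List.not_mem_nil, or_false] at hq
    rcases hq with rfl | rfl
    · exact ⟨hne h2D, hne hbD⟩
    · exact ⟨hne h3D, hne hcD⟩
  have p1 : G.EdgePairs (D.map (fun f => (f, f)) ++ [(e₂, b), (e₃, c)]) :=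
    p0.append_diag D (List.nodup_append.1 hDC).1
      (fun f hf => hDe f (List.mem_append_left _ hf)) hav
  have hpx : ∀ q ∈ D.map (fun f => (f, f)) ++ [(e₂, b), (e₃, c)], ∀ e ∈ [i, j, k],
      q.1 ≠ e ∧ q.2 ≠ e := by
    intro q hq e he
    have heD : e ∉ D := by
      simp only [List.mem_cons, List.not_mem_nil, or_false] at he
      rcases he with rfl | rfl | rfl
      · exact hiD.1
      · exact hjD.1
      · exact hkD.1
    rw [List.mem_append] at hq
    rcases hq with hq | hq
    · obtain ⟨f, hf, rfl⟩ := List.mem_map.1 hq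
      have : f ≠ e := fun h => heD (h ▸ hf)
      exact ⟨this, this⟩
    · simp only [List.mem_cons, List.not_mem_nil, or_false] at hq he
      rcases hq with rfl | rfl <;> rcases he with rfl | rfl | rfl <;> simp [hn1]
  have hKi : ∀ e ∈ [i, j, k], e ∉ Cs.toFinset := by
    simp [hiD, hjD, hkD]
  have hexp := (hx.starExpansion hxv (by simp [hn1]) hε p1 hpx hKi rfl).neg_one_pow_mul
    (G.verts.card - 1)
  set L := insert k (insert j (insert i Cs.toFinset)) with hL
  have hLm : ∀ e, e ∈ L ↔ e = k ∨ e = j ∨ e = i ∨ e ∈ Cs := by simp [hL]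
  have hmin : ∀ (q : List (E × E)) (K L : Finset E),
      (∀ r ∈ q, r.1 ∉ D ++ Cs ∧ r.2 ∉ D ++ Cs) → (∀ e ∈ Cs, e ∉ K) → G.EdgePairs q →
      (∀ e, e ∉ D → e ∉ q.map Prod.fst → e ∉ q.map Prod.snd → (e ∈ K ∨ e ∈ Cs ↔ e ∈ L)) →
      GraphSum.dodgson (q.map Prod.fst) (q.map Prod.snd) K
        (GraphSum.minor (FreeAbelianGroup.of G) D Cs) =
      (-1) ^ (G.verts.card - 1) * G.edgeMinor v L (D.map (fun f => (f, f)) ++ q) :=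
    fun q K L h1 h2 h3 h4 => GraphSum.dodgson_minor_eq hv D Cs hDC h1 h2 h3 hDe h4
  have hCne : ∀ {y}, y ∉ D ∧ y ∉ Cs → ∀ e ∈ Cs, e ≠ y := fun h e he h' => h.2 (h' ▸ he)
  have m0 := hmin [(e₂, b), (e₃, c)] ∅ Cs.toFinset (by simp [*]) (by simp) p0 (by simp)
  have m1 := hmin [(e₂, b), (e₃, c), (i, i), (j, j)] {k} L (by simp [*])
    (fun e he => by simp [hCne hkD e he]) (by simp [edgePairs_cons_iff, edgePairs_nil, *])
    (fun e _ h1 h2 => by simp at h1; simp [hLm, h1])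
  have m2 := hmin [(e₂, b), (e₃, c), (i, i)] {j, k} L (by simp [*])
    (fun e he => by simp [hCne hjD e he, hCne hkD e he])
    (by simp [edgePairs_cons_iff, edgePairs_nil, *])
    (fun e _ h1 h2 => by simp at h1; simp [hLm, h1, or_assoc, or_left_comm])
  have m3 := hmin [(e₂, b), (e₃, c), (j, j)] {i, k} L (by simp [*])
    (fun e he => by simp [hCne hiD e he, hCne hkD e he])
    (by simp [edgePairs_cons_iff, edgePairs_nil, *])
    (fun e _ h1 h2 => by simp at h1; simp [hLm, h1, or_assoc, or_left_comm])
  have m4 := hmin [(e₂, b), (e₃, c), (k, k)] {i, j} L (by simp [*])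
    (fun e he => by simp [hCne hiD e he, hCne hjD e he])
    (by simp [edgePairs_cons_iff, edgePairs_nil, *])
    (fun e _ h1 h2 => by simp at h1; simp [hLm, h1, or_assoc, or_left_comm])
  have hperm : ∀ e : E, G.edgeMinor v L (D.map (fun f => (f, f)) ++ [(e₂, b), (e₃, c), (e, e)]) =
      G.edgeMinor v L ((e, e) :: (D.map (fun f => (f, f)) ++ [(e₂, b), (e₃, c)])) := by
    intro e
    apply edgeMinor_perm
    rw [show D.map (fun f => (f, f)) ++ [(e₂, b), (e₃, c), (e, e)] =
      (D.map (fun f => (f, f)) ++ [(e₂, b), (e₃, c)]) ++ [(e, e)] by simp]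
    exact List.perm_append_singleton _ _
  have hperm2 : G.edgeMinor v L
        (D.map (fun f => (f, f)) ++ [(e₂, b), (e₃, c), (i, i), (j, j)]) =
      G.edgeMinor v L
        ((i, i) :: (j, j) :: (D.map (fun f => (f, f)) ++ [(e₂, b), (e₃, c)])) := by
    apply edgeMinor_perm
    rw [show D.map (fun f => (f, f)) ++ [(e₂, b), (e₃, c), (i, i), (j, j)] =
      (D.map (fun f => (f, f)) ++ [(e₂, b), (e₃, c)]) ++ [(i, i), (j, j)] by simp]
    exact List.perm_append_comm
  rw [hperm2] at m1
  rw [hperm] at m2 m3 m4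
  rw [← m0, ← m1, ← m2, ← m3, ← m4] at hexp
  exact ⟨_, hexp⟩

end Multigraph

theorem coefficientsOf_of_starExpansion {V E : Type*} [DecidableEq V] [DecidableEq E]
    {H : GraphSum V E} {e₂ e₃ b c i j k : E} {t : MvPolynomial E ℤ}
    (hH : StarExpansion i j k (GraphSum.dodgson [e₂, e₃] [b, c] ∅ H)
      (GraphSum.dodgson [e₂, e₃, i, j] [b, c, i, j] {k} H)
      (GraphSum.dodgson [e₂, e₃, i] [b, c, i] {j, k} H)
      (GraphSum.dodgson [e₂, e₃, j] [b, c, j] {i, k} H)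
      (GraphSum.dodgson [e₂, e₃, k] [b, c, k] {i, j} H) t) :
    CoefficientsOf H e₂ e₃ b c i j k := by
  refine ⟨_, _, _, _, 0, _, _, t, rfl, rfl, rfl, rfl, ?_, by rw [hH.eq]; ring⟩
  intro P hP e he
  have h := fun P hP => hH.free P hP e he
  simp only [List.forall_mem_cons] at h
  obtain ⟨h1, h2, h3, h4, h5, -⟩ := h
  simp only [List.mem_cons, List.not_mem_nil, or_false] at hP
  rcases hP with rfl | rfl | rfl | rfl | rfl | rfl | rfl | rfl
  · exact h1
  · exact h2
  · exact h3
  · exact h4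
  · exact freeOf_zero
  · exact h1
  · exact h1
  · exact h5

/-! ### Two generic vertices -/

theorem neg_one_pow_mul_sq {R : Type*} [CommRing R] (n : ℕ) (r : R) :
    ((-1) ^ n * r) ^ 2 = r ^ 2 := by
  rw [mul_pow, ← pow_mul, mul_comm n, pow_mul, neg_one_sq, one_pow, one_mul]

namespace Multigraph

variable {V E : Type*} [DecidableEq V] [DecidableEq E] {G : Multigraph V E}

theorem HasStar.exists_other_end {V E : Type*} [DecidableEq V] {G : Multigraph V E}
    {u : V} {T : Finset E} (hu : G.HasStar u T) {e : E} (he : e ∈ T) :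
    ∃ v ∈ G.verts, u ≠ v ∧ ∀ w T', G.HasStar w T' → e ∉ T' → w ≠ v := by
  obtain ⟨heG, h⟩ := hu.mem_iff.1 he
  have hl := hu.no_loop e he
  rcases h with h | h
  · refine ⟨G.tgt e, G.tgt_mem e heG, fun h' => hl (h.trans h'), fun w T' hw hT h' => hT ?_⟩
    exact hw.mem_iff.2 ⟨heG, Or.inr h'.symm⟩
  · refine ⟨G.src e, G.src_mem e heG, fun h' => hl (h'.symm.trans h.symm),
      fun w T' hw hT h' => hT ?_⟩
    exact hw.mem_iff.2 ⟨heG, Or.inl h'.symm⟩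

theorem HasStar.ne_of_mem {V E : Type*} [DecidableEq V] {G : Multigraph V E}
    {u w : V} {T T' : Finset E} (hu : G.HasStar u T) (hw : G.HasStar w T')
    {e : E} (he : e ∈ T) (he' : e ∉ T') : u ≠ w := by
  rintro rfl
  exact he' (by rwa [← hw.incident, hu.incident])

/-- Removal of the vertices `S` removes from the edges at `w ∉ S` those that end in `S`. -/
theorem HasStar.removeVerts_set {w : V} {T : Finset E} (h : G.HasStar w T) {S : Finset V}
    (hw : w ∉ S) : (G.removeVerts S).HasStar w (T \ S.biUnion G.incidentEdges) := by
  refine ⟨Finset.mem_sdiff.2 ⟨h.mem, hw⟩, ?_, fun e he => h.no_loop e (Finset.mem_sdiff.1 he).1⟩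
  ext e
  rw [mem_incidentEdges, Finset.mem_sdiff, h.mem_iff]
  simp only [Multigraph.removeVerts, Finset.mem_filter, Finset.mem_biUnion, mem_incidentEdges]
  constructor
  · rintro ⟨⟨h1, h2, h3⟩, h4⟩
    refine ⟨⟨h1, h4⟩, ?_⟩
    rintro ⟨s, hs, -, rfl | rfl⟩
    · exact h2 hs
    · exact h3 hs
  · rintro ⟨⟨h1, h2⟩, h3⟩
    exact ⟨⟨h1, fun h => h3 ⟨_, h, h1, Or.inl rfl⟩, fun h => h3 ⟨_, h, h1, Or.inr rfl⟩⟩, h2⟩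

theorem HasStar.notMem_edges_removeVerts {V E : Type*} [DecidableEq V] {G : Multigraph V E}
    {u : V} {T : Finset E} (hu : G.HasStar u T) {e : E}
    (he : e ∈ T) {S : Finset V} (huS : u ∈ S) : e ∉ (G.removeVerts S).edges := by
  intro h
  obtain ⟨-, h1, h2⟩ := Finset.mem_filter.1 h
  rcases (hu.mem_iff.1 he).2 with rfl | rfl
  · exact h1 huS
  · exact h2 huS

theorem isQuadraticInvariant_iff {s : List E} {P₀ : MvPolynomial E ℤ}
    (h : G.IsQuadraticInvariant s P₀) (P : MvPolynomial E ℤ) :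
    G.IsQuadraticInvariant s P ↔ P = P₀ :=
  ⟨fun hP => hP.unique h, fun hP => hP ▸ h⟩

theorem isQuadraticInvariant_six_edgeMinor {u w v : V} {i j k a b c : E}
    (hu : G.HasStar u {i, j, k}) (hw : G.HasStar w {a, b, c}) (hv : v ∈ G.verts) (huv : u ≠ v)
    (hwv : w ≠ v) (huw : w ≠ u) (hn : [i, j, k, a, b, c].Nodup) {s : List E}
    (hs : s.Perm [j, b, k, c, i, a]) :
    G.IsQuadraticInvariant s
      (((G.removeVerts {u, w}).edgeMinor v [i, j, k, a, b, c].toFinset [] *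
        G.edgeMinor v [i, j, k, a, b, c].toFinset [(j, b), (k, c)]) ^ 2) := by
  rw [mul_comm]
  exact isQuadraticInvariant_six_of_perm hu hw hv huv hwv huw hn hs fun e => List.mem_toFinset

/-- The reduction for two vertices `u`, `w` of degree three without a prescribed edge to a third
one. -/
theorem isQuadraticInvariant_generic {u w x : V} {e₁ e₂ e₃ a b c i j k : E}
    (hu : G.HasStar u {e₁, e₂, e₃}) (hw : G.HasStar w {a, b, c}) (hx : G.HasStar x {i, j, k})
    (ho : G.IsOrientedAt x) (hn : [e₁, e₂, e₃, a, b, c, i, j, k].Nodup) {H : GraphSum V E}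
    (hH : H = GraphSum.minor (FreeAbelianGroup.of G) [] [e₁, a]) :
    CoefficientsOf H e₂ e₃ b c i j k ∧ ∀ s : List E, s.Perm [e₂, b, e₃, c, e₁, a] →
      G.IsQuadraticInvariant (s ++ [i, j, k])
        (reducedInvariant (G.removeVerts {u, w}) H e₂ e₃ b c i j k) := by
  have g1 := hu.mem_edges (e := e₁) (by simp)
  have g2 := hu.mem_edges (e := e₂) (by simp)
  have g3 := hu.mem_edges (e := e₃) (by simp)
  have ga := hw.mem_edges (e := a) (by simp)
  have gb := hw.mem_edges (e := b) (by simp)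
  have gc := hw.mem_edges (e := c) (by simp)
  have gi := hx.mem_edges (e := i) (by simp)
  have gj := hx.mem_edges (e := j) (by simp)
  have gk := hx.mem_edges (e := k) (by simp)
  obtain ⟨ε, hε⟩ := hx.exists_incidence ho
  have hε' : ∀ e ∈ [i, j, k], G.incidence x e = ε := fun e he => hε e (by simpa using he)
  have hn6 : [e₁, e₂, e₃, a, b, c].Nodup := hn.sublist (List.sublist_append_left _ [i, j, k])
  have hr := List.nodup_reverse.2 hn
  simp only [List.reverse_cons, List.reverse_nil, List.nil_append, List.cons_append,
    List.nodup_cons, List.mem_cons, List.not_mem_nil, or_false, not_or] at hn hr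
  -- The other end `v` of `e₂` is none of the named vertices: `e₂` is an edge of only one of them.
  obtain ⟨v, hv, huv, hvne⟩ := hu.exists_other_end (e := e₂) (by simp)
  have hwv : w ≠ v := hvne _ _ hw (by simp [hn])
  have hxv : x ≠ v := hvne _ _ hx (by simp [hn])
  have hwu : w ≠ u := hw.ne_of_mem hu (e := a) (by simp) (by simp [hr])
  have hxu : x ≠ u := hx.ne_of_mem hu (e := i) (by simp) (by simp [hr])
  have hxw : x ≠ w := hx.ne_of_mem hw (e := i) (by simp) (by simp [hr])
  obtain ⟨t, hexp⟩ := hx.starExpansion_minor hxv hv hε' [] [e₁, a] (e₂ := e₂) (e₃ := e₃) (b := b)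
    (c := c) (by simp [hn, hr]) (by simp [*])
  rw [← hH] at hexp
  refine ⟨coefficientsOf_of_starExpansion hexp, fun s hs => ?_⟩
  have h6 := isQuadraticInvariant_six_edgeMinor hu hw hv huv hwv hwu hn6 hs
  have hd : GraphSum.dodgson [e₂, e₃] [b, c] ∅ H = (-1) ^ (G.verts.card - 1) *
      G.edgeMinor v [e₁, e₂, e₃, a, b, c].toFinset [(e₂, b), (e₃, c)] :=
    hH ▸ GraphSum.dodgson_minor_eq hv [] [e₁, a] (q := [(e₂, b), (e₃, c)]) (K := ∅)
    (L := [e₁, e₂, e₃, a, b, c].toFinset) (by simp [hn]) (by simp [hn, hr]) (by simp)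
    (by simp [edgePairs_cons_iff, edgePairs_nil, *]) (by simp [*])
    (fun e _ h1 h2 => by simp at h1 h2; simp [h1, h2])
  have hx0 : (G.removeVerts {u, w}).HasStar x {i, j, k} := by
    have h := hx.removeVerts_set (S := {u, w}) (by simp [hxu, hxw])
    rwa [Finset.biUnion_insert, Finset.singleton_biUnion, hu.incident, hw.incident,
      Finset.sdiff_eq_self_iff_disjoint.2 (by simp [hn])] at h
  refine h6.reduce_oriented (by rw [hd, neg_one_pow_mul_sq]) hx0 hxv
    (Finset.mem_sdiff.2 ⟨hv, by simp [huv.symm, hwv.symm]⟩) (by simp [hn]) hε' (by simp [*]) ?_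
    (by simp [hr]) ?_ hexp

  · simp [hs.mem_iff, hr]
  · simp only [List.mem_toFinset, List.forall_mem_cons]
    exact ⟨hu.notMem_edges_removeVerts (by simp) (by simp),
      hu.notMem_edges_removeVerts (by simp) (by simp),
      hu.notMem_edges_removeVerts (by simp) (by simp),
      hw.notMem_edges_removeVerts (by simp) (by simp),
      hw.notMem_edges_removeVerts (by simp) (by simp),
      hw.notMem_edges_removeVerts (by simp) (by simp), by simp⟩

end Multigraph

/-! ### One edge between vertices of degree three -/

namespace Multigraph

variable {V E : Type*} [DecidableEq V] [DecidableEq E] {G : Multigraph V E}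

/-- After the edges at `u` and `w` are reduced, `u'` has degree two, with edges `e₄` and `e₅`. -/
theorem isQuadraticInvariant_eight {u u' w v : V} {e₁ e₂ e₃ e₄ e₅ a b c : E}
    (hu : G.HasStar u {e₁, e₂, e₃}) (hu' : G.HasStar u' {e₁, e₄, e₅}) (hw : G.HasStar w {a, b, c})
    (hn : [e₁, e₂, e₃, e₄, e₅, a, b, c].Nodup) (hv : v ∈ G.verts) (huv : u ≠ v) (huv' : u' ≠ v)
    (hwv : w ≠ v) {s : List E} (hs : s.Perm [e₂, b, e₃, c, e₁, a]) {K : Finset E}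
    (hK : K = insert e₅ (insert e₄ [e₁, e₂, e₃, a, b, c].toFinset)) :
    G.IsQuadraticInvariant (s ++ [e₄, e₅])
      (((G.removeVerts {u, u', w}).edgeMinor v K [] *
        (G.edgeMinor v K [(e₄, e₄), (e₂, b), (e₃, c)] -
          G.edgeMinor v K [(e₅, e₅), (e₂, b), (e₃, c)])) ^ 2) := by
  have g2 := hu.mem_edges (e := e₂) (by simp)
  have g3 := hu.mem_edges (e := e₃) (by simp)
  have g4 := hu'.mem_edges (e := e₄) (by simp)
  have g5 := hu'.mem_edges (e := e₅) (by simp)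
  have gb := hw.mem_edges (e := b) (by simp)
  have gc := hw.mem_edges (e := c) (by simp)
  have hr := List.nodup_reverse.2 hn
  simp only [List.reverse_cons, List.reverse_nil, List.nil_append, List.cons_append,
    List.nodup_cons, List.mem_cons, List.not_mem_nil, or_false, not_or] at hn hr
  have hwu : w ≠ u := hw.ne_of_mem hu (e := a) (by simp) (by simp [hr])
  have huu : u' ≠ u := hu'.ne_of_mem hu (e := e₄) (by simp) (by simp [hr])
  have huw : u' ≠ w := hu'.ne_of_mem hw (e := e₄) (by simp) (by simp [hn])
  have h6 := isQuadraticInvariant_six_edgeMinor hu hw hv huv hwv hwu (by simp [hn]) hs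
  have hz : G.edgeMinor v K ((e₅, e₅) :: (e₄, e₄) :: [(e₂, b), (e₃, c)]) = 0 :=
    hu'.edgeMinor_eq_zero hu huu huv' huv (by simp [hn]) (by simp) K
  rw [hK] at hz
  have hg := edgeMinor_expand_two (v := v) (p := [(e₂, b), (e₃, c)])
    (K := [e₁, e₂, e₃, a, b, c].toFinset) g4 g5 (by simp [hn]) (by simp [hr]) (by simp [hr])
    (by simp [hn, hr]) (by simp [hn, hr]) hz
  rw [← hK] at hg
  have hy : (G.removeVerts {u, w}).HasStar u' {e₄, e₅} := by
    have h := hu'.removeVerts_set (S := {u, w}) (by simp [huu, huw])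
    rwa [Finset.biUnion_insert, Finset.singleton_biUnion, hu.incident, hw.incident,
      Finset.insert_sdiff_of_mem _ (by simp),
      Finset.sdiff_eq_self_iff_disjoint.2 (by simp [hn, hr])] at h
  have h8 := h6.reduce_two_valent hy huv' g4 g5 (by simp [hn]) (by simp [hn, hr])
    (by simp [hn, hr]) (by simp [hs.mem_iff, hn, hr]) (by simp [hs.mem_iff, hn, hr]) hg ?_
  · have hset : ({u, w} : Finset V) ∪ {u'} = {u, u', w} := by
      ext y
      simp only [Finset.mem_union, Finset.mem_insert, Finset.mem_singleton]
      clear * -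
      tauto
    rwa [removeVerts_removeVerts, hset, ← hK] at h8
  · have hm : ∀ f ∈ [e₄, e₅], f ∈ K := by simp [hK]
    intro P hP f hf
    simp only [List.mem_cons, List.not_mem_nil, or_false] at hP
    rcases hP with rfl | rfl | rfl
    · exact EdgePairs.freeOf_edgeMinor
        (by simp [edgePairs_cons_iff, edgePairs_nil, *]) v (hm f hf)
    · exact EdgePairs.freeOf_edgeMinor
        (by simp [edgePairs_cons_iff, edgePairs_nil, *]) v (hm f hf)
    · exact EdgePairs.freeOf_edgeMinor
        (by simp [edgePairs_cons_iff, edgePairs_nil, *]) v (hm f hf)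

/-- The reduction for a vertex `w` and two vertices `u`, `u'` joined by `e₁`, all of degree
three. -/
theorem isQuadraticInvariant_one_edge {u u' w x : V} {e₁ e₂ e₃ e₄ e₅ a b c i j k : E}
    (hu : G.HasStar u {e₁, e₂, e₃}) (hu' : G.HasStar u' {e₁, e₄, e₅}) (hw : G.HasStar w {a, b, c})
    (hx : G.HasStar x {i, j, k}) (ho : G.IsOrientedAt x)
    (hn : [e₁, e₂, e₃, e₄, e₅, a, b, c, i, j, k].Nodup) {H : GraphSum V E}
    (hH : H = GraphSum.minor (FreeAbelianGroup.of G) [e₄] [e₁, e₅, a] -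
      GraphSum.minor (FreeAbelianGroup.of G) [e₅] [e₁, e₄, a]) :
    CoefficientsOf H e₂ e₃ b c i j k ∧ ∀ s : List E, s.Perm [e₂, b, e₃, c, e₁, a] →
      G.IsQuadraticInvariant (s ++ [e₄, e₅] ++ [i, j, k])
        (reducedInvariant (G.removeVerts {u, u', w}) H e₂ e₃ b c i j k) := by
  have g1 := hu.mem_edges (e := e₁) (by simp)
  have g2 := hu.mem_edges (e := e₂) (by simp)
  have g3 := hu.mem_edges (e := e₃) (by simp)
  have g4 := hu'.mem_edges (e := e₄) (by simp)
  have g5 := hu'.mem_edges (e := e₅) (by simp)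
  have ga := hw.mem_edges (e := a) (by simp)
  have gb := hw.mem_edges (e := b) (by simp)
  have gc := hw.mem_edges (e := c) (by simp)
  have gi := hx.mem_edges (e := i) (by simp)
  have gj := hx.mem_edges (e := j) (by simp)
  have gk := hx.mem_edges (e := k) (by simp)
  obtain ⟨ε, hε⟩ := hx.exists_incidence ho
  have hε' : ∀ e ∈ [i, j, k], G.incidence x e = ε := fun e he => hε e (by simpa using he)
  have hn8 : [e₁, e₂, e₃, e₄, e₅, a, b, c].Nodup :=
    hn.sublist (List.sublist_append_left _ [i, j, k])
  have hr := List.nodup_reverse.2 hn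
  simp only [List.reverse_cons, List.reverse_nil, List.nil_append, List.cons_append,
    List.nodup_cons, List.mem_cons, List.not_mem_nil, or_false, not_or] at hn hr
  -- The other end `v` of `e₂` is none of the named vertices: `e₂` is an edge of only one of them.
  obtain ⟨v, hv, huv, hvne⟩ := hu.exists_other_end (e := e₂) (by simp)
  have hwv : w ≠ v := hvne _ _ hw (by simp [hn])
  have huv' : u' ≠ v := hvne _ _ hu' (by simp [hn, hr])
  have hxv : x ≠ v := hvne _ _ hx (by simp [hn])
  have hxu : x ≠ u := hx.ne_of_mem hu (e := i) (by simp) (by simp [hr])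
  have hxu' : x ≠ u' := hx.ne_of_mem hu' (e := i) (by simp) (by simp [hr])
  have hxw : x ≠ w := hx.ne_of_mem hw (e := i) (by simp) (by simp [hr])
  obtain ⟨t₄, hexp4⟩ := hx.starExpansion_minor hxv hv hε' [e₄] [e₁, e₅, a] (e₂ := e₂) (e₃ := e₃)
    (b := b) (c := c) (by simp [hn, hr]) (by simp [*])
  obtain ⟨t₅, hexp5⟩ := hx.starExpansion_minor hxv hv hε' [e₅] [e₁, e₄, a] (e₂ := e₂) (e₃ := e₃)
    (b := b) (c := c) (by simp [hn, hr]) (by simp [*])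
  have hexp := hexp4.sub hexp5
  simp only [← map_sub, ← hH] at hexp
  refine ⟨coefficientsOf_of_starExpansion hexp, fun s hs => ?_⟩
  set K := insert e₅ (insert e₄ [e₁, e₂, e₃, a, b, c].toFinset) with hK
  have hKm : ∀ e, e ∈ K ↔ e = e₅ ∨ e = e₄ ∨ e = e₁ ∨ e = e₂ ∨ e = e₃ ∨ e = a ∨ e = b ∨ e = c := by
    simp [hK]
  have h8 := isQuadraticInvariant_eight hu hu' hw hn8 hv huv huv' hwv hs hK
  have d4 : GraphSum.dodgson [e₂, e₃] [b, c] ∅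
      (GraphSum.minor (FreeAbelianGroup.of G) [e₄] [e₁, e₅, a]) = (-1) ^ (G.verts.card - 1) *
      G.edgeMinor v K [(e₄, e₄), (e₂, b), (e₃, c)] :=
    GraphSum.dodgson_minor_eq hv [e₄] [e₁, e₅, a] (q := [(e₂, b), (e₃, c)]) (K := ∅)
    (L := K) (by simp [hn, hr]) (by simp [hn, hr]) (by simp)
    (by simp [edgePairs_cons_iff, edgePairs_nil, *]) (by simp [*])
    (fun e h0 h1 h2 => by simp at h0 h1 h2; simp [hKm, h0, h1, h2, or_left_comm])
  have d5 : GraphSum.dodgson [e₂, e₃] [b, c] ∅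
      (GraphSum.minor (FreeAbelianGroup.of G) [e₅] [e₁, e₄, a]) = (-1) ^ (G.verts.card - 1) *
      G.edgeMinor v K [(e₅, e₅), (e₂, b), (e₃, c)] :=
    GraphSum.dodgson_minor_eq hv [e₅] [e₁, e₄, a] (q := [(e₂, b), (e₃, c)]) (K := ∅)
    (L := K) (by simp [hn, hr]) (by simp [hn, hr]) (by simp)
    (by simp [edgePairs_cons_iff, edgePairs_nil, *]) (by simp [*])
    (fun e h0 h1 h2 => by simp at h0 h1 h2; simp [hKm, h0, h1, h2, or_left_comm])
  have hx0 : (G.removeVerts {u, u', w}).HasStar x {i, j, k} := by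
    have h := hx.removeVerts_set (S := {u, u', w}) (by simp [hxu, hxu', hxw])
    rwa [Finset.biUnion_insert, Finset.biUnion_insert, Finset.singleton_biUnion, hu.incident,
      hu'.incident, hw.incident, Finset.sdiff_eq_self_iff_disjoint.2 (by simp [hn])] at h
  refine h8.reduce_oriented
    (by rw [hH, map_sub, d4, d5, ← mul_sub, neg_one_pow_mul_sq]) hx0 hxv
    (Finset.mem_sdiff.2 ⟨hv, by simp [huv.symm, huv'.symm, hwv.symm]⟩) (by simp [hn]) hε'
    (by simp [*]) ?_ (by simp [hKm, hr]) ?_ hexp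
  · simp [hs.mem_iff, hr]
  · intro f hf
    rw [hKm] at hf
    have h1 : ∀ f ∈ ({e₁, e₂, e₃} : Finset E), f ∉ (G.removeVerts {u, u', w}).edges :=
      fun f hf => hu.notMem_edges_removeVerts hf (by simp)
    have h2 : ∀ f ∈ ({e₁, e₄, e₅} : Finset E), f ∉ (G.removeVerts {u, u', w}).edges :=
      fun f hf => hu'.notMem_edges_removeVerts hf (by simp)
    have h3 : ∀ f ∈ ({a, b, c} : Finset E), f ∉ (G.removeVerts {u, u', w}).edges :=
      fun f hf => hw.notMem_edges_removeVerts hf (by simp)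
    rcases hf with rfl | rfl | rfl | rfl | rfl | rfl | rfl | rfl
    · exact h2 _ (by simp)
    · exact h2 _ (by simp)
    · exact h1 _ (by simp)
    · exact h1 _ (by simp)
    · exact h1 _ (by simp)
    · exact h3 _ (by simp)
    · exact h3 _ (by simp)
    · exact h3 _ (by simp)

end Multigraph

/-! ### Two edges between vertices of degree three -/

namespace Multigraph

variable {V E : Type*} [DecidableEq V] [DecidableEq E] {G : Multigraph V E}

/-- After the edges at `u`, `u'` and `w` are reduced, `w'` has degree two, with edges `d` and
`e`. -/
theorem isQuadraticInvariant_ten {u u' w w' v : V} {e₁ e₂ e₃ e₄ e₅ a b c d e : E}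
    (hu : G.HasStar u {e₁, e₂, e₃}) (hu' : G.HasStar u' {e₁, e₄, e₅}) (hw : G.HasStar w {a, b, c})
    (hw' : G.HasStar w' {a, d, e})
    (hn : [e₁, e₂, e₃, e₄, e₅, a, b, c, d, e].Nodup) (hv : v ∈ G.verts) (huv : u ≠ v)
    (huv' : u' ≠ v) (hwv : w ≠ v) (hwv' : w' ≠ v) {s : List E}
    (hs : s.Perm [e₂, b, e₃, c, e₁, a]) {K : Finset E}
    (hK : K = insert e (insert d (insert e₅ (insert e₄ [e₁, e₂, e₃, a, b, c].toFinset)))) :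
    G.IsQuadraticInvariant (s ++ [e₄, e₅] ++ [d, e])
      (((G.removeVerts {u, u', w, w'}).edgeMinor v K [] *
        ((G.edgeMinor v K [(d, d), (e₄, e₄), (e₂, b), (e₃, c)] -
          G.edgeMinor v K [(d, d), (e₅, e₅), (e₂, b), (e₃, c)]) -
        (G.edgeMinor v K [(e, e), (e₄, e₄), (e₂, b), (e₃, c)] -
          G.edgeMinor v K [(e, e), (e₅, e₅), (e₂, b), (e₃, c)]))) ^ 2) := by
  have g2 := hu.mem_edges (e := e₂) (by simp)
  have g3 := hu.mem_edges (e := e₃) (by simp)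
  have g4 := hu'.mem_edges (e := e₄) (by simp)
  have g5 := hu'.mem_edges (e := e₅) (by simp)
  have gb := hw.mem_edges (e := b) (by simp)
  have gc := hw.mem_edges (e := c) (by simp)
  have gd := hw'.mem_edges (e := d) (by simp)
  have ge := hw'.mem_edges (e := e) (by simp)
  have hn8 : [e₁, e₂, e₃, e₄, e₅, a, b, c].Nodup :=
    hn.sublist (List.sublist_append_left _ [d, e])
  have hr := List.nodup_reverse.2 hn
  simp only [List.reverse_cons, List.reverse_nil, List.nil_append, List.cons_append,
    List.nodup_cons, List.mem_cons, List.not_mem_nil, or_false, not_or] at hn hr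
  have hww : w' ≠ w := hw'.ne_of_mem hw (e := d) (by simp) (by simp [hr])
  have hwu : w' ≠ u := hw'.ne_of_mem hu (e := d) (by simp) (by simp [hr])
  have hwu' : w' ≠ u' := hw'.ne_of_mem hu' (e := d) (by simp) (by simp [hr])
  set K' := insert e₅ (insert e₄ [e₁, e₂, e₃, a, b, c].toFinset) with hK'
  have h8 := isQuadraticInvariant_eight hu hu' hw hn8 hv huv huv' hwv hs hK'
  have hdK : d ∉ K' := by simp [hK', hr]
  have heK : e ∉ K' := by simp [hK', hr]
  have hg : ∀ f ∈ [e₄, e₅], G.edgeMinor v K' [(f, f), (e₂, b), (e₃, c)] =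
      G.edgeMinor v K [(d, d), (f, f), (e₂, b), (e₃, c)] * X d +
        G.edgeMinor v K [(e, e), (f, f), (e₂, b), (e₃, c)] * X e +
        G.edgeMinor v K [(f, f), (e₂, b), (e₃, c)] := by
    intro f hf
    have hq : G.EdgePairs [(e, e), (d, d), (f, f), (e₂, b), (e₃, c)] := by
      simp only [List.mem_cons, List.not_mem_nil, or_false] at hf
      rcases hf with rfl | rfl <;> simp [edgePairs_cons_iff, edgePairs_nil, *]
    -- at the edges `b`, `c` the columns are removed instead of the rows
    have hz : G.edgeMinor v K [(e, e), (d, d), (f, f), (e₂, b), (e₃, c)] = 0 := by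
      rw [← hq.edgeMinor_swap]
      refine hw'.edgeMinor_eq_zero hw hww hwv' hwv ?_ (by simp) K
      simp only [List.mem_cons, List.not_mem_nil, or_false] at hf
      rcases hf with rfl | rfl <;> simp [hn, hr]
    rw [hK] at hz ⊢
    refine edgeMinor_expand_two gd ge (by simp [hn]) ?_ ?_ hdK heK hz <;>
    · simp only [List.mem_cons, List.not_mem_nil, or_false] at hf
      rcases hf with rfl | rfl <;> simp [hr]
  have hy : (G.removeVerts {u, u', w}).HasStar w' {d, e} := by
    have h := hw'.removeVerts_set (S := {u, u', w}) (by simp [hwu, hwu', hww])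
    rwa [Finset.biUnion_insert, Finset.biUnion_insert, Finset.singleton_biUnion, hu.incident,
      hu'.incident, hw.incident, Finset.insert_sdiff_of_mem _ (by simp),
      Finset.sdiff_eq_self_iff_disjoint.2 (by simp [hn])] at h
  have hg' : G.edgeMinor v K' [(e₄, e₄), (e₂, b), (e₃, c)] -
      G.edgeMinor v K' [(e₅, e₅), (e₂, b), (e₃, c)] =
      (G.edgeMinor v K [(d, d), (e₄, e₄), (e₂, b), (e₃, c)] -
        G.edgeMinor v K [(d, d), (e₅, e₅), (e₂, b), (e₃, c)]) * X d +
      (G.edgeMinor v K [(e, e), (e₄, e₄), (e₂, b), (e₃, c)] -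
        G.edgeMinor v K [(e, e), (e₅, e₅), (e₂, b), (e₃, c)]) * X e +
      (G.edgeMinor v K [(e₄, e₄), (e₂, b), (e₃, c)] -
        G.edgeMinor v K [(e₅, e₅), (e₂, b), (e₃, c)]) := by
    rw [hg e₄ (by simp), hg e₅ (by simp)]
    ring
  have h10 := h8.reduce_two_valent hy hwv' gd ge (by simp [hn]) hdK heK
    (by simp [hs.mem_iff, hr]) (by simp [hs.mem_iff, hr]) hg' ?_
  · have hset : ({u, u', w} : Finset V) ∪ {w'} = {u, u', w, w'} := by
      ext y
      simp only [Finset.mem_union, Finset.mem_insert, Finset.mem_singleton]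
      clear * -
      tauto
    rwa [removeVerts_removeVerts, hset, ← hK] at h10
  · have hm : ∀ f ∈ [d, e], f ∈ K := by simp [hK]
    have q1 : ∀ y z, y ∈ [d, e] → z ∈ [e₄, e₅] →
        G.EdgePairs [(y, y), (z, z), (e₂, b), (e₃, c)] := by
      intro y z hy hz
      simp only [List.mem_cons, List.not_mem_nil, or_false] at hy hz
      rcases hy with rfl | rfl <;> rcases hz with rfl | rfl <;>
      simp [edgePairs_cons_iff, edgePairs_nil, *]
    intro P hP f hf
    have hf' := hm f hf
    simp only [List.mem_cons, List.not_mem_nil, or_false] at hP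
    rcases hP with rfl | rfl | rfl
    · exact ((q1 d e₄ (by simp) (by simp)).freeOf_edgeMinor v hf').sub
        ((q1 d e₅ (by simp) (by simp)).freeOf_edgeMinor v hf')
    · exact ((q1 e e₄ (by simp) (by simp)).freeOf_edgeMinor v hf').sub
        ((q1 e e₅ (by simp) (by simp)).freeOf_edgeMinor v hf')
    · exact ((edgePairs_cons_iff.1 (q1 d e₄ (by simp) (by simp))).2.freeOf_edgeMinor v hf').sub
        ((edgePairs_cons_iff.1 (q1 d e₅ (by simp) (by simp))).2.freeOf_edgeMinor v hf')

/-- The reduction for vertices `u`, `u'` joined by `e₁` and `w`, `w'` joined by `a`, all of degree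
three. -/
theorem isQuadraticInvariant_two_edges {u u' w w' x : V} {e₁ e₂ e₃ e₄ e₅ a b c d e i j k : E}
    (hu : G.HasStar u {e₁, e₂, e₃}) (hu' : G.HasStar u' {e₁, e₄, e₅}) (hw : G.HasStar w {a, b, c})
    (hw' : G.HasStar w' {a, d, e}) (hx : G.HasStar x {i, j, k}) (ho : G.IsOrientedAt x)
    (hn : [e₁, e₂, e₃, e₄, e₅, a, b, c, d, e, i, j, k].Nodup) {H : GraphSum V E}
    (hH : H = GraphSum.minor (FreeAbelianGroup.of G) [e₄, d] [e₁, e₅, a, e]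
          - GraphSum.minor (FreeAbelianGroup.of G) [e₅, d] [e₁, e₄, a, e]
          - GraphSum.minor (FreeAbelianGroup.of G) [e₄, e] [e₁, e₅, a, d]
          + GraphSum.minor (FreeAbelianGroup.of G) [e₅, e] [e₁, e₄, a, d]) :
    CoefficientsOf H e₂ e₃ b c i j k ∧ ∀ s : List E, s.Perm [e₂, b, e₃, c, e₁, a] →
      G.IsQuadraticInvariant (s ++ [e₄, e₅, d, e] ++ [i, j, k])
        (reducedInvariant (G.removeVerts {u, u', w, w'}) H e₂ e₃ b c i j k) := by
  have g1 := hu.mem_edges (e := e₁) (by simp)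
  have g2 := hu.mem_edges (e := e₂) (by simp)
  have g3 := hu.mem_edges (e := e₃) (by simp)
  have g4 := hu'.mem_edges (e := e₄) (by simp)
  have g5 := hu'.mem_edges (e := e₅) (by simp)
  have ga := hw.mem_edges (e := a) (by simp)
  have gb := hw.mem_edges (e := b) (by simp)
  have gc := hw.mem_edges (e := c) (by simp)
  have gd := hw'.mem_edges (e := d) (by simp)
  have ge := hw'.mem_edges (e := e) (by simp)
  have gi := hx.mem_edges (e := i) (by simp)
  have gj := hx.mem_edges (e := j) (by simp)
  have gk := hx.mem_edges (e := k) (by simp)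
  obtain ⟨ε, hε⟩ := hx.exists_incidence ho
  have hε' : ∀ e ∈ [i, j, k], G.incidence x e = ε := fun e he => hε e (by simpa using he)
  have hn10 : [e₁, e₂, e₃, e₄, e₅, a, b, c, d, e].Nodup :=
    hn.sublist (List.sublist_append_left _ [i, j, k])
  have hr := List.nodup_reverse.2 hn
  simp only [List.reverse_cons, List.reverse_nil, List.nil_append, List.cons_append,
    List.nodup_cons, List.mem_cons, List.not_mem_nil, or_false, not_or] at hn hr
  -- The other end `v` of `e₂` is none of the named vertices: `e₂` is an edge of only one of them.
  obtain ⟨v, hv, huv, hvne⟩ := hu.exists_other_end (e := e₂) (by simp)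
  have hwv : w ≠ v := hvne _ _ hw (by simp [hn])
  have hwv' : w' ≠ v := hvne _ _ hw' (by simp [hn])
  have huv' : u' ≠ v := hvne _ _ hu' (by simp [hn, hr])
  have hxv : x ≠ v := hvne _ _ hx (by simp [hn])
  have hxu : x ≠ u := hx.ne_of_mem hu (e := i) (by simp) (by simp [hr])
  have hxu' : x ≠ u' := hx.ne_of_mem hu' (e := i) (by simp) (by simp [hr])
  have hxw : x ≠ w := hx.ne_of_mem hw (e := i) (by simp) (by simp [hr])
  have hxw' : x ≠ w' := hx.ne_of_mem hw' (e := i) (by simp) (by simp [hr])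
  obtain ⟨t₁, hexp1⟩ := hx.starExpansion_minor hxv hv hε' [e₄, d] [e₁, e₅, a, e] (e₂ := e₂)
    (e₃ := e₃) (b := b) (c := c) (by simp [hn, hr]) (by simp [*])
  obtain ⟨t₂, hexp2⟩ := hx.starExpansion_minor hxv hv hε' [e₅, d] [e₁, e₄, a, e] (e₂ := e₂)
    (e₃ := e₃) (b := b) (c := c) (by simp [hn, hr]) (by simp [*])
  obtain ⟨t₃, hexp3⟩ := hx.starExpansion_minor hxv hv hε' [e₄, e] [e₁, e₅, a, d] (e₂ := e₂)
    (e₃ := e₃) (b := b) (c := c) (by simp [hn, hr]) (by simp [*])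
  obtain ⟨t₄, hexp4⟩ := hx.starExpansion_minor hxv hv hε' [e₅, e] [e₁, e₄, a, d] (e₂ := e₂)
    (e₃ := e₃) (b := b) (c := c) (by simp [hn, hr]) (by simp [*])
  have hexp := ((hexp1.sub hexp2).sub hexp3).add hexp4
  simp only [← map_sub, ← map_add, ← hH] at hexp
  refine ⟨coefficientsOf_of_starExpansion hexp, fun s hs => ?_⟩
  set K := insert e (insert d (insert e₅ (insert e₄ [e₁, e₂, e₃, a, b, c].toFinset))) with hK
  have hKm : ∀ f, f ∈ K ↔ f = e ∨ f = d ∨ f = e₅ ∨ f = e₄ ∨ f = e₁ ∨ f = e₂ ∨ f = e₃ ∨ f = a ∨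
      f = b ∨ f = c := by
    simp [hK]
  have h10 := isQuadraticInvariant_ten hu hu' hw hw' hn10 hv huv huv' hwv hwv' hs hK
  have hd : ∀ y z y' z' : E, [y, y', e₂, b, e₃, c, e₁, a, z, z'].Nodup →
      (∀ f, f ∈ [y, z] ↔ f ∈ [e₄, e₅]) → (∀ f, f ∈ [y', z'] ↔ f ∈ [d, e]) →
      GraphSum.dodgson [e₂, e₃] [b, c] ∅
        (GraphSum.minor (FreeAbelianGroup.of G) [y, y'] [e₁, z, a, z']) =
      (-1) ^ (G.verts.card - 1) * G.edgeMinor v K [(y', y'), (y, y), (e₂, b), (e₃, c)] := by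
    intro y z y' z' hny hyz hyz'
    have hr' := List.nodup_reverse.2 hny
    simp only [List.reverse_cons, List.reverse_nil, List.nil_append, List.cons_append,
      List.nodup_cons, List.mem_cons, List.not_mem_nil, or_false, not_or] at hny hr'
    have hyG : y ∈ G.edges ∧ z ∈ G.edges := by
      have h1 := (hyz y).1 (by simp)
      have h2 := (hyz z).1 (by simp)
      simp only [List.mem_cons, List.not_mem_nil, or_false] at h1 h2
      constructor
      · rcases h1 with rfl | rfl <;> assumption
      · rcases h2 with rfl | rfl <;> assumption
    have hyG' : y' ∈ G.edges ∧ z' ∈ G.edges := by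
      have h1 := (hyz' y').1 (by simp)
      have h2 := (hyz' z').1 (by simp)
      simp only [List.mem_cons, List.not_mem_nil, or_false] at h1 h2
      constructor
      · rcases h1 with rfl | rfl <;> assumption
      · rcases h2 with rfl | rfl <;> assumption
    rw [edgeMinor_perm (List.Perm.swap (y, y) (y', y') [(e₂, b), (e₃, c)])]
    refine GraphSum.dodgson_minor_eq hv [y, y'] [e₁, z, a, z'] (q := [(e₂, b), (e₃, c)]) (K := ∅)
      (L := K) (by simp [hny, hr']) (by simp [hny, hr']) (by simp)
      (by simp [edgePairs_cons_iff, edgePairs_nil, hny, g2, g3, gb, gc])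
      (by simp [hyG, hyG', g1, ga]) ?_
    intro f h0 h1 h2
    have h3 := hyz f
    have h4 := hyz' f
    rw [hKm]
    simp only [List.map_cons, List.map_nil, List.mem_cons, List.not_mem_nil, or_false, not_or,
      Finset.notMem_empty, false_or] at h0 h1 h2 h3 h4 ⊢
    clear * - h0 h1 h2 h3 h4
    tauto
  have d1 := hd e₄ e₅ d e (by simp [hn, hr]) (by simp) (by simp)
  have d2 := hd e₅ e₄ d e (by simp [hn, hr]) (by simp [or_comm]) (by simp)
  have d3 := hd e₄ e₅ e d (by simp [hn, hr]) (by simp) (by simp [or_comm])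
  have d4 := hd e₅ e₄ e d (by simp [hn, hr]) (by simp [or_comm]) (by simp [or_comm])
  have hx0 : (G.removeVerts {u, u', w, w'}).HasStar x {i, j, k} := by
    have h := hx.removeVerts_set (S := {u, u', w, w'}) (by simp [hxu, hxu', hxw, hxw'])
    rwa [Finset.biUnion_insert, Finset.biUnion_insert, Finset.biUnion_insert,
      Finset.singleton_biUnion, hu.incident, hu'.incident, hw.incident, hw'.incident,
      Finset.sdiff_eq_self_iff_disjoint.2 (by simp [hn])] at h
  have hfin := h10.reduce_oriented (H := H) (e₂ := e₂) (e₃ := e₃) (b := b) (c := c)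
    (by
      rw [hH, map_add, map_sub, map_sub, d1, d2, d3, d4, ← mul_sub, ← mul_sub, ← mul_add,
        neg_one_pow_mul_sq]
      ring) hx0 hxv
    (Finset.mem_sdiff.2 ⟨hv, by simp [huv.symm, huv'.symm, hwv.symm, hwv'.symm]⟩) (by simp [hn])
    hε' (by simp [*]) ?_ (by simp [hKm, hr]) ?_ hexp
  · simpa using hfin
  · simp [hs.mem_iff, hr]
  · intro f hf
    rw [hKm] at hf
    have h1 : ∀ f ∈ ({e₁, e₂, e₃} : Finset E), f ∉ (G.removeVerts {u, u', w, w'}).edges :=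
      fun f hf => hu.notMem_edges_removeVerts hf (by simp)
    have h2 : ∀ f ∈ ({e₁, e₄, e₅} : Finset E), f ∉ (G.removeVerts {u, u', w, w'}).edges :=
      fun f hf => hu'.notMem_edges_removeVerts hf (by simp)
    have h3 : ∀ f ∈ ({a, b, c} : Finset E), f ∉ (G.removeVerts {u, u', w, w'}).edges :=
      fun f hf => hw.notMem_edges_removeVerts hf (by simp)
    have h4 : ∀ f ∈ ({a, d, e} : Finset E), f ∉ (G.removeVerts {u, u', w, w'}).edges :=
      fun f hf => hw'.notMem_edges_removeVerts hf (by simp)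
    rcases hf with rfl | rfl | rfl | rfl | rfl | rfl | rfl | rfl | rfl | rfl
    · exact h4 _ (by simp)
    · exact h4 _ (by simp)
    · exact h2 _ (by simp)
    · exact h2 _ (by simp)
    · exact h1 _ (by simp)
    · exact h1 _ (by simp)
    · exact h1 _ (by simp)
    · exact h3 _ (by simp)
    · exact h3 _ (by simp)
    · exact h3 _ (by simp)

end Multigraph

theorem lemma7p2 {V E : Type*} [DecidableEq V] [DecidableEq E] (G : Multigraph V E)
    (e₁ e₂ e₃ e₄ e₅ a b c d e A B C : E) (x : V)
    (hx : G.IsThreeValent x A B C) (ho : G.IsOrientedAt x) :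
    -- (1) two generic vertices `123` and `abc`; `n = 9`
    (∀ u w : V, G.IsThreeValent u e₁ e₂ e₃ → G.IsThreeValent w a b c →
      [e₁, e₂, e₃, a, b, c, A, B, C].Nodup →
      ∀ G₀ : Multigraph V E, G₀ = G.removeVerts {u, w} →
      ∀ H : GraphSum V E, H = GraphSum.minor (FreeAbelianGroup.of G) [] [e₁, a] →
        CoefficientsOf H e₂ e₃ b c A B C ∧
        ∀ s : List E, s.Perm [e₂, b, e₃, c, e₁, a] → ∀ P : MvPolynomial E ℤ,
          G.IsQuadraticInvariant (s ++ [A, B, C]) P ↔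
            P = reducedInvariant G₀ H e₂ e₃ b c A B C) ∧
    -- (2) the edge `1` joins the vertices `123` and `145`, and `abc` is generic; `n = 11`
    (∀ u u' w : V, G.IsThreeValent u e₁ e₂ e₃ → G.IsThreeValent u' e₁ e₄ e₅ →
      G.IsThreeValent w a b c →
      [e₁, e₂, e₃, e₄, e₅, a, b, c, A, B, C].Nodup →
      ∀ G₀ : Multigraph V E, G₀ = G.removeVerts {u, u', w} →
      ∀ H : GraphSum V E,
        H = GraphSum.minor (FreeAbelianGroup.of G) [e₄] [e₁, e₅, a]
          - GraphSum.minor (FreeAbelianGroup.of G) [e₅] [e₁, e₄, a] →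
        CoefficientsOf H e₂ e₃ b c A B C ∧
        ∀ s : List E, s.Perm [e₂, b, e₃, c, e₁, a] → ∀ P : MvPolynomial E ℤ,
          G.IsQuadraticInvariant (s ++ [e₄, e₅] ++ [A, B, C]) P ↔
            P = reducedInvariant G₀ H e₂ e₃ b c A B C) ∧
    -- (3) the edge `1` joins `123` and `145`, and the edge `a` joins `abc` and `ade`; `n = 13`
    (∀ u u' w w' : V, G.IsThreeValent u e₁ e₂ e₃ → G.IsThreeValent u' e₁ e₄ e₅ →
      G.IsThreeValent w a b c → G.IsThreeValent w' a d e →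
      [e₁, e₂, e₃, e₄, e₅, a, b, c, d, e, A, B, C].Nodup →
      ∀ G₀ : Multigraph V E, G₀ = G.removeVerts {u, u', w, w'} →
      ∀ H : GraphSum V E,
        H = GraphSum.minor (FreeAbelianGroup.of G) [e₄, d] [e₁, e₅, a, e]
          - GraphSum.minor (FreeAbelianGroup.of G) [e₅, d] [e₁, e₄, a, e]
          - GraphSum.minor (FreeAbelianGroup.of G) [e₄, e] [e₁, e₅, a, d]
          + GraphSum.minor (FreeAbelianGroup.of G) [e₅, e] [e₁, e₄, a, d] →
        CoefficientsOf H e₂ e₃ b c A B C ∧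
        ∀ s : List E, s.Perm [e₂, b, e₃, c, e₁, a] → ∀ P : MvPolynomial E ℤ,
          G.IsQuadraticInvariant (s ++ [e₄, e₅, d, e] ++ [A, B, C]) P ↔
            P = reducedInvariant G₀ H e₂ e₃ b c A B C) := by
  refine ⟨fun u w hu hw hn G₀ hG₀ H hH => ?_, fun u u' w hu hu' hw hn G₀ hG₀ H hH => ?_,
    fun u u' w w' hu hu' hw hw' hn G₀ hG₀ H hH => ?_⟩
  · obtain ⟨h1, h2⟩ := Multigraph.isQuadraticInvariant_generic hu.hasStar hw.hasStar hx.hasStar ho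
      hn hH
    exact ⟨h1, fun s hs => Multigraph.isQuadraticInvariant_iff (hG₀ ▸ h2 s hs)⟩
  · obtain ⟨h1, h2⟩ := Multigraph.isQuadraticInvariant_one_edge hu.hasStar hu'.hasStar hw.hasStar
      hx.hasStar ho hn hH
    exact ⟨h1, fun s hs => Multigraph.isQuadraticInvariant_iff (hG₀ ▸ h2 s hs)⟩
  · obtain ⟨h1, h2⟩ := Multigraph.isQuadraticInvariant_two_edges hu.hasStar hu'.hasStar hw.hasStar
      hw'.hasStar hx.hasStar ho hn hH
    exact ⟨h1, fun s hs => Multigraph.isQuadraticInvariant_iff (hG₀ ▸ h2 s hs)⟩
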